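/- **Setting.** Let $\mathcal A\subset\mathbb R^d$ be a finite set of atoms, $D=\mathrm{conv}(\mathcal A)$, $f:\mathbb R^d\to\mathbb R$ convex on $D$ and differentiable at the points of $D$, $x^*\in D$ a minimizer of $f$ over $D$, $\epsilon\ge 0$, and $h_t=f(x^{(t)})-f(x^*)$. For $x\in D$ let $\mathcal S_x$ be the set of all $S\subseteq\mathcal A$ such that $x$ is a convex combination of all the elements of $S$ with positive coefficients (the possible active sets of $x$). *Constants.* $M=\mathrm{diam}(D)$. The pyramidal width is $$\delta=\inf_{K,\,x,\,r}\ \min_{S\in\mathcal S_x,\,S\subseteq K}\ \max_{s\in K\cap\mathcal A,\,v\in S}\Big\langle \tfrac{r}{\|r\|},s-v\Big\rangle ,$$ over the faces $K$ of $D$, $x\in K$ and $0\ne r\in\mathrm{cone}(K-x)$. Further $$C_f=\sup_{x,s\in D,\ \gamma\in(0,1],\ y=x+\gamma(s-x)}\tfrac{2}{\gamma^2}\big(f(y)-f(x)-\langle\nabla f(x),y-x\rangle\big),$$ $$C_f^A=\sup_{x,s,v\in D,\ \gamma\in(0,1],\ y=x+\gamma(s-v)}\tfrac{2}{\gamma^2}\big(f(y)-f(x)-\gamma\langle\nabla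 f(x),s-v\rangle\big),$$ $$\mu_f^A=\inf_{x,y\in D,\ \langle\nabla f(x),y-x\rangle<0}\tfrac{2}{\gamma^A(x,y)^2}\big(f(y)-f(x)-\langle\nabla f(x),y-x\rangle\big),\qquad \gamma^A(x,y)=\frac{\langle-\nabla f(x),y-x\rangle}{\langle-\nabla f(x),s_f(x)-v_f(x)\rangle},$$ where $s_f(x)\in\arg\min_{a\in\mathcal A}\langle\nabla f(x),a\rangle$ and $v_f(x)$ has the smallest value of $\langle\nabla f(x),\cdot\rangle$ among the away atoms $v_S(x)\in\arg\max_{v\in S}\langle\nabla f(x),v\rangle$, $S\in\mathcal S_x$. *Algorithms.* In iteration $t$ every method picks $s_t\in\arg\min_{a\in\mathcal A}\langle\nabla f(x^{(t)}),a\rangle$ and stops if $\langle-\nabla f(x^{(t)}),s_t-x^{(t)}\rangle\le\epsilon$; the claims are about the iterations performed before stopping. - *Away-steps FW (AFW)* and *pairwise FW (PFW)* start at an atom with weight $1$ and maintain weights $\alpha$ with $x^{(t)}=\sum_v\alpha_v v$ and active set $S^{(t)}=\{v:\alpha_v>0\}$. Let $v_t\in\arg\max_{v\in S^{(t)}}\langle\nabla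 f(x^{(t)}),v\rangle$. AFW uses $d_t=s_t-x^{(t)}$, $\gamma_{\max}=1$ if $\langle-\nabla f(x^{(t)}),s_t-x^{(t)}\rangle\ge\langle-\nabla f(x^{(t)}),x^{(t)}-v_t\rangle$, and $d_t=x^{(t)}-v_t$, $\gamma_{\max}=\alpha_{v_t}/(1-\alpha_{v_t})$ otherwise. PFW uses $d_t=s_t-v_t$, $\gamma_{\max}=\alpha_{v_t}$. Then $\gamma_t\in\arg\min_{\gamma\in[0,\gamma_{\max}]}f(x^{(t)}+\gamma d_t)$, $x^{(t+1)}=x^{(t)}+\gamma_td_t$, and the weights are updated accordingly. - *Fully-corrective FW (FCFW) with approximate correction* maintains sets $V^{(t)}\subseteq\mathcal A$ containing an active set $S^{(t)}$ of $x^{(t)}$; $x^{(t+1)}$ is any point with $f(x^{(t+1)})\le\min_{\gamma\in[0,1]}f(x^{(t)}+\gamma(s_t-x^{(t)}))$ whose away gap $\max_{v\in S^{(t+1)}}\langle-\nabla f(x^{(t+1)}),x^{(t+1)}-v\rangle$ is at most $\epsilon$. The starting point also has away gap at most $\epsilon$ (for instance, it is an atom). With *exact correction*, $x^{(t+1)}$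 minimizes $f$ over $\mathrm{conv}(V^{(t)}\cup\{s_t\})$, $S^{(t+1)}\subseteq V^{(t)}\cup\{s_t\}$, and the starting point has away gap at most $0$. - *Wolfe's min-norm-point algorithm (MNP)* starts at an atom, with $V^{(t)}=S^{(t)}$. Its correction starts from $z=x^{(t)}$, $S=S^{(t)}\cup\{s_t\}$ and repeats: let $y$ minimize $f$ over the affine hull of $S$; if $y$ is in the relative interior of $\mathrm{conv}(S)$, return $(x^{(t+1)},S^{(t+1)})=(y,S)$; otherwise replace $z$ by the last point of the segment from $z$ to $y$ that lies in $\mathrm{conv}(S)$, and $S$ by the active atoms of this point. For MNP, $f$ is assumed to be convex on the affine hull of $\mathcal A$. *Good steps.* A step is a drop step if $|S^{(t+1)}|<|S^{(t)}|$, and a swap step (PFW) if $\gamma_t=\gamma_{\max}$ and $|S^{(t+1)}|=|S^{(t)}|$. For AFW and PFW a step is good if $\gamma_t<\gamma_{\max}$ or $\gamma_{\max}\ge1$; for MNP, if it is not a drop step; for FCFW every step is good. Let $k(t)$ be the number of good steps among the first $t$ steps. **Theorem.** 1. (*Counting.*) For AFW every step that is not a drop step is good, and for PFW every step that is neither a drop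 nor a swap step is good. For AFW, PFW and MNP at most $t/2$ of the first $t$ steps are drop steps. For PFW there are at most $3|\mathcal A|!$ swap steps in any run of consecutive steps without a step with $\gamma_t<\gamma_{\max}$. Moreover $k(t)=t$ for FCFW, $k(t)\ge t/2$ for AFW and MNP, and $k(t)\ge t/(3|\mathcal A|!+1)$ for PFW. 2. (*Affine-invariant form.*) Assume $C_f^A<\infty$ for AFW and PFW, and $C_f<\infty$ for FCFW and MNP. Then $h_{t+1}\le(1-\rho_f)h_t$ at every good step and $h_t\le h_0\exp(-\rho_f k(t))$, with $\rho_f=\frac{\mu_f^A}{4C_f^A}$ for AFW, $\rho_f=\min\{\frac12,\frac{\mu_f^A}{C_f^A}\}$ for PFW, $\rho_f=\frac{\mu_f^A}{4C_f}$ for FCFW with approximate correction, and $\rho_f=\min\{\frac12,\frac{\mu_f^A}{C_f}\}$ for MNP and for FCFW with exact correction (a quotient with denominator $0$ is read as $0$). In particular $h_t\le h_0\exp(-\frac12\rho_ft)$ for AFW and MNP. Also when $\mu_f^A=0$, $h_t\le\frac{4C}{k(t)+4}$ with $C=2C_f^A+h_0$ for AFW and $C=2C_f+h_0$ for FCFW,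 and, when $k(t)\ge1$, $h_t\le\frac{2C}{k(t)+2}$ with $C=C_f^A$ for PFW and $C=C_f$ for MNP. 3. (*Euclidean form.*) Assume that $f$ is $\mu$-strongly convex on $D$ ($\mu\ge0$) and that $\nabla f$ is $L$-Lipschitz on $D$; for AFW and PFW, that $f$ is differentiable with $L$-Lipschitz gradient on $D+D-D$. Then for AFW, PFW, FCFW (with approximate correction) and MNP, $h_{t+1}\le(1-\rho)h_t$ at every good step and $h_t\le h_0\exp(-\rho k(t))$, where $\rho=\frac{\mu}{4L}\left(\frac{\delta}{M}\right)^2$ (read as $0$ if $L=0$). Also when $\mu=0$, $h_t=O(1/k(t))$: the sublinear bounds of part 2 hold with $LM^2$ in place of $C_f^A$ and $C_f$. -/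

import Mathlib

open scoped Pointwise InnerProductSpace

noncomputable section

namespace FrankWolfe

variable {E : Type*} [NormedAddCommGroup E] [InnerProductSpace ℝ E] [CompleteSpace E]

/-- The domain: the polytope spanned by the finite set of atoms. -/
def domain (A : Finset E) : Set E := convexHull ℝ (A : Set E)

/-- The enlarged domain `D + (D - D)`. -/
def awayDomain (A : Finset E) : Set E := domain A + (domain A - domain A)

/-- The possible active sets of `x`: the sets `S` of atoms such that `x` is a proper
convex combination (all coefficients nonzero) of all the elements of `S`. -/
def activeSets (A : Finset E) (x : E) : Set (Finset E) :=
  {S | S ⊆ A ∧ ∃ w : E → ℝ, (∀ v ∈ S, 0 < w v) ∧ ∑ v ∈ S, w v = 1 ∧ ∑ v ∈ S, w v • v = x}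

/-! ### Pyramidal width -/

/-- Pyramidal directional width of `V` with respect to the direction `r` and base point `x`. -/
def pyramidalDirWidth (V : Finset E) (r x : E) : ℝ :=
  sInf {w | ∃ S ∈ activeSets V x,
    w = sSup {c | ∃ s ∈ V, ∃ v ∈ S, c = ⟪(1 / ‖r‖) • r, s - v⟫_ℝ}}

/-- The directions that are feasible from `x` for the convex set `K` (with `x ∈ K`). -/
def feasibleCone (K : Set E) (x : E) : Set E :=
  {r | ∃ c : ℝ, 0 ≤ c ∧ ∃ y ∈ K, r = c • (y - x)}

open Classical in
/-- Pyramidal width: the smallest pyramidal directional width over all the faces `K` of the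
polytope, the points `x ∈ K`, and the nonzero directions feasible from `x` in `K`. -/
def pyramidalWidth (A : Finset E) : ℝ :=
  sInf {w | ∃ K : Set E, IsExposed ℝ (domain A) K ∧ ∃ x ∈ K, ∃ r ∈ feasibleCone K x, r ≠ 0 ∧
    w = pyramidalDirWidth (A.filter (fun a => a ∈ K)) r x}

/-! ### Frank-Wolfe atoms and away atoms -/

/-- `s` is an answer of the linear minimization oracle for the gradient at `x`. -/
def IsFWAtom (A : Finset E) (f : E → ℝ) (x s : E) : Prop :=
  s ∈ A ∧ ∀ a ∈ A, ⟪gradient f x, s⟫_ℝ ≤ ⟪gradient f x, a⟫_ℝ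

/-- `v` is an away atom at `x` for the active set `S`. -/
def IsAwayAtom (f : E → ℝ) (x : E) (S : Finset E) (v : E) : Prop :=
  v ∈ S ∧ ∀ a ∈ S, ⟪gradient f x, a⟫_ℝ ≤ ⟪gradient f x, v⟫_ℝ

/-- `v` is a worst-case away atom at `x`, over all possible active sets of `x`. -/
def IsWorstAwayAtom (A : Finset E) (f : E → ℝ) (x v : E) : Prop :=
  (∃ S ∈ activeSets A x, IsAwayAtom f x S v) ∧
    ∀ S ∈ activeSets A x, ∀ w, IsAwayAtom f x S w →
      ⟪gradient f x, v⟫_ℝ ≤ ⟪gradient f x, w⟫_ℝ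

/-! ### Affine invariant constants -/

/-- The values whose supremum is the curvature constant `C_f`. -/
def curvatureSet (A : Finset E) (f : E → ℝ) : Set ℝ :=
  {c | ∃ x ∈ domain A, ∃ s ∈ domain A, ∃ γ ∈ Set.Ioc (0 : ℝ) 1, ∃ y : E,
    y = x + γ • (s - x) ∧ c = 2 / γ ^ 2 * (f y - f x - ⟪gradient f x, y - x⟫_ℝ)}

/-- The curvature constant `C_f`. -/
def curvature (A : Finset E) (f : E → ℝ) : ℝ := sSup (curvatureSet A f)

/-- The values whose supremum is the away curvature constant. -/
def awayCurvatureSet (A : Finset E) (f : E → ℝ) : Set ℝ :=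
  {c | ∃ x ∈ domain A, ∃ s ∈ domain A, ∃ v ∈ domain A, ∃ γ ∈ Set.Ioc (0 : ℝ) 1, ∃ y : E,
    y = x + γ • (s - v) ∧ c = 2 / γ ^ 2 * (f y - f x - γ * ⟪gradient f x, s - v⟫_ℝ)}

/-- The away curvature constant `C_f^A`. -/
def awayCurvature (A : Finset E) (f : E → ℝ) : ℝ := sSup (awayCurvatureSet A f)

/-- The step-size quantity `γ^A(x, y)`, for a Frank-Wolfe atom `s` and a worst-case away
atom `v` at `x` (its value does not depend on how ties among such atoms are broken). -/
def awayStepSize (f : E → ℝ) (x y s v : E) : ℝ :=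
  ⟪-gradient f x, y - x⟫_ℝ / ⟪-gradient f x, s - v⟫_ℝ

/-- The geometric strong convexity constant `μ_f^A`. -/
def geometricStrongConvexity (A : Finset E) (f : E → ℝ) : ℝ :=
  sInf {c | ∃ x ∈ domain A, ∃ y ∈ domain A, ∃ s v : E, IsFWAtom A f x s ∧
    IsWorstAwayAtom A f x v ∧ ⟪gradient f x, y - x⟫_ℝ < 0 ∧
    c = 2 / awayStepSize f x y s v ^ 2 * (f y - f x - ⟪gradient f x, y - x⟫_ℝ)}

/-! ### Away-steps and pairwise Frank-Wolfe -/

/-- The quantities that the line-search variants compute: iterates, weights of the atoms,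
Frank-Wolfe atoms, away atoms, directions, maximal step-sizes and step-sizes. -/
structure LineSearchTrace (E : Type*) where
  /-- iterates -/
  x : ℕ → E
  /-- weights of the atoms -/
  weight : ℕ → E → ℝ
  /-- Frank-Wolfe atoms -/
  s : ℕ → E
  /-- away atoms -/
  v : ℕ → E
  /-- search directions -/
  d : ℕ → E
  /-- maximal step-sizes -/
  γmax : ℕ → ℝ
  /-- step-sizes -/
  γ : ℕ → ℝ

open Classical in
/-- The active set of iteration `t`: the atoms of positive weight. -/
def LineSearchTrace.active (τ : LineSearchTrace E) (A : Finset E) (t : ℕ) : Finset E :=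
  A.filter (fun a => 0 < τ.weight t a)

open Classical in
/-- The run starts at an atom, which gets all the weight. -/
def LineSearchTrace.Starts (τ : LineSearchTrace E) (A : Finset E) : Prop :=
  τ.x 0 ∈ A ∧ ∀ a, τ.weight 0 a = if a = τ.x 0 then 1 else 0

/-- What an iteration of the two line-search variants has in common, when the stopping
test of tolerance `ε` fails: the choice of the two atoms, the line-search, the update. -/
structure LineSearchTrace.CommonStep (τ : LineSearchTrace E) (A : Finset E) (f : E → ℝ)
    (ε : ℝ) (t : ℕ) : Prop where
  fwAtom : IsFWAtom A f (τ.x t) (τ.s t)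
  awayAtom : IsAwayAtom f (τ.x t) (τ.active A t) (τ.v t)
  not_stopped : ε < ⟪-gradient f (τ.x t), τ.s t - τ.x t⟫_ℝ
  stepSize_mem : τ.γ t ∈ Set.Icc 0 (τ.γmax t)
  lineSearch : ∀ η ∈ Set.Icc 0 (τ.γmax t),
    f (τ.x t + τ.γ t • τ.d t) ≤ f (τ.x t + η • τ.d t)
  update : τ.x (t + 1) = τ.x t + τ.γ t • τ.d t

open Classical in
/-- Choice of the Frank-Wolfe direction in the away-steps variant. -/
def LineSearchTrace.FWBranch (τ : LineSearchTrace E) (f : E → ℝ) (t : ℕ) : Prop :=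
  ⟪-gradient f (τ.x t), τ.x t - τ.v t⟫_ℝ ≤ ⟪-gradient f (τ.x t), τ.s t - τ.x t⟫_ℝ ∧
  τ.d t = τ.s t - τ.x t ∧ τ.γmax t = 1 ∧
  ∀ a, τ.weight (t + 1) a
    = (1 - τ.γ t) * τ.weight t a + (if a = τ.s t then τ.γ t else 0)

open Classical in
/-- Choice of the away direction in the away-steps variant. -/
def LineSearchTrace.AwayBranch (τ : LineSearchTrace E) (f : E → ℝ) (t : ℕ) : Prop :=
  ⟪-gradient f (τ.x t), τ.s t - τ.x t⟫_ℝ < ⟪-gradient f (τ.x t), τ.x t - τ.v t⟫_ℝ ∧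
  τ.d t = τ.x t - τ.v t ∧
  τ.γmax t = τ.weight t (τ.v t) / (1 - τ.weight t (τ.v t)) ∧
  ∀ a, τ.weight (t + 1) a
    = (1 + τ.γ t) * τ.weight t a - (if a = τ.v t then τ.γ t else 0)

open Classical in
/-- The pairwise direction and the pairwise update of the weights. -/
def LineSearchTrace.PairwiseBranch (τ : LineSearchTrace E) (t : ℕ) : Prop :=
  τ.d t = τ.s t - τ.v t ∧ τ.γmax t = τ.weight t (τ.v t) ∧
  ∀ a, τ.weight (t + 1) a
    = τ.weight t a - (if a = τ.v t then τ.γ t else 0) + (if a = τ.s t then τ.γ t else 0)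

/-- `τ` records a run of away-steps Frank-Wolfe that performs (at least) `T` iterations. -/
def IsAFW (A : Finset E) (f : E → ℝ) (ε : ℝ) (T : ℕ) (τ : LineSearchTrace E) : Prop :=
  τ.Starts A ∧ ∀ t < T, τ.CommonStep A f ε t ∧ (τ.FWBranch f t ∨ τ.AwayBranch f t)

/-- `τ` records a run of pairwise Frank-Wolfe that performs (at least) `T` iterations. -/
def IsPFW (A : Finset E) (f : E → ℝ) (ε : ℝ) (T : ℕ) (τ : LineSearchTrace E) : Prop :=
  τ.Starts A ∧ ∀ t < T, τ.CommonStep A f ε t ∧ τ.PairwiseBranch t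

/-- A good step: the step-size is not truncated, or the maximal step-size is at least one. -/
def LineSearchTrace.Good (τ : LineSearchTrace E) (t : ℕ) : Prop :=
  τ.γ t < τ.γmax t ∨ 1 ≤ τ.γmax t

/-- A drop step: the active set shrinks. -/
def LineSearchTrace.Drop (τ : LineSearchTrace E) (A : Finset E) (t : ℕ) : Prop :=
  (τ.active A (t + 1)).card < (τ.active A t).card

/-- A swap step: maximal step-size, and the size of the active set does not change. -/
def LineSearchTrace.Swap (τ : LineSearchTrace E) (A : Finset E) (t : ℕ) : Prop :=
  τ.γ t = τ.γmax t ∧ (τ.active A (t + 1)).card = (τ.active A t).card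

/-! ### Fully-corrective Frank-Wolfe -/

/-- The quantities of the corrective variants: iterates, their active sets, correction sets
of atoms, and Frank-Wolfe atoms. -/
structure CorrectiveTrace (E : Type*) where
  /-- iterates -/
  x : ℕ → E
  /-- active sets -/
  S : ℕ → Finset E
  /-- correction atoms -/
  V : ℕ → Finset E
  /-- Frank-Wolfe atoms -/
  s : ℕ → E

/-- The active set of iterate `t` is one, and is contained in the set of correction atoms. -/
def CorrectiveTrace.Valid (τ : CorrectiveTrace E) (A : Finset E) (t : ℕ) : Prop :=
  τ.S t ∈ activeSets A (τ.x t) ∧ τ.S t ⊆ τ.V t ∧ τ.V t ⊆ A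

/-- The away gap of iterate `t` is at most `ε`. -/
def CorrectiveTrace.AwayGapLE (τ : CorrectiveTrace E) (f : E → ℝ) (ε : ℝ) (t : ℕ) : Prop :=
  ∀ v ∈ τ.S t, ⟪-gradient f (τ.x t), τ.x t - v⟫_ℝ ≤ ε

/-- The Frank-Wolfe atom is chosen, and the stopping test of tolerance `ε` fails. -/
def CorrectiveTrace.Continues (τ : CorrectiveTrace E) (A : Finset E) (f : E → ℝ) (ε : ℝ)
    (t : ℕ) : Prop :=
  IsFWAtom A f (τ.x t) (τ.s t) ∧ ε < ⟪-gradient f (τ.x t), τ.s t - τ.x t⟫_ℝ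

/-- `τ` records a run of fully-corrective Frank-Wolfe with approximate correction that
performs (at least) `T` iterations. The starting point has away gap at most `ε`, like all
later iterates (this holds if it is an atom with itself as active set). -/
def IsFCFW (A : Finset E) (f : E → ℝ) (ε : ℝ) (T : ℕ) (τ : CorrectiveTrace E) : Prop :=
  τ.Valid A 0 ∧ τ.AwayGapLE f ε 0 ∧
  ∀ t < T, τ.Continues A f ε t ∧ τ.Valid A (t + 1) ∧
    (∀ γ ∈ Set.Icc (0 : ℝ) 1, f (τ.x (t + 1)) ≤ f (τ.x t + γ • (τ.s t - τ.x t))) ∧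
    τ.AwayGapLE f ε (t + 1)

open Classical in
/-- The same with exact correction: the next iterate minimizes `f` over the convex hull of
the correction atoms and the Frank-Wolfe atom, among which its active atoms are. The
starting point has away gap zero (for instance, it is an atom). -/
def IsFCFWExact (A : Finset E) (f : E → ℝ) (ε : ℝ) (T : ℕ) (τ : CorrectiveTrace E) : Prop :=
  τ.Valid A 0 ∧ τ.AwayGapLE f 0 0 ∧
  ∀ t < T, τ.Continues A f ε t ∧ τ.Valid A (t + 1) ∧
    τ.S (t + 1) ⊆ insert (τ.s t) (τ.V t) ∧
    IsMinOn f (domain (insert (τ.s t) (τ.V t))) (τ.x (t + 1))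

/-! ### The min-norm-point algorithm -/

/-- `y` minimizes `f` over the affine hull of `S`. -/
def IsAffineMinimizer (f : E → ℝ) (S : Finset E) (y : E) : Prop :=
  y ∈ affineSpan ℝ (S : Set E) ∧ IsMinOn f (affineSpan ℝ (S : Set E) : Set E) y

/-- `MNPCorrection f z S y W`: the loop of the min-norm-point correction, entered with the
point `z` and the set of atoms `S`, returns the point `y` with the active set `W`. In a
minor cycle one moves from `z` towards the affine minimizer, as far as the convex hull of
`S` allows, and keeps the active atoms of the point obtained. -/
inductive MNPCorrection (f : E → ℝ) : E → Finset E → E → Finset E → Prop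
  | finish (z : E) (S : Finset E) (y : E) (hy : IsAffineMinimizer f S y)
      (hin : y ∈ intrinsicInterior ℝ (convexHull ℝ (S : Set E))) :
      MNPCorrection f z S y S
  | minor (z : E) (S : Finset E) (y : E) (θ : ℝ) (S' : Finset E) (y' : E) (W : Finset E)
      (hy : IsAffineMinimizer f S y)
      (hout : y ∉ intrinsicInterior ℝ (convexHull ℝ (S : Set E)))
      (hθ : IsGreatest {η : ℝ | η ∈ Set.Icc (0 : ℝ) 1 ∧
        z + η • (y - z) ∈ convexHull ℝ (S : Set E)} θ)
      (hS' : S' ∈ activeSets S (z + θ • (y - z)))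
      (next : MNPCorrection f (z + θ • (y - z)) S' y' W) :
      MNPCorrection f z S y' W

open Classical in
/-- `τ` records a run of the min-norm-point algorithm, started at an atom, that performs
(at least) `T` iterations; the correction atoms are the active atoms. -/
def IsMNP (A : Finset E) (f : E → ℝ) (ε : ℝ) (T : ℕ) (τ : CorrectiveTrace E) : Prop :=
  τ.x 0 ∈ A ∧ τ.S 0 = {τ.x 0} ∧ (∀ t, τ.V t = τ.S t) ∧
  ∀ t < T, τ.Continues A f ε t ∧
    MNPCorrection f (τ.x t) (insert (τ.s t) (τ.V t)) (τ.x (t + 1)) (τ.V (t + 1))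

/-- A drop step: the active set shrinks. -/
def CorrectiveTrace.Drop (τ : CorrectiveTrace E) (t : ℕ) : Prop :=
  (τ.S (t + 1)).card < (τ.S t).card

/-! ### Rates -/

/-- Suboptimality of the iterates. -/
def subopt (f : E → ℝ) (xstar : E) (x : ℕ → E) (t : ℕ) : ℝ := f (x t) - f xstar

open Classical in
/-- Number of the steps `i` with `a ≤ i < b` that have the property `P`. -/
def countSteps (P : ℕ → Prop) (a b : ℕ) : ℕ := ((Finset.Ico a b).filter P).card

/-- Over the first `T` iterations, `h` decreases by the factor `1 - ρ` at each good step,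
and it decreases exponentially in the number of good steps. -/
def LinearRate (h : ℕ → ℝ) (good : ℕ → Prop) (T : ℕ) (ρ : ℝ) : Prop :=
  (∀ t < T, good t → h (t + 1) ≤ (1 - ρ) * h t) ∧
  ∀ t ≤ T, h t ≤ h 0 * Real.exp (-ρ * (countSteps good 0 t : ℝ))

/-- The sublinear rate `4 C / (k(t) + 4)`, where `k(t)` is the number of good steps. -/
def SublinearRate4 (h : ℕ → ℝ) (good : ℕ → Prop) (T : ℕ) (C : ℝ) : Prop :=
  ∀ t ≤ T, h t ≤ 4 * C / ((countSteps good 0 t : ℝ) + 4)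

/-- The sublinear rate `2 C / (k(t) + 2)` for `k(t) ≥ 1`. -/
def SublinearRate2 (h : ℕ → ℝ) (good : ℕ → Prop) (T : ℕ) (C : ℝ) : Prop :=
  ∀ t ≤ T, 1 ≤ countSteps good 0 t → h t ≤ 2 * C / ((countSteps good 0 t : ℝ) + 2)

/-- The rate constant `μ / (4 L) * (δ / M) ^ 2`, with `δ` the pyramidal width of the atoms
and `M` the diameter of the polytope. -/
def euclideanRate (A : Finset E) (L μ : ℝ) : ℝ :=
  μ / (4 * L) * (pyramidalWidth A / Metric.diam (domain A)) ^ 2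

end FrankWolfe

end

set_option linter.unusedSectionVars false

namespace FrankWolfe

open Filter Topology Set

variable {E : Type*} [NormedAddCommGroup E] [InnerProductSpace ℝ E] [CompleteSpace E]

/-! ### First-order facts along segments -/

/-! All variants rest on one estimate, `SufficientDecrease`: at a good step `f x' ≤ f x - η * d + η
^ 2 * C / 2` for every `η ∈ [0, 1]`, where the slope `d` is at least the Frank-Wolfe gap, hence at
least the suboptimality `h`, and `κ * d` is at least the pairwise gap `g`. Here `κ = 1` for pairwise
steps, exact correction and min-norm-point, and `κ = 2` for away steps and approximate correction.
Optimizing over `η` gives a decrease of `d / 2` or of `d ^ 2 / (2 * C)`. Geometric strong convexity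
gives `2 * m * h ≤ g ^ 2` (`two_mul_mul_sub_le_sq`), so the decrease is proportional to `h`; using
only `h ≤ d` gives the sublinear rates.

The Euclidean constants come from `pyramidalWidth_mul_inner_le`: the negative gradient is projected
onto the cone of feasible directions at `x`; the normal remainder exposes a face containing `x` and
its active atoms, in which the projection is feasible, and the width of that face bounds `g` from
below.

It remains to see that good steps have the estimate and are frequent. For line searches, an
untruncated optimum is at least as long as the minimizer of the quadratic model (`lineSearch_le`).
Active sets start with one atom and gain at most one per step, so at most half of the steps are
drops. In a run of truncated pairwise steps without drops the weights are merely permuted while `f`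
strictly decreases, so injections of the active set into the atoms bound the length of the run
(`IsPFW.card_filter_le`). For min-norm-point, a step that is not a drop has at most one minor cycle,
which removes one atom; crossing the affine hull of the remaining atoms shows that the result is as
good as any point of the hull before the removal (`le_of_single_minor`). -/

lemma hasDerivAt_line {f : E → ℝ} {x d : E} {u : ℝ} (h : DifferentiableAt ℝ f (x + u • d)) :
    HasDerivAt (fun u : ℝ => f (x + u • d)) ⟪gradient f (x + u • d), d⟫_ℝ u := by
  have h1 := h.hasGradientAt.hasFDerivAt
  have h2 : HasDerivAt (fun u : ℝ => x + u • d) d u := by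
    simpa using ((hasDerivAt_id u).smul_const d).const_add x
  exact (h1.comp_hasDerivAt u h2).congr_deriv (by simp)

lemma hasDerivAt_line_zero {f : E → ℝ} {x : E} (d : E) (h : DifferentiableAt ℝ f x) :
    HasDerivAt (fun u : ℝ => f (x + u • d)) ⟪gradient f x, d⟫_ℝ 0 := by
  have := hasDerivAt_line (f := f) (x := x) (d := d) (u := 0) (by simpa using h)
  simpa using this

/-- The term `u * c` vanishes as `u → 0⁺`, so difference quotients may exceed `b` by a first-order
error. -/
lemma deriv_le_of_slope_le {φ : ℝ → ℝ} {φ' a b c : ℝ} (h : HasDerivAt φ φ' 0) (ha : 0 < a)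
    (hle : ∀ u, 0 < u → u < a → φ u - φ 0 ≤ u * (b + u * c)) : φ' ≤ b := by
  have h1 := (hasDerivAt_iff_tendsto_slope_zero.1 h).mono_left
    (nhdsWithin_mono (0 : ℝ) (show Ioi 0 ⊆ ({0}ᶜ : Set ℝ) from fun x hx => ne_of_gt hx))
  have h2 : Tendsto (fun u : ℝ => b + u * c) (𝓝[>] 0) (𝓝 b) := by
    have : Continuous (fun u : ℝ => b + u * c) := by fun_prop
    have := (this.tendsto 0).mono_left (nhdsWithin_le_nhds (s := Ioi 0))
    simpa using this
  refine le_of_tendsto_of_tendsto h1 h2 ?_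
  filter_upwards [Ioo_mem_nhdsGT ha] with u hu
  have := hle u hu.1 hu.2
  rw [zero_add, smul_eq_mul, inv_mul_le_iff₀ hu.1]
  exact this

lemma le_deriv_of_le {φ : ℝ → ℝ} {φ' a : ℝ} (h : HasDerivAt φ φ' 0) (ha : 0 < a)
    (hle : ∀ u, 0 < u → u < a → φ 0 ≤ φ u) : 0 ≤ φ' := by
  have := deriv_le_of_slope_le (φ := fun u => - φ u) (b := 0) (c := 0) h.neg ha
    (fun u h1 h2 => by have := hle u h1 h2; simp; linarith)
  linarith

lemma inner_gradient_nonneg {f : E → ℝ} {x d : E} {a : ℝ} (h : DifferentiableAt ℝ f x)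
    (ha : 0 < a) (hle : ∀ u, 0 < u → u < a → f x ≤ f (x + u • d)) :
    0 ≤ ⟪gradient f x, d⟫_ℝ :=
  le_deriv_of_le (hasDerivAt_line_zero d h) ha (by simpa using hle)

lemma inner_gradient_le_of_strongConvexOn {f : E → ℝ} {s : Set E} {μ : ℝ}
    (hf : StrongConvexOn s μ f) {x y : E} (hx : x ∈ s) (hy : y ∈ s)
    (hd : DifferentiableAt ℝ f x) :
    ⟪gradient f x, y - x⟫_ℝ ≤ f y - f x - μ / 2 * ‖y - x‖ ^ 2 := by
  -- The strong convexity term `u * (1 - u) * (μ / 2 * ‖y - x‖ ^ 2)` has a part linear in `u`, which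
  -- improves the slope, and a part in `u ^ 2`, which `c` absorbs.
  refine deriv_le_of_slope_le (a := 1) (c := μ / 2 * ‖y - x‖ ^ 2)
    (hasDerivAt_line_zero (y - x) hd) one_pos ?_
  intro u hu hu1
  have := hf.2 hx hy (show 0 ≤ 1 - u by linarith) hu.le (by ring)
  have e : (1 - u) • x + u • y = x + u • (y - x) := by module
  rw [e, norm_sub_rev] at this
  simp only [smul_eq_mul] at this
  simp only [zero_smul, add_zero]
  linarith

lemma inner_gradient_le {f : E → ℝ} {s : Set E} (hf : ConvexOn ℝ s f) {x y : E} (hx : x ∈ s)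
    (hy : y ∈ s) (hd : DifferentiableAt ℝ f x) : ⟪gradient f x, y - x⟫_ℝ ≤ f y - f x := by
  have := inner_gradient_le_of_strongConvexOn (strongConvexOn_zero.2 hf) hx hy hd
  simpa using this

/-- The quadratic upper bound for a function with Lipschitz gradient. -/
lemma le_add_inner_gradient_add_sq {f : E → ℝ} {s : Set E} (hs : Convex ℝ s) {L : NNReal}
    (hd : ∀ x ∈ s, DifferentiableAt ℝ f x) (hL : LipschitzOnWith L (gradient f) s) {x d : E}
    (hx : x ∈ s) (hxd : x + d ∈ s) :
    f (x + d) ≤ f x + ⟪gradient f x, d⟫_ℝ + L / 2 * ‖d‖ ^ 2 := by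
  have hseg : ∀ u ∈ Icc (0 : ℝ) 1, x + u • d ∈ s := fun u hu => hs.add_smul_mem hx hxd hu
  have hder : ∀ u ∈ Icc (0 : ℝ) 1, HasDerivAt
      (fun u : ℝ => f (x + u • d) - u * ⟪gradient f x, d⟫_ℝ - L / 2 * ‖d‖ ^ 2 * u ^ 2)
      (⟪gradient f (x + u • d), d⟫_ℝ - ⟪gradient f x, d⟫_ℝ - L * ‖d‖ ^ 2 * u) u := by
    intro u hu
    have h1 := hasDerivAt_line (hd _ (hseg u hu))
    have h2 := (hasDerivAt_id u).mul_const ⟪gradient f x, d⟫_ℝ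
    have h3 := ((hasDerivAt_id u).pow 2).const_mul (L / 2 * ‖d‖ ^ 2)
    refine ((h1.sub h2).sub h3).congr_deriv ?_
    simp
    ring
  -- Along the segment the gradient changes by at most `L * u * ‖d‖`, so `f` minus its quadratic
  -- model decreases.
  have hanti := antitoneOn_of_hasDerivWithinAt_nonpos (convex_Icc (0 : ℝ) 1)
    (fun u hu => (hder u hu).continuousAt.continuousWithinAt)
    (fun u hu => (hder u (interior_subset hu)).hasDerivWithinAt) (by
      intro u hu
      have hu := interior_subset hu
      have h1 : ‖gradient f (x + u • d) - gradient f x‖ ≤ L * (u * ‖d‖) := by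
        have := hL.norm_sub_le (hseg u hu) hx
        rwa [add_sub_cancel_left, norm_smul, Real.norm_of_nonneg hu.1] at this
      have h2 := real_inner_le_norm (gradient f (x + u • d) - gradient f x) d
      rw [inner_sub_left] at h2
      nlinarith [norm_nonneg d])
  have := hanti (left_mem_Icc.2 zero_le_one) (right_mem_Icc.2 zero_le_one) zero_le_one
  simp only [one_smul, zero_smul, add_zero] at this
  linarith

end FrankWolfe

/-! ### Counting of steps and scalar recursions. -/

namespace FrankWolfe

/-! ### Counting steps -/

lemma countSteps_self (P : ℕ → Prop) (a : ℕ) : countSteps P a a = 0 := by simp [countSteps]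

lemma countSteps_succ_of_pos {P : ℕ → Prop} {a b : ℕ} (hab : a ≤ b) (h : P b) :
    countSteps P a (b + 1) = countSteps P a b + 1 := by
  classical
  unfold countSteps
  rw [← Finset.insert_Ico_right_eq_Ico_add_one hab, Finset.filter_insert, if_pos h,
    Finset.card_insert_of_notMem (by simp)]

lemma countSteps_succ_of_neg {P : ℕ → Prop} {a b : ℕ} (hab : a ≤ b) (h : ¬ P b) :
    countSteps P a (b + 1) = countSteps P a b := by
  classical
  unfold countSteps
  rw [← Finset.insert_Ico_right_eq_Ico_add_one hab, Finset.filter_insert, if_neg h]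

lemma countSteps_mono {P : ℕ → Prop} {a b c : ℕ} (hbc : b ≤ c) :
    countSteps P a b ≤ countSteps P a c := by
  classical
  exact Finset.card_le_card (Finset.filter_subset_filter _ (Finset.Ico_subset_Ico_right hbc))

lemma countSteps_true (t : ℕ) : countSteps (fun _ => True) 0 t = t := by simp [countSteps]

lemma countSteps_add_countSteps_not (P : ℕ → Prop) (t : ℕ) :
    countSteps P 0 t + countSteps (fun i => ¬ P i) 0 t = t := by
  classical
  have := Finset.card_filter_add_card_filter_not (s := Finset.Ico 0 t) P
  simp only [Nat.card_Ico, Nat.sub_zero] at this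
  unfold countSteps
  convert this

lemma countSteps_le_of_imp {P Q : ℕ → Prop} {T t : ℕ} (ht : t ≤ T) (h : ∀ i < T, P i → Q i) :
    countSteps P 0 t ≤ countSteps Q 0 t := by
  classical
  refine Finset.card_le_card fun i hi => ?_
  simp only [Finset.mem_filter, Finset.mem_Ico] at hi ⊢
  exact ⟨hi.1, h i (by omega) hi.2⟩

/-- If a positive integer that starts at one grows by at most one in each step, then it
decreases in at most half of the steps. -/
lemma countSteps_decrease_le {c : ℕ → ℕ} {T : ℕ} (h0 : c 0 = 1) (hpos : ∀ t ≤ T, 1 ≤ c t)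
    (hle : ∀ t < T, c (t + 1) ≤ c t + 1) {t : ℕ} (ht : t ≤ T) :
    (countSteps (fun i => c (i + 1) < c i) 0 t : ℝ) ≤ t / 2 := by
  -- A decrease loses at least one unit and any other step gains at most one, so this potential
  -- grows by at most one per step.
  have key : ∀ t ≤ T, c t + 2 * countSteps (fun i => c (i + 1) < c i) 0 t ≤ 1 + t := by
    intro t
    induction t with
    | zero => intro _; simp [countSteps_self, h0]
    | succ t ih =>
      intro ht
      have h1 := ih (by omega)
      by_cases hd : c (t + 1) < c t
      · rw [countSteps_succ_of_pos (P := fun i => c (i + 1) < c i) (Nat.zero_le t) hd]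
        omega
      · rw [countSteps_succ_of_neg (P := fun i => c (i + 1) < c i) (Nat.zero_le t) hd]
        have := hle t (by omega)
        omega
  have h1 := key t ht
  have h2 := hpos t ht
  have : 2 * countSteps (fun i => c (i + 1) < c i) 0 t ≤ t := by omega
  have : (2 : ℝ) * countSteps (fun i => c (i + 1) < c i) 0 t ≤ t := by exact_mod_cast this
  linarith

lemma half_le_countSteps_not {P : ℕ → Prop} {t : ℕ} (h : (countSteps P 0 t : ℝ) ≤ t / 2) :
    (t : ℝ) / 2 ≤ countSteps (fun i => ¬ P i) 0 t := by
  have : (countSteps P 0 t : ℝ) + countSteps (fun i => ¬ P i) 0 t = t := by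
    exact_mod_cast countSteps_add_countSteps_not P t
  linarith

/-! ### From the progress of one step to rates -/

/-- Combines `1 - ρ ≤ exp (-ρ)` with `h t ≥ 0`; steps that are not good only have to be monotone. -/
lemma LinearRate.of_steps {h : ℕ → ℝ} {good : ℕ → Prop} {T : ℕ} {ρ : ℝ}
    (hpos : ∀ t ≤ T, 0 ≤ h t) (hmono : ∀ t < T, h (t + 1) ≤ h t)
    (hgood : ∀ t < T, good t → h (t + 1) ≤ (1 - ρ) * h t) : LinearRate h good T ρ := by
  refine ⟨hgood, fun t => ?_⟩
  induction t with
  | zero => intro _; simp [countSteps_self]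
  | succ t ih =>
    intro ht
    have h1 := ih (by omega)
    by_cases hg : good t
    · rw [countSteps_succ_of_pos (Nat.zero_le t) hg]
      have h2 := hgood t (by omega) hg
      have h3 : (1 - ρ) * h t ≤ Real.exp (-ρ) * h t :=
        mul_le_mul_of_nonneg_right (by linarith [Real.add_one_le_exp (-ρ)]) (hpos t (by omega))
      have h4 := mul_le_mul_of_nonneg_left h1 (Real.exp_pos (-ρ)).le
      have e : h 0 * Real.exp (-ρ * ((countSteps good 0 t + 1 : ℕ) : ℝ))
          = Real.exp (-ρ) * (h 0 * Real.exp (-ρ * (countSteps good 0 t : ℝ))) := by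
        push_cast
        rw [mul_add, Real.exp_add]
        ring_nf
      rw [e]
      linarith
    · rw [countSteps_succ_of_neg (Nat.zero_le t) hg]
      exact (hmono t (by omega)).trans h1

lemma LinearRate.le_exp_half {h : ℕ → ℝ} {good : ℕ → Prop} {T : ℕ} {ρ : ℝ}
    (hr : LinearRate h good T ρ) (h0 : 0 ≤ h 0) (hρ : 0 ≤ ρ) {t : ℕ} (ht : t ≤ T)
    (hk : (t : ℝ) / 2 ≤ countSteps good 0 t) :
    h t ≤ h 0 * Real.exp (-(1 / 2) * ρ * t) := by
  refine (hr.2 t ht).trans (mul_le_mul_of_nonneg_left (Real.exp_le_exp.2 ?_) h0)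
  nlinarith

lemma le_of_steps {h : ℕ → ℝ} {T : ℕ} (hmono : ∀ t < T, h (t + 1) ≤ h t) {t : ℕ}
    (ht : t ≤ T) : h t ≤ h 0 := by
  induction t with
  | zero => exact le_rfl
  | succ t ih => exact (hmono t (by omega)).trans (ih (by omega))

/-- After `k ≥ 1` good steps the choice is `η = 2 / (k + 2)`. The first good step takes `η = 1`,
which removes the initial value from the bound; this is why nothing is claimed for `k = 0`. -/
lemma SublinearRate2.of_steps {h : ℕ → ℝ} {good : ℕ → Prop} {T : ℕ} {C : ℝ} (hC : 0 ≤ C)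
    (hmono : ∀ t < T, h (t + 1) ≤ h t)
    (hgood : ∀ t < T, good t → ∀ η ∈ Set.Icc (0 : ℝ) 1,
      h (t + 1) ≤ (1 - η) * h t + η ^ 2 * C / 2) : SublinearRate2 h good T C := by
  intro t
  induction t with
  | zero => intro _ hk; simp [countSteps_self] at hk
  | succ t ih =>
    intro ht hk
    by_cases hg : good t
    · rw [countSteps_succ_of_pos (Nat.zero_le t) hg]
      rcases Nat.eq_zero_or_pos (countSteps good 0 t) with h0 | h0
      · have := hgood t (by omega) hg 1 (by simp)
        rw [h0]
        norm_num at this ⊢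
        linarith
      · have h1 := ih (by omega) h0
        set k : ℝ := (countSteps good 0 t : ℝ) with hk'
        have hk1 : (1 : ℝ) ≤ k := by rw [hk']; exact_mod_cast h0
        have h2 := hgood t (by omega) hg (2 / (k + 2))
          ⟨by positivity, by rw [div_le_one (by positivity)]; linarith⟩
        push_cast
        have h3 : (1 - 2 / (k + 2)) * h t ≤ (1 - 2 / (k + 2)) * (2 * C / (k + 2)) := by
          refine mul_le_mul_of_nonneg_left h1 ?_
          rw [sub_nonneg, div_le_one (by positivity)]
          linarith
        have h4 : (1 - 2 / (k + 2)) * (2 * C / (k + 2)) + (2 / (k + 2)) ^ 2 * C / 2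
            ≤ 2 * C / (k + 1 + 2) := by
          have : (1 - 2 / (k + 2)) * (2 * C / (k + 2)) + (2 / (k + 2)) ^ 2 * C / 2
            = 2 * C * (k + 1) / (k + 2) ^ 2 := by field_simp; ring
          rw [this, div_le_div_iff₀ (by positivity) (by positivity)]
          nlinarith
        linarith
    · rw [countSteps_succ_of_neg (Nat.zero_le t) hg] at hk ⊢
      exact (hmono t (by omega)).trans (ih (by omega) hk)

/-- The summand `h 0` in the constant serves only the case of no good step; otherwise the rate of
`SublinearRate2` is stronger. -/
lemma SublinearRate4.of_steps {h : ℕ → ℝ} {good : ℕ → Prop} {T : ℕ} {C : ℝ} (hC : 0 ≤ C)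
    (hpos : 0 ≤ h 0) (hmono : ∀ t < T, h (t + 1) ≤ h t)
    (hgood : ∀ t < T, good t → ∀ η ∈ Set.Icc (0 : ℝ) 1,
      h (t + 1) ≤ (1 - η) * h t + η ^ 2 * C / 2) :
    SublinearRate4 h good T (2 * C + h 0) := by
  intro t ht
  rcases Nat.eq_zero_or_pos (countSteps good 0 t) with h0 | h0
  · have := le_of_steps hmono ht
    rw [h0]
    norm_num
    linarith
  · refine (SublinearRate2.of_steps hC hmono hgood t ht h0).trans ?_
    rw [div_le_div_iff₀ (by positivity) (by positivity)]
    have : (0 : ℝ) ≤ countSteps good 0 t := by positivity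
    nlinarith [mul_nonneg hC this, mul_nonneg hpos this]

/-- The parabola is minimized over `[0, 1]` at `1` or at `g / C`; in the first case `C ≤ g`
simplifies the value. -/
lemma le_sub_min_of_quadratic {h h' g C : ℝ} (hg : 0 ≤ g)
    (hq : ∀ η ∈ Set.Icc (0 : ℝ) 1, h' ≤ h - η * g + η ^ 2 * C / 2) :
    h' ≤ h - g / 2 ∨ (0 < C ∧ h' ≤ h - g ^ 2 / (2 * C)) := by
  rcases le_or_gt C g with hCg | hCg
  · left
    have := hq 1 (by simp)
    linarith
  · right
    have hC' : 0 < C := hg.trans_lt hCg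
    refine ⟨hC', ?_⟩
    have := hq (g / C) ⟨by positivity, (div_le_one hC').2 hCg.le⟩
    have e : h - g / C * g + (g / C) ^ 2 * C / 2 = h - g ^ 2 / (2 * C) := by field_simp; ring
    linarith

/-- The slope `d` is only guaranteed to be half of the gap `g`, and squaring costs the factor `4`.
Since `μ ≤ C`, the rate is at most `1 / 4`, so the decrease by `d / 2` of a full step also suffices.
-/
lemma le_one_sub_quarter_mul {h h' g d C μ : ℝ} (hh : 0 ≤ h) (hd : h ≤ d) (hg : 0 ≤ g)
    (hgd : g ≤ 2 * d) (hC : 0 ≤ C) (hμC : μ ≤ C) (hμ : 2 * μ * h ≤ g ^ 2)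
    (hq : ∀ η ∈ Set.Icc (0 : ℝ) 1, h' ≤ h - η * d + η ^ 2 * C / 2) :
    h' ≤ (1 - μ / (4 * C)) * h := by
  -- For `C = 0` the quotient is `0`, and the claim is plain monotonicity.
  rcases hC.eq_or_lt with rfl | hC'
  · have := hq 0 (by simp)
    simp at this ⊢
    exact this
  have h1 : μ / (4 * C) ≤ 1 / 4 := by
    rw [div_le_div_iff₀ (by positivity) (by norm_num)]
    linarith
  rcases le_sub_min_of_quadratic (hh.trans hd) hq with h2 | ⟨-, h2⟩
  · nlinarith
  · have h3 : 2 * μ * h ≤ 4 * d ^ 2 := by nlinarith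
    have : μ / (4 * C) * h ≤ d ^ 2 / (2 * C) := by
      rw [div_mul_eq_mul_div, div_le_div_iff₀ (by positivity) (by positivity)]
      nlinarith [mul_le_mul_of_nonneg_right h3 hC]
    linarith

/-- Here the slope is the gap itself. The minimum with `1 / 2` accounts for full steps, so `μ` and
`C` need not be compared. -/
lemma le_one_sub_min_mul {h h' g C μ : ℝ} (hh : 0 ≤ h) (hg : h ≤ g)
    (hμ : 2 * μ * h ≤ g ^ 2)
    (hq : ∀ η ∈ Set.Icc (0 : ℝ) 1, h' ≤ h - η * g + η ^ 2 * C / 2) :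
    h' ≤ (1 - min (1 / 2) (μ / C)) * h := by
  have m1 := min_le_left (1 / 2) (μ / C)
  have m2 := min_le_right (1 / 2) (μ / C)
  rcases le_sub_min_of_quadratic (hh.trans hg) hq with h2 | ⟨hC', h2⟩
  · nlinarith
  · have : μ / C * h ≤ g ^ 2 / (2 * C) := by
      rw [div_mul_eq_mul_div, div_le_div_iff₀ (by positivity) (by positivity)]
      nlinarith
    nlinarith

end FrankWolfe

/-! ### Oracle atoms, curvature and geometric strong convexity. -/

namespace FrankWolfe

open Set

variable {E : Type*} [NormedAddCommGroup E] [InnerProductSpace ℝ E] [CompleteSpace E]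
  {A : Finset E} {f : E → ℝ}

/-! ### The domain and active sets -/

lemma convex_domain (A : Finset E) : Convex ℝ (domain A) := convex_convexHull ℝ _

lemma mem_domain_of_mem {a : E} (ha : a ∈ A) : a ∈ domain A := subset_convexHull ℝ _ ha

lemma isBounded_domain (A : Finset E) : Bornology.IsBounded (domain A) :=
  isBounded_convexHull.2 A.finite_toSet.isBounded

lemma domain_mono {S : Finset E} (h : S ⊆ A) : domain S ⊆ domain A :=
  convexHull_mono (Finset.coe_subset.2 h)

lemma nonempty_of_mem_domain {x : E} (hx : x ∈ domain A) : A.Nonempty := by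
  rw [← Finset.coe_nonempty, ← convexHull_nonempty_iff (𝕜 := ℝ)]
  exact ⟨x, hx⟩

lemma sum_smul_mem_domain {S : Finset E} {w : E → ℝ} (hw : ∀ v ∈ S, 0 ≤ w v)
    (h1 : ∑ v ∈ S, w v = 1) : ∑ v ∈ S, w v • v ∈ domain S :=
  (convex_domain S).sum_mem hw h1 fun _ hv => mem_domain_of_mem hv

lemma activeSets_nonempty {S : Finset E} {x : E} (h : S ∈ activeSets A x) : S.Nonempty := by
  obtain ⟨-, w, -, h1, -⟩ := h
  rw [Finset.nonempty_iff_ne_empty]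
  rintro rfl
  simp at h1

lemma mem_domain_of_activeSets {S : Finset E} {x : E} (h : S ∈ activeSets A x) :
    x ∈ domain S := by
  obtain ⟨-, w, hw, h1, rfl⟩ := h
  exact sum_smul_mem_domain (fun v hv => (hw v hv).le) h1

lemma mem_domain_of_activeSets' {S : Finset E} {x : E} (h : S ∈ activeSets A x) :
    x ∈ domain A := domain_mono h.1 (mem_domain_of_activeSets h)

lemma singleton_mem_activeSets {a : E} (ha : a ∈ A) : {a} ∈ activeSets A a :=
  ⟨by simpa using ha, fun _ => 1, by simp⟩

lemma le_inner_of_mem_domain {c x : E} {k : ℝ} (h : ∀ a ∈ A, k ≤ ⟪c, a⟫_ℝ)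
    (hx : x ∈ domain A) : k ≤ ⟪c, x⟫_ℝ := by
  have hc : Convex ℝ {y : E | k ≤ ⟪c, y⟫_ℝ} :=
    convex_halfSpace_ge ((innerSL ℝ c).isLinear) k
  exact convexHull_min (fun a ha => h a ha) hc hx

lemma inner_le_of_mem_domain {c x : E} {k : ℝ} (h : ∀ a ∈ A, ⟪c, a⟫_ℝ ≤ k)
    (hx : x ∈ domain A) : ⟪c, x⟫_ℝ ≤ k := by
  have := le_inner_of_mem_domain (A := A) (c := -c) (x := x) (k := -k)
    (fun a ha => by simpa using h a ha) hx
  simpa using this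

/-! ### Frank-Wolfe atoms and away atoms -/

lemma IsFWAtom.inner_le {x s y : E} (hs : IsFWAtom A f x s) (hy : y ∈ domain A) :
    ⟪gradient f x, s⟫_ℝ ≤ ⟪gradient f x, y⟫_ℝ := le_inner_of_mem_domain hs.2 hy

lemma IsAwayAtom.inner_le {x v y : E} {S : Finset E} (hv : IsAwayAtom f x S v)
    (hy : y ∈ domain S) : ⟪gradient f x, y⟫_ℝ ≤ ⟪gradient f x, v⟫_ℝ :=
  inner_le_of_mem_domain hv.2 hy

lemma exists_isFWAtom (hA : A.Nonempty) (f : E → ℝ) (x : E) : ∃ s, IsFWAtom A f x s :=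
  A.exists_min_image (fun a => ⟪gradient f x, a⟫_ℝ) hA

lemma exists_isAwayAtom {S : Finset E} (hS : S.Nonempty) (f : E → ℝ) (x : E) :
    ∃ v, IsAwayAtom f x S v :=
  S.exists_max_image (fun a => ⟪gradient f x, a⟫_ℝ) hS

lemma exists_isWorstAwayAtom {x : E} {S : Finset E} (hS : S ∈ activeSets A x) (f : E → ℝ) :
    ∃ v, IsWorstAwayAtom A f x v := by
  classical
  obtain ⟨v₀, hv₀⟩ := exists_isAwayAtom (activeSets_nonempty hS) f x
  obtain ⟨v, hv, hmin⟩ := (A.filter fun v => ∃ S ∈ activeSets A x, IsAwayAtom f x S v).exists_min_image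
    (fun a => ⟪gradient f x, a⟫_ℝ) ⟨v₀, Finset.mem_filter.2 ⟨hS.1 hv₀.1, S, hS, hv₀⟩⟩
  refine ⟨v, (Finset.mem_filter.1 hv).2, fun S' hS' w hw => hmin w ?_⟩
  exact Finset.mem_filter.2 ⟨hS'.1 hw.1, S', hS', hw⟩

/-! ### Curvature -/

/-- A quadratic upper bound, with constant `C`, for steps towards points of the domain. -/
def CurvatureBound (A : Finset E) (f : E → ℝ) (C : ℝ) : Prop :=
  0 ≤ C ∧ ∀ x ∈ domain A, ∀ s ∈ domain A, ∀ η ∈ Icc (0 : ℝ) 1,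
    f (x + η • (s - x)) ≤ f x + η * ⟪gradient f x, s - x⟫_ℝ + η ^ 2 * C / 2

/-- A quadratic upper bound, with constant `C`, for steps along differences of points of the
domain. -/
def AwayCurvatureBound (A : Finset E) (f : E → ℝ) (C : ℝ) : Prop :=
  0 ≤ C ∧ ∀ x ∈ domain A, ∀ s ∈ domain A, ∀ v ∈ domain A, ∀ η ∈ Icc (0 : ℝ) 1,
    f (x + η • (s - v)) ≤ f x + η * ⟪gradient f x, s - v⟫_ℝ + η ^ 2 * C / 2

lemma AwayCurvatureBound.curvatureBound {C : ℝ} (h : AwayCurvatureBound A f C) :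
    CurvatureBound A f C :=
  ⟨h.1, fun x hx s hs η hη => h.2 x hx s hs x hx η hη⟩

lemma curvatureBound_of_bddAbove (hA : A.Nonempty) (h : BddAbove (curvatureSet A f)) :
    CurvatureBound A f (curvature A f) := by
  obtain ⟨a, ha⟩ := hA
  have ha := mem_domain_of_mem ha
  -- The trivial step from `a` to `a` contributes the value `0`, so the supremum is nonnegative.
  refine ⟨le_csSup h ⟨a, ha, a, ha, 1, by simp, a, by simp, by simp⟩, ?_⟩
  intro x hx s hs η hη
  rcases hη.1.eq_or_lt with rfl | h0
  · simp
  have := le_csSup h ⟨x, hx, s, hs, η, ⟨h0, hη.2⟩, _, rfl, rfl⟩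
  rw [add_sub_cancel_left, inner_smul_right, div_mul_eq_mul_div, div_le_iff₀ (by positivity)]
    at this
  change _ ≤ curvature A f * _ at this
  linarith

lemma awayCurvatureBound_of_bddAbove (hA : A.Nonempty) (h : BddAbove (awayCurvatureSet A f)) :
    AwayCurvatureBound A f (awayCurvature A f) := by
  obtain ⟨a, ha⟩ := hA
  have ha := mem_domain_of_mem ha
  refine ⟨le_csSup h ⟨a, ha, a, ha, a, ha, 1, by simp, a, by simp, by simp⟩, ?_⟩
  intro x hx s hs v hv η hη
  rcases hη.1.eq_or_lt with rfl | h0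
  · simp
  have := le_csSup h ⟨x, hx, s, hs, v, hv, η, ⟨h0, hη.2⟩, _, rfl, rfl⟩
  rw [div_mul_eq_mul_div, div_le_iff₀ (by positivity)] at this
  change _ ≤ awayCurvature A f * _ at this
  linarith

lemma sq_norm_sub_le_diam {x y : E} (hx : x ∈ domain A) (hy : y ∈ domain A) :
    ‖x - y‖ ^ 2 ≤ Metric.diam (domain A) ^ 2 := by
  rw [← dist_eq_norm]
  exact pow_le_pow_left₀ dist_nonneg (Metric.dist_le_diam_of_mem (isBounded_domain A) hx hy) 2

lemma curvatureBound_of_lipschitz {L : NNReal} (hd : ∀ x ∈ domain A, DifferentiableAt ℝ f x)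
    (hL : LipschitzOnWith L (gradient f) (domain A)) :
    CurvatureBound A f (L * Metric.diam (domain A) ^ 2) := by
  refine ⟨by positivity, fun x hx s hs η hη => ?_⟩
  have := le_add_inner_gradient_add_sq (convex_domain A) hd hL hx
    ((convex_domain A).add_smul_sub_mem hx hs hη)
  refine this.trans ?_
  rw [inner_smul_right, norm_smul, mul_pow, Real.norm_of_nonneg hη.1]
  have := mul_le_mul_of_nonneg_left (sq_norm_sub_le_diam hs hx)
    (show 0 ≤ (L : ℝ) * η ^ 2 / 2 by positivity)
  linarith

lemma convex_awayDomain (A : Finset E) : Convex ℝ (awayDomain A) :=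
  (convex_domain A).add ((convex_domain A).sub (convex_domain A))

lemma domain_subset_awayDomain (A : Finset E) : domain A ⊆ awayDomain A := fun x hx =>
  Set.mem_add.2 ⟨x, hx, 0, Set.mem_sub.2 ⟨x, hx, x, hx, sub_self x⟩, add_zero x⟩

lemma awayCurvatureBound_of_lipschitz {L : NNReal}
    (hd : ∀ x ∈ awayDomain A, DifferentiableAt ℝ f x)
    (hL : LipschitzOnWith L (gradient f) (awayDomain A)) :
    AwayCurvatureBound A f (L * Metric.diam (domain A) ^ 2) := by
  refine ⟨by positivity, fun x hx s hs v hv η hη => ?_⟩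
  have hx' := domain_subset_awayDomain A hx
  have h1 : x + (s - v) ∈ awayDomain A :=
    Set.mem_add.2 ⟨x, hx, s - v, Set.mem_sub.2 ⟨s, hs, v, hv, rfl⟩, rfl⟩
  have := le_add_inner_gradient_add_sq (convex_awayDomain A) hd hL hx'
    ((convex_awayDomain A).add_smul_mem hx' h1 hη)
  refine this.trans ?_
  rw [inner_smul_right, norm_smul, mul_pow, Real.norm_of_nonneg hη.1]
  have := mul_le_mul_of_nonneg_left (sq_norm_sub_le_diam hs hv)
    (show 0 ≤ (L : ℝ) * η ^ 2 / 2 by positivity)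
  linarith

/-! ### Geometric strong convexity -/

/-- The values whose infimum is the geometric strong convexity constant. -/
def strongConvexitySet (A : Finset E) (f : E → ℝ) : Set ℝ :=
  {c | ∃ x ∈ domain A, ∃ y ∈ domain A, ∃ s v : E, IsFWAtom A f x s ∧
    IsWorstAwayAtom A f x v ∧ ⟪gradient f x, y - x⟫_ℝ < 0 ∧
    c = 2 / awayStepSize f x y s v ^ 2 * (f y - f x - ⟪gradient f x, y - x⟫_ℝ)}

lemma nonneg_of_mem_strongConvexitySet (hconv : ConvexOn ℝ (domain A) f)
    (hdiff : ∀ x ∈ domain A, DifferentiableAt ℝ f x) {c : ℝ}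
    (hc : c ∈ strongConvexitySet A f) : 0 ≤ c := by
  obtain ⟨x, hx, y, hy, s, v, -, -, -, rfl⟩ := hc
  have := inner_gradient_le hconv hx hy (hdiff x hx)
  exact mul_nonneg (by positivity) (by linarith)

lemma geometricStrongConvexity_nonneg (hconv : ConvexOn ℝ (domain A) f)
    (hdiff : ∀ x ∈ domain A, DifferentiableAt ℝ f x) : 0 ≤ geometricStrongConvexity A f :=
  Real.sInf_nonneg fun _ hc => nonneg_of_mem_strongConvexitySet hconv hdiff hc

/-- The rates are proved for any lower bound of `strongConvexitySet`. This treats the constant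
itself and `μ * pyramidalWidth A ^ 2` alike, without a case distinction for the empty set, where
`sInf` is `0` by default. -/
lemma geometricStrongConvexity_mem_lowerBounds (hconv : ConvexOn ℝ (domain A) f)
    (hdiff : ∀ x ∈ domain A, DifferentiableAt ℝ f x) :
    geometricStrongConvexity A f ∈ lowerBounds (strongConvexitySet A f) := fun _ hc =>
  csInf_le ⟨0, fun _ h => nonneg_of_mem_strongConvexitySet hconv hdiff h⟩ hc

lemma inner_sub_le_of_isWorstAwayAtom {x y s v : E} (hy : y ∈ domain A)
    (hs : IsFWAtom A f x s) (hv : IsWorstAwayAtom A f x v) :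
    ⟪-gradient f x, y - x⟫_ℝ ≤ ⟪-gradient f x, s - v⟫_ℝ := by
  obtain ⟨⟨S, hS, hvS⟩, -⟩ := hv
  have h1 := hvS.inner_le (mem_domain_of_activeSets hS)
  have h2 := hs.inner_le hy
  simp only [inner_neg_left, inner_sub_right]
  linarith

/-- Geometric strong convexity bounds the suboptimality by the pairwise Frank-Wolfe gap. -/
lemma two_mul_mul_sub_le_sq (hconv : ConvexOn ℝ (domain A) f)
    (hdiff : ∀ x ∈ domain A, DifferentiableAt ℝ f x) {m : ℝ}
    (hm : m ∈ lowerBounds (strongConvexitySet A f)) {x y s v : E} {S : Finset E}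
    (hS : S ∈ activeSets A x) (hs : IsFWAtom A f x s) (hv : IsAwayAtom f x S v)
    (hy : y ∈ domain A) (hle : f y ≤ f x) :
    2 * m * (f x - f y) ≤ ⟪-gradient f x, s - v⟫_ℝ ^ 2 := by
  have hx := mem_domain_of_activeSets' hS
  have hgrad := inner_gradient_le hconv hx hy (hdiff x hx)
  rcases lt_or_ge ⟪gradient f x, y - x⟫_ℝ 0 with hneg | hneg
  · obtain ⟨v', hv'⟩ := exists_isWorstAwayAtom hS f
    have h1 := inner_sub_le_of_isWorstAwayAtom hy hs hv'
    have h2 : ⟪-gradient f x, s - v'⟫_ℝ ≤ ⟪-gradient f x, s - v⟫_ℝ := by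
      have := hv'.2 S hS v hv
      simp only [inner_neg_left, inner_sub_right]
      linarith
    have h3 := hm ⟨x, hx, y, hy, s, v', hs, hv', hneg, rfl⟩
    have he : 0 < ⟪-gradient f x, y - x⟫_ℝ := by rw [inner_neg_left]; linarith
    have hgr : ⟪gradient f x, y - x⟫_ℝ = -⟪-gradient f x, y - x⟫_ℝ := by
      rw [inner_neg_left, neg_neg]
    rw [hgr] at h3 hgrad
    unfold awayStepSize at h3
    set e := ⟪-gradient f x, y - x⟫_ℝ
    set g' := ⟪-gradient f x, s - v'⟫_ℝ
    set g := ⟪-gradient f x, s - v⟫_ℝ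
    have hg' : 0 < g' := he.trans_le h1
    have hγ : 0 < e / g' := div_pos he hg'
    rw [div_mul_eq_mul_div, le_div_iff₀ (by positivity)] at h3
    have heq : e = e / g' * g' := by field_simp
    set γ := e / g'
    have h4 : g' ^ 2 ≤ g ^ 2 := pow_le_pow_left₀ hg'.le h2 2
    rcases le_or_gt 0 m with hm0 | hm0
    -- Since `e = γ * g'`, the defining inequality reads `f x - f y ≤ γ * g' - m * γ ^ 2 / 2`, and
    -- `2 * m` times the right side is `g' ^ 2 - (g' - m * γ) ^ 2`.
    · nlinarith [sq_nonneg (g' - m * γ)]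
    · nlinarith [sq_nonneg g]
  · have : f x - f y = 0 := by linarith
    rw [this, mul_zero]
    positivity

/-- Unless `f` is constant on the domain, geometric strong convexity is at most the curvature. -/
lemma le_of_mem_lowerBounds_strongConvexitySet (hconv : ConvexOn ℝ (domain A) f)
    (hdiff : ∀ x ∈ domain A, DifferentiableAt ℝ f x) {m C : ℝ}
    (hm : m ∈ lowerBounds (strongConvexitySet A f)) (hC : CurvatureBound A f C) {x y : E}
    (hx : x ∈ domain A) (hy : y ∈ domain A) (hxy : ⟪gradient f x, y - x⟫_ℝ < 0) : m ≤ C := by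
  -- If every atom were a minimizer, convexity would make `x` one as well, and no point of the
  -- domain could lie in a descent direction.
  obtain ⟨a, ha, b, hb, hab⟩ : ∃ a ∈ A, ∃ b ∈ domain A, f b < f a := by
    by_contra! hcon
    obtain ⟨a, ha, hxa⟩ := hconv.exists_ge_of_mem_convexHull (subset_convexHull ℝ _) hx
    have := inner_gradient_nonneg (d := y - x) (hdiff x hx) one_pos fun u hu hu1 =>
      hxa.trans (hcon a ha _ ((convex_domain A).add_smul_sub_mem hx hy ⟨hu.le, hu1.le⟩))
    linarith
  have ha' := mem_domain_of_mem ha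
  obtain ⟨s, hs⟩ := exists_isFWAtom ⟨a, ha⟩ f a
  obtain ⟨v, hv⟩ := exists_isWorstAwayAtom (singleton_mem_activeSets ha) f
  have h1 : ⟪gradient f a, b - a⟫_ℝ < 0 :=
    (inner_gradient_le hconv ha' hb (hdiff a ha')).trans_lt (by linarith)
  have h2 : ⟪gradient f a, s - a⟫_ℝ < 0 := by
    have := hs.inner_le hb
    rw [inner_sub_right] at h1 ⊢
    linarith
  -- As `{a}` is an active set of the atom `a`, the worst-case away atom has the slope of `a`. With
  -- `y = s` the away step-size is then `1`, where `m` and `C` bound the same quantity.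
  have hva : ⟪gradient f a, v⟫_ℝ = ⟪gradient f a, a⟫_ℝ := by
    refine le_antisymm (hv.2 {a} (singleton_mem_activeSets ha) a ⟨by simp, by simp⟩) ?_
    obtain ⟨⟨S, hS, hvS⟩, -⟩ := hv
    exact hvS.inner_le (mem_domain_of_activeSets hS)
  have h3 := hm ⟨a, ha', s, mem_domain_of_mem hs.1, s, v, hs, hv, h2, rfl⟩
  have h4 : awayStepSize f a s s v = 1 := by
    unfold awayStepSize
    have : ⟪-gradient f a, s - v⟫_ℝ = ⟪-gradient f a, s - a⟫_ℝ := by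
      simp only [inner_neg_left, inner_sub_right, hva]
    rw [this, div_self]
    rw [inner_neg_left]
    linarith
  have h5 := hC.2 a ha' s (mem_domain_of_mem hs.1) 1 (by simp)
  rw [h4] at h3
  simp only [one_smul, add_sub_cancel] at h5
  linarith

end FrankWolfe

/-! ### Finitely generated cones and the pyramidal width. -/

namespace FrankWolfe

open Set

variable {E : Type*} [NormedAddCommGroup E] [InnerProductSpace ℝ E] [CompleteSpace E]
  {A : Finset E} {f : E → ℝ}

/-! ### Finitely generated cones are closed -/

/-- The cone generated by the vectors `v a`, `a ∈ A`. -/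
def finCone {ι : Type*} (A : Finset ι) (v : ι → E) : Set E :=
  {z | ∃ c : ι → ℝ, (∀ a ∈ A, 0 ≤ c a) ∧ z = ∑ a ∈ A, c a • v a}

lemma finCone_mono {ι : Type*} {A B : Finset ι} {v : ι → E} (h : A ⊆ B) :
    finCone A v ⊆ finCone B v := by
  classical
  rintro z ⟨c, hc, rfl⟩
  refine ⟨fun a => if a ∈ A then c a else 0, fun a _ => ?_, ?_⟩
  · dsimp only
    split_ifs with ha
    exacts [hc a ha, le_rfl]
  · rw [← Finset.sum_subset h (fun a _ ha => by simp [ha])]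
    exact Finset.sum_congr rfl fun a ha => by simp [ha]

/-- Carathéodory's argument: subtracting the largest multiple of a linear relation that keeps the
coefficients nonnegative makes one generator superfluous. The minimal ratio `c a / d a` is that
multiple. -/
lemma exists_linearIndepOn_mem_finCone {ι : Type*} (A : Finset ι) (v : ι → E) {z : E}
    (hz : z ∈ finCone A v) : ∃ B ⊆ A, LinearIndepOn ℝ v (B : Set ι) ∧ z ∈ finCone B v := by
  classical
  induction A using Finset.strongInduction with
  | H A ih =>
  by_cases hli : LinearIndepOn ℝ v (A : Set ι)
  · exact ⟨A, subset_rfl, hli, hz⟩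
  obtain ⟨c, hc, hzc⟩ := hz
  obtain ⟨d, hd0, hdpos⟩ : ∃ d : ι → ℝ, ∑ a ∈ A, d a • v a = 0 ∧ ∃ a ∈ A, 0 < d a := by
    rw [linearIndepOn_finset_iff] at hli
    push Not at hli
    obtain ⟨d, hd, a, ha, hda⟩ := hli
    rcases hda.lt_or_gt with h | h
    · exact ⟨-d, by simpa using hd, a, ha, by simpa using h⟩
    · exact ⟨d, hd, a, ha, h⟩
  obtain ⟨b, hb, hmin⟩ := (A.filter fun a => 0 < d a).exists_min_image (fun a => c a / d a)
    (by obtain ⟨a, ha, h⟩ := hdpos; exact ⟨a, Finset.mem_filter.2 ⟨ha, h⟩⟩)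
  rw [Finset.mem_filter] at hb
  have hnn : ∀ a ∈ A, 0 ≤ c a - c b / d b * d a := by
    intro a ha
    have hcb : 0 ≤ c b / d b := div_nonneg (hc b hb.1) hb.2.le
    rcases le_or_gt (d a) 0 with h | h
    · nlinarith [hc a ha]
    · have := hmin a (Finset.mem_filter.2 ⟨ha, h⟩)
      rw [le_div_iff₀ h] at this
      linarith
  have hz' : z ∈ finCone (A.erase b) v := by
    refine ⟨fun a => c a - c b / d b * d a, fun a ha => hnn a (Finset.mem_of_mem_erase ha), ?_⟩
    rw [Finset.sum_erase]
    · simp only [sub_smul, mul_smul, Finset.sum_sub_distrib, ← Finset.smul_sum, hd0, smul_zero,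
        sub_zero, hzc]
    · dsimp only
      rw [div_mul_cancel₀ _ hb.2.ne', sub_self, zero_smul]
  obtain ⟨B, hB, h⟩ := ih _ (Finset.erase_ssubset hb.1) hz'
  exact ⟨B, hB.trans (Finset.erase_subset _ _), h⟩

/-- For independent generators the coefficient map is a closed embedding, and the cone is the image
of the closed orthant. A general cone is a finite union of such cones. -/
lemma isClosed_finCone_of_linearIndepOn {ι : Type*} {A : Finset ι} {v : ι → E}
    (h : LinearIndepOn ℝ v (A : Set ι)) : IsClosed (finCone A v) := by
  classical
  let Φ : (A → ℝ) →ₗ[ℝ] E := Fintype.linearCombination ℝ (fun a : A => v a)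
  have hker : LinearMap.ker Φ = ⊥ :=
    LinearMap.ker_eq_bot.2 (linearIndependent_iff_injective_fintypeLinearCombination.1 h)
  have hemb := LinearMap.isClosedEmbedding_of_injective hker
  have : finCone A v = Φ '' {c | ∀ i, 0 ≤ c i} := by
    ext z
    constructor
    · rintro ⟨c, hc, rfl⟩
      refine ⟨fun a => c a, fun a => hc a a.2, ?_⟩
      rw [Fintype.linearCombination_apply, Finset.sum_coe_sort A (fun a => c a • v a)]
    · rintro ⟨c, hc, rfl⟩
      refine ⟨fun a => if ha : a ∈ A then c ⟨a, ha⟩ else 0, fun a ha => by simpa [ha] using hc _, ?_⟩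
      rw [Fintype.linearCombination_apply, ← Finset.sum_coe_sort A]
      exact Finset.sum_congr rfl fun a _ => by simp
  rw [this]
  refine hemb.isClosedMap _ ?_
  simp only [ofPred_forall]
  exact isClosed_iInter fun i => isClosed_le continuous_const (continuous_apply i)

lemma isClosed_finCone {ι : Type*} (A : Finset ι) (v : ι → E) : IsClosed (finCone A v) := by
  have : finCone A v
      = ⋃ B ∈ {B : Finset ι | B ⊆ A ∧ LinearIndepOn ℝ v (B : Set ι)}, finCone B v := by
    ext z
    simp only [mem_iUnion, exists_prop, mem_ofPred_eq]
    constructor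
    · intro hz
      obtain ⟨B, hB, hli, hz⟩ := exists_linearIndepOn_mem_finCone A v hz
      exact ⟨B, ⟨hB, hli⟩, hz⟩
    · rintro ⟨B, ⟨hB, -⟩, hz⟩
      exact finCone_mono hB hz
  rw [this]
  refine Finite.isClosed_biUnion ?_ fun B hB => isClosed_finCone_of_linearIndepOn hB.2
  exact A.powerset.finite_toSet.subset fun B hB => Finset.mem_coe.2 (Finset.mem_powerset.2 hB.1)

lemma convex_finCone {ι : Type*} (A : Finset ι) (v : ι → E) : Convex ℝ (finCone A v) := by
  rintro _ ⟨c, hc, rfl⟩ _ ⟨d, hd, rfl⟩ a b ha hb -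
  refine ⟨fun i => a * c i + b * d i, fun i hi => ?_, ?_⟩
  · have := hc i hi
    have := hd i hi
    positivity
  · simp only [add_smul, mul_smul, Finset.sum_add_distrib, Finset.smul_sum]

lemma smul_mem_finCone {ι : Type*} {A : Finset ι} {v : ι → E} {z : E} {k : ℝ} (hk : 0 ≤ k)
    (hz : z ∈ finCone A v) : k • z ∈ finCone A v := by
  obtain ⟨c, hc, rfl⟩ := hz
  exact ⟨fun i => k * c i, fun i hi => mul_nonneg hk (hc i hi),
    by simp only [mul_smul, Finset.smul_sum]⟩

/-- Moreau decomposition with respect to a finitely generated cone. -/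
lemma exists_projection_finCone {ι : Type*} (A : Finset ι) (v : ι → E) (r : E) :
    ∃ p ∈ finCone A v, ⟪r - p, p⟫_ℝ = 0 ∧ ∀ z ∈ finCone A v, ⟪r - p, z⟫_ℝ ≤ 0 := by
  obtain ⟨p, hp, hmin⟩ := exists_norm_eq_iInf_of_complete_convex
    (⟨0, fun _ => 0, by simp, by simp⟩ : (finCone A v).Nonempty)
    (isClosed_finCone A v).isComplete (convex_finCone A v) r
  have h := (norm_eq_iInf_iff_real_inner_le_zero (convex_finCone A v) hp).1 hmin
  -- The variational inequality is tested at `2 • p` and at `0`.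
  have h0 : ⟪r - p, p⟫_ℝ = 0 := by
    have h1 := h _ (smul_mem_finCone zero_le_two hp)
    have h2 := h _ (smul_mem_finCone le_rfl hp)
    rw [two_smul, add_sub_cancel_right] at h1
    rw [zero_smul, zero_sub, inner_neg_right] at h2
    linarith
  refine ⟨p, hp, h0, fun z hz => ?_⟩
  have := h z hz
  rwa [inner_sub_right, h0, sub_zero] at this

/-- Makes the projection onto feasible directions available, the cone being finitely generated and
hence closed. -/
lemma feasibleCone_domain {x : E} (hx : x ∈ domain A) :
    feasibleCone (domain A) x = finCone A (fun a => a - x) := by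
  ext r
  constructor
  · rintro ⟨c, hc, y, hy, rfl⟩
    obtain ⟨w, hw, h1, rfl⟩ := (Finset.mem_convexHull' ).1 hy
    refine ⟨fun a => c * w a, fun a ha => mul_nonneg hc (hw a ha), ?_⟩
    simp only [mul_smul, ← Finset.smul_sum, smul_sub, Finset.sum_sub_distrib, ← Finset.sum_smul,
      h1, one_smul]
  · rintro ⟨c, hc, rfl⟩
    have hs := Finset.sum_nonneg hc
    rcases hs.eq_or_lt with h0 | h0
    · have := (Finset.sum_eq_zero_iff_of_nonneg hc).1 h0.symm
      refine ⟨0, le_rfl, x, hx, ?_⟩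
      rw [Finset.sum_eq_zero fun a ha => by rw [this a ha, zero_smul], zero_smul]
    · set k := ∑ a ∈ A, c a
      refine ⟨k, hs, ∑ a ∈ A, (c a / k) • a, sum_smul_mem_domain
        (fun a ha => div_nonneg (hc a ha) hs) ?_, ?_⟩
      · rw [← Finset.sum_div, div_self h0.ne']
      · simp only [smul_sub, Finset.sum_sub_distrib, ← Finset.sum_smul, Finset.smul_sum, smul_smul,
          mul_div_cancel₀ _ h0.ne']
        rfl

/-! ### Pyramidal width -/

lemma finite_pairValues (V S : Finset E) (r : E) :
    {c : ℝ | ∃ s ∈ V, ∃ v ∈ S, c = ⟪(1 / ‖r‖) • r, s - v⟫_ℝ}.Finite := by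
  refine ((V ×ˢ S).finite_toSet.image fun p => ⟪(1 / ‖r‖) • r, p.1 - p.2⟫_ℝ).subset ?_
  rintro c ⟨s, hs, v, hv, rfl⟩
  exact ⟨(s, v), by simp [hs, hv], rfl⟩

lemma sSup_pairValues_nonneg {V S : Finset E} {x : E} (hS : S ∈ activeSets V x) (r : E) :
    0 ≤ sSup {c : ℝ | ∃ s ∈ V, ∃ v ∈ S, c = ⟪(1 / ‖r‖) • r, s - v⟫_ℝ} := by
  obtain ⟨v, hv⟩ := activeSets_nonempty hS
  exact le_csSup (finite_pairValues V S r).bddAbove ⟨v, hS.1 hv, v, hv, by simp⟩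

lemma pyramidalDirWidth_nonneg (V : Finset E) (r x : E) : 0 ≤ pyramidalDirWidth V r x := by
  refine Real.sInf_nonneg ?_
  rintro _ ⟨S, hS, rfl⟩
  exact sSup_pairValues_nonneg hS r

lemma pyramidalDirWidth_le {V S : Finset E} {x r : E} {c : ℝ} (hS : S ∈ activeSets V x)
    (h : ∀ s ∈ V, ∀ v ∈ S, ⟪(1 / ‖r‖) • r, s - v⟫_ℝ ≤ c) : pyramidalDirWidth V r x ≤ c := by
  have hbdd : BddBelow {w | ∃ S ∈ activeSets V x,
      w = sSup {c | ∃ s ∈ V, ∃ v ∈ S, c = ⟪(1 / ‖r‖) • r, s - v⟫_ℝ}} := by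
    refine ⟨0, ?_⟩
    rintro _ ⟨S, hS, rfl⟩
    exact sSup_pairValues_nonneg hS r
  refine (csInf_le hbdd ⟨S, hS, rfl⟩).trans (csSup_le ?_ ?_)
  · obtain ⟨v, hv⟩ := activeSets_nonempty hS
    exact ⟨_, v, hS.1 hv, v, hv, rfl⟩
  · rintro _ ⟨s, hs, v, hv, rfl⟩
    exact h s hs v hv

lemma pyramidalWidth_nonneg (A : Finset E) : 0 ≤ pyramidalWidth A := by
  refine Real.sInf_nonneg ?_
  rintro _ ⟨K, -, x, -, r, -, -, rfl⟩
  exact pyramidalDirWidth_nonneg _ _ _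

lemma pyramidalWidth_le {K : Set E} (hK : IsExposed ℝ (domain A) K) {x r : E} (hx : x ∈ K)
    (hr : r ∈ feasibleCone K x) (h0 : r ≠ 0) {V : Finset E} (hV : ∀ a, a ∈ V ↔ a ∈ A ∧ a ∈ K) :
    pyramidalWidth A ≤ pyramidalDirWidth V r x := by
  classical
  obtain rfl : V = A.filter (fun a => a ∈ K) := by
    ext a
    rw [hV, Finset.mem_filter]
  refine csInf_le ⟨0, ?_⟩ ⟨K, hK, x, hx, r, hr, h0, by congr⟩
  rintro _ ⟨K, -, x, -, r, -, -, rfl⟩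
  exact pyramidalDirWidth_nonneg _ _ _

/-- A convex combination that attains the maximum attains it at every atom of positive weight. -/
lemma mem_of_inner_eq_of_activeSets {S : Finset E} {x q : E} (hS : S ∈ activeSets A x)
    (hq : ∀ z ∈ domain A, ⟪q, z⟫_ℝ ≤ ⟪q, x⟫_ℝ) : ∀ v ∈ S, ⟪q, v⟫_ℝ = ⟪q, x⟫_ℝ := by
  obtain ⟨hSA, w, hw, h1, hx⟩ := hS
  have hsum : ∑ v ∈ S, w v * (⟪q, x⟫_ℝ - ⟪q, v⟫_ℝ) = 0 := by
    have : ∑ v ∈ S, w v * ⟪q, v⟫_ℝ = ⟪q, x⟫_ℝ := by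
      rw [← hx, inner_sum]
      simp only [inner_smul_right]
    simp only [mul_sub, Finset.sum_sub_distrib, this, ← Finset.sum_mul, h1]
    ring
  intro v hv
  have := (Finset.sum_eq_zero_iff_of_nonneg fun v hv => mul_nonneg (hw v hv).le
    (sub_nonneg.2 (hq v (mem_domain_of_mem (hSA hv))))).1 hsum v hv
  rcases mul_eq_zero.1 this with h | h
  · exact absurd h (hw v hv).ne'
  · linarith

/-- The pyramidal width bounds from below the pairwise Frank-Wolfe gap in terms of the slope
towards any point of the domain. -/
theorem pyramidalWidth_mul_inner_le {x y r s v : E} {S : Finset E} (hS : S ∈ activeSets A x)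
    (hy : y ∈ domain A) (hpos : 0 < ⟪r, y - x⟫_ℝ)
    (hs : ∀ a ∈ A, ⟪r, a⟫_ℝ ≤ ⟪r, s⟫_ℝ) (hv : ∀ a ∈ S, ⟪r, v⟫_ℝ ≤ ⟪r, a⟫_ℝ) :
    pyramidalWidth A * ⟪r, y - x⟫_ℝ ≤ ‖y - x‖ * ⟪r, s - v⟫_ℝ := by
  classical
  have hx := mem_domain_of_activeSets' hS
  -- The width concerns feasible directions only, and `r` need not be one. Its projection `p` is
  -- feasible, while `r - p` is normal to the domain at `x`.
  obtain ⟨p, hp, hp0, hpz⟩ := exists_projection_finCone A (fun a => a - x) r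
  rw [← feasibleCone_domain hx] at hp hpz
  have hq : ∀ z ∈ domain A, ⟪r - p, z⟫_ℝ ≤ ⟪r - p, x⟫_ℝ := by
    intro z hz
    have := hpz (z - x) ⟨1, zero_le_one, z, hz, by simp⟩
    rw [inner_sub_right] at this
    linarith
  have hrp : ⟪r, y - x⟫_ℝ ≤ ⟪p, y - x⟫_ℝ := by
    have := hpz (y - x) ⟨1, zero_le_one, y, hy, by simp⟩
    rw [inner_sub_left] at this
    linarith
  have hp_ne : p ≠ 0 := by
    rintro rfl
    rw [inner_zero_left] at hrp
    linarith
  have hnorm : 0 < ‖p‖ := norm_pos_iff.2 hp_ne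
  -- The face exposed by the normal part. It contains `x` and the active atoms, and `p` stays
  -- feasible in it because `r - p` is orthogonal to `p`.
  let K : Set E := {z ∈ domain A | ∀ y ∈ domain A, innerSL ℝ (r - p) y ≤ innerSL ℝ (r - p) z}
  have hK : IsExposed ℝ (domain A) K := fun _ => ⟨innerSL ℝ (r - p), rfl⟩
  have hxK : x ∈ K := ⟨hx, hq⟩
  have hKeq : ∀ z ∈ K, ⟪r - p, z⟫_ℝ = ⟪r - p, x⟫_ℝ := fun z hz =>
    le_antisymm (hq z hz.1) (hz.2 x hx)
  have hpK : p ∈ feasibleCone K x := by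
    obtain ⟨c, hc, z, hz, hpc⟩ := hp
    refine ⟨c, hc, z, ⟨hz, fun u hu => (hq u hu).trans ?_⟩, hpc⟩
    have hc' : c ≠ 0 := by
      rintro rfl
      exact hp_ne (by rw [hpc, zero_smul])
    have hzx : ⟪r - p, z - x⟫_ℝ = 0 := by
      have h0 : ⟪r - p, c • (z - x)⟫_ℝ = 0 := by rw [← hpc]; exact hp0
      rw [inner_smul_right] at h0
      exact (mul_eq_zero.1 h0).resolve_left hc'
    rw [inner_sub_right] at hzx
    simp only [innerSL_apply_apply]
    linarith
  have hSK : ∀ u ∈ S, u ∈ K := fun u hu =>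
    ⟨mem_domain_of_mem (hS.1 hu), fun z hz =>
      (hq z hz).trans (mem_of_inner_eq_of_activeSets hS hq u hu).ge⟩
  have hSV : S ∈ activeSets (A.filter (fun a => a ∈ K)) x :=
    ⟨fun u hu => Finset.mem_filter.2 ⟨hS.1 hu, hSK u hu⟩, hS.2⟩
  have hwidth : pyramidalWidth A ≤ ⟪r, s - v⟫_ℝ / ‖p‖ := by
    refine (pyramidalWidth_le hK hxK hpK hp_ne (fun a => Finset.mem_filter)).trans (pyramidalDirWidth_le hSV ?_)
    intro a ha u hu
    rw [Finset.mem_filter] at ha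
    rw [real_inner_smul_left, one_div, inv_mul_eq_div]
    refine div_le_div_of_nonneg_right ?_ hnorm.le
    -- On the face `r - p` is constant, so `p` and `r` agree on differences of its atoms.
    have h1 := hKeq a ha.2
    have h2 := hKeq u (hSK u hu)
    have h3 := hs a ha.1
    have h4 := hv u hu
    simp only [inner_sub_left, inner_sub_right] at h1 h2 ⊢
    linarith
  rw [le_div_iff₀ hnorm] at hwidth
  have h1 := real_inner_le_norm p (y - x)
  have h2 : pyramidalWidth A * ⟪r, y - x⟫_ℝ ≤ pyramidalWidth A * (‖p‖ * ‖y - x‖) :=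
    mul_le_mul_of_nonneg_left (hrp.trans h1) (pyramidalWidth_nonneg A)
  have h3 := mul_le_mul_of_nonneg_right hwidth (norm_nonneg (y - x))
  linarith

/-- Strong convexity and the pyramidal width bound geometric strong convexity from below. -/
theorem mul_pyramidalWidth_sq_mem_lowerBounds
    (hdiff : ∀ x ∈ domain A, DifferentiableAt ℝ f x) {μ : ℝ} (hμ : 0 ≤ μ)
    (hf : StrongConvexOn (domain A) μ f) :
    μ * pyramidalWidth A ^ 2 ∈ lowerBounds (strongConvexitySet A f) := by
  rintro _ ⟨x, hx, y, hy, s, v, hs, hv, hneg, rfl⟩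
  have h1 := inner_sub_le_of_isWorstAwayAtom hy hs hv
  obtain ⟨⟨S, hS, hvS⟩, -⟩ := hv
  have h2 := inner_gradient_le_of_strongConvexOn hf hx hy (hdiff x hx)
  have he : 0 < ⟪-gradient f x, y - x⟫_ℝ := by rw [inner_neg_left]; linarith
  have h3 := pyramidalWidth_mul_inner_le hS hy he
    (fun a ha => by simpa only [inner_neg_left, neg_le_neg_iff] using hs.2 a ha)
    (fun a ha => by simpa only [inner_neg_left, neg_le_neg_iff] using hvS.2 a ha)
  unfold awayStepSize
  set e := ⟪-gradient f x, y - x⟫_ℝ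
  set g := ⟪-gradient f x, s - v⟫_ℝ
  have hg : 0 < g := he.trans_le h1
  rw [div_mul_eq_mul_div, le_div_iff₀ (by positivity), div_pow, mul_div_assoc',
    div_le_iff₀ (by positivity)]
  -- The away step-size being `e / g`, the width trades `pyramidalWidth A * e` for `‖y - x‖ * g`,
  -- and strong convexity bounds `μ * ‖y - x‖ ^ 2`.
  have h4 : (pyramidalWidth A * e) ^ 2 ≤ (‖y - x‖ * g) ^ 2 :=
    pow_le_pow_left₀ (mul_nonneg (pyramidalWidth_nonneg A) he.le) h3 2
  have h5 := mul_le_mul_of_nonneg_left h4 hμ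
  have h6 : μ * ‖y - x‖ ^ 2 ≤ 2 * (f y - f x - ⟪gradient f x, y - x⟫_ℝ) := by linarith
  have h7 := mul_le_mul_of_nonneg_right h6 (sq_nonneg g)
  nlinarith

end FrankWolfe

/-! ### Progress of a single step, exact line search and weights. -/

namespace FrankWolfe

open Set

variable {E : Type*} [NormedAddCommGroup E] [InnerProductSpace ℝ E] [CompleteSpace E]
  {A : Finset E} {f : E → ℝ}

/-! ### Steps with sufficient decrease -/

/-- The step from `x` to `x'` decreases `f` as much as an optimal step with slope `-d` and
curvature `C`, where `κ * d` is at least the pairwise gap. -/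
def SufficientDecrease (A : Finset E) (f : E → ℝ) (C κ : ℝ) (x x' : E) : Prop :=
  ∃ S s v d, S ∈ activeSets A x ∧ IsFWAtom A f x s ∧ IsAwayAtom f x S v ∧
    0 < ⟪-gradient f x, s - x⟫_ℝ ∧ ⟪-gradient f x, s - x⟫_ℝ ≤ d ∧
    ⟪-gradient f x, s - v⟫_ℝ ≤ κ * d ∧
    ∀ η ∈ Icc (0 : ℝ) 1, f x' ≤ f x - η * d + η ^ 2 * C / 2

/-- The rate `m / (4 * C)`, shared by the four methods in the Euclidean form, only asks for `κ = 2`.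
-/
lemma SufficientDecrease.two {C : ℝ} {x x' : E} (h : SufficientDecrease A f C 1 x x') :
    SufficientDecrease A f C 2 x x' := by
  obtain ⟨S, s, v, d, hS, hs, hv, h1, h2, h3, h4⟩ := h
  exact ⟨S, s, v, d, hS, hs, hv, h1, h2, by linarith, h4⟩

lemma sub_le_inner_of_isFWAtom (hconv : ConvexOn ℝ (domain A) f)
    (hdiff : ∀ x ∈ domain A, DifferentiableAt ℝ f x) {x y s : E} (hx : x ∈ domain A)
    (hy : y ∈ domain A) (hs : IsFWAtom A f x s) : f x - f y ≤ ⟪-gradient f x, s - x⟫_ℝ := by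
  have h1 := inner_gradient_le hconv hx hy (hdiff x hx)
  have h2 := hs.inner_le hy
  simp only [inner_neg_left, inner_sub_right] at h1 ⊢
  linarith

lemma inner_sub_le_of_isAwayAtom {x v : E} {S : Finset E} (hS : S ∈ activeSets A x) (s : E)
    (hv : IsAwayAtom f x S v) :
    ⟪-gradient f x, s - x⟫_ℝ ≤ ⟪-gradient f x, s - v⟫_ℝ := by
  have := hv.inner_le (mem_domain_of_activeSets hS)
  simp only [inner_neg_left, inner_sub_right]
  linarith

section Rates

variable {xstar : E} {x : ℕ → E} {good : ℕ → Prop} {T : ℕ} {C m : ℝ}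

lemma subopt_nonneg (hmin : IsMinOn f (domain A) xstar) {t : ℕ} (hx : x t ∈ domain A) :
    0 ≤ subopt f xstar x t := sub_nonneg.2 (hmin hx)

lemma linearRate_quarter (hconv : ConvexOn ℝ (domain A) f)
    (hdiff : ∀ x ∈ domain A, DifferentiableAt ℝ f x) (hmem : xstar ∈ domain A)
    (hmin : IsMinOn f (domain A) xstar) (hC : CurvatureBound A f C)
    (hm : m ∈ lowerBounds (strongConvexitySet A f)) (hx : ∀ t ≤ T, x t ∈ domain A)
    (hmono : ∀ t < T, f (x (t + 1)) ≤ f (x t))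
    (hgood : ∀ t < T, good t → SufficientDecrease A f C 2 (x t) (x (t + 1))) :
    LinearRate (subopt f xstar x) good T (m / (4 * C)) := by
  refine LinearRate.of_steps (fun t ht => subopt_nonneg hmin (hx t ht))
    (fun t ht => sub_le_sub_right (hmono t ht) _) fun t ht hg => ?_
  obtain ⟨S, s, v, d, hS, hs, hv, h0, h1, h2, h3⟩ := hgood t ht hg
  have hxt := hx t ht.le
  refine le_one_sub_quarter_mul (subopt_nonneg hmin hxt)
    ((sub_le_inner_of_isFWAtom hconv hdiff hxt hmem hs).trans h1)
    (h0.le.trans (inner_sub_le_of_isAwayAtom hS s hv)) h2 hC.1 ?_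
    (two_mul_mul_sub_le_sq hconv hdiff hm hS hs hv hmem (hmin hxt)) ?_
  · refine le_of_mem_lowerBounds_strongConvexitySet hconv hdiff hm hC hxt
      (mem_domain_of_mem hs.1) ?_
    rw [inner_neg_left] at h0
    linarith
  · intro η hη
    have := h3 η hη
    unfold subopt
    linarith

lemma linearRate_min (hconv : ConvexOn ℝ (domain A) f)
    (hdiff : ∀ x ∈ domain A, DifferentiableAt ℝ f x) (hmem : xstar ∈ domain A)
    (hmin : IsMinOn f (domain A) xstar)
    (hm : m ∈ lowerBounds (strongConvexitySet A f)) (hx : ∀ t ≤ T, x t ∈ domain A)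
    (hmono : ∀ t < T, f (x (t + 1)) ≤ f (x t))
    (hgood : ∀ t < T, good t → SufficientDecrease A f C 1 (x t) (x (t + 1))) :
    LinearRate (subopt f xstar x) good T (min (1 / 2) (m / C)) := by
  refine LinearRate.of_steps (fun t ht => subopt_nonneg hmin (hx t ht))
    (fun t ht => sub_le_sub_right (hmono t ht) _) fun t ht hg => ?_
  obtain ⟨S, s, v, d, hS, hs, hv, h0, h1, h2, h3⟩ := hgood t ht hg
  have hxt := hx t ht.le
  refine le_one_sub_min_mul (g := d) (subopt_nonneg hmin hxt)
    ((sub_le_inner_of_isFWAtom hconv hdiff hxt hmem hs).trans h1)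
    ((two_mul_mul_sub_le_sq hconv hdiff hm hS hs hv hmem (hmin hxt)).trans ?_) ?_
  · have := h0.le.trans (inner_sub_le_of_isAwayAtom hS s hv)
    exact pow_le_pow_left₀ this (by linarith) 2
  · intro η hη
    have := h3 η hη
    unfold subopt
    linarith

lemma SufficientDecrease.subopt_le (hconv : ConvexOn ℝ (domain A) f)
    (hdiff : ∀ x ∈ domain A, DifferentiableAt ℝ f x) (hmem : xstar ∈ domain A) {κ : ℝ} {t : ℕ}
    (hx : x t ∈ domain A) (h : SufficientDecrease A f C κ (x t) (x (t + 1))) :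
    ∀ η ∈ Icc (0 : ℝ) 1,
      subopt f xstar x (t + 1) ≤ (1 - η) * subopt f xstar x t + η ^ 2 * C / 2 := by
  intro η hη
  obtain ⟨S, s, v, d, hS, hs, hv, h0, h1, h2, h3⟩ := h
  have h4 := h3 η hη
  have h5 := mul_le_mul_of_nonneg_left
    ((sub_le_inner_of_isFWAtom hconv hdiff hx hmem hs).trans h1) hη.1
  unfold subopt
  linarith

lemma sublinearRate2 (hconv : ConvexOn ℝ (domain A) f)
    (hdiff : ∀ x ∈ domain A, DifferentiableAt ℝ f x) (hmem : xstar ∈ domain A)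
    (hC : 0 ≤ C) {κ : ℝ} (hx : ∀ t ≤ T, x t ∈ domain A)
    (hmono : ∀ t < T, f (x (t + 1)) ≤ f (x t))
    (hgood : ∀ t < T, good t → SufficientDecrease A f C κ (x t) (x (t + 1))) :
    SublinearRate2 (subopt f xstar x) good T C :=
  SublinearRate2.of_steps hC (fun t ht => sub_le_sub_right (hmono t ht) _) fun t ht hg =>
    (hgood t ht hg).subopt_le hconv hdiff hmem (hx t ht.le)

lemma sublinearRate4 (hconv : ConvexOn ℝ (domain A) f)
    (hdiff : ∀ x ∈ domain A, DifferentiableAt ℝ f x) (hmem : xstar ∈ domain A)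
    (hmin : IsMinOn f (domain A) xstar)
    (hC : 0 ≤ C) {κ : ℝ} (hx : ∀ t ≤ T, x t ∈ domain A)
    (hmono : ∀ t < T, f (x (t + 1)) ≤ f (x t))
    (hgood : ∀ t < T, good t → SufficientDecrease A f C κ (x t) (x (t + 1))) :
    SublinearRate4 (subopt f xstar x) good T (2 * C + subopt f xstar x 0) :=
  SublinearRate4.of_steps hC (subopt_nonneg hmin (hx 0 (Nat.zero_le T)))
    (fun t ht => sub_le_sub_right (hmono t ht) _) fun t ht hg =>
    (hgood t ht hg).subopt_le hconv hdiff hmem (hx t ht.le)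

end Rates

/-- An exact line search that is not truncated makes as much progress as any step of size at
most one according to the curvature bound. -/
lemma lineSearch_le (hdiff : ∀ x ∈ domain A, DifferentiableAt ℝ f x) {C : ℝ}
    (hC : AwayCurvatureBound A f C) {x s v d : E} (hx : x ∈ domain A) (hs : s ∈ domain A)
    (hv : v ∈ domain A) (hd : d = s - v) {γ γmax : ℝ}
    (hseg : ∀ η ∈ Icc 0 γmax, x + η • d ∈ domain A) (hdesc : 0 < ⟪-gradient f x, d⟫_ℝ)
    (hγ : γ ∈ Icc 0 γmax) (hmin : ∀ η ∈ Icc 0 γmax, f (x + γ • d) ≤ f (x + η • d))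
    (hgood : γ < γmax ∨ 1 ≤ γmax) :
    ∀ η ∈ Icc (0 : ℝ) 1, f (x + γ • d) ≤ f x - η * ⟪-gradient f x, d⟫_ℝ + η ^ 2 * C / 2 := by
  have hbound : ∀ η ∈ Icc (0 : ℝ) 1,
      f (x + η • d) ≤ f x - η * ⟪-gradient f x, d⟫_ℝ + η ^ 2 * C / 2 := by
    intro η hη
    have := hC.2 x hx s hs v hv η hη
    rw [← hd] at this
    rw [inner_neg_left]
    linarith
  intro η hη
  rcases le_or_gt 1 γmax with h1 | h1
  · exact (hmin η ⟨hη.1, hη.2.trans h1⟩).trans (hbound η hη)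
  have hlt : γ < γmax := hgood.resolve_right (not_le.2 h1)
  have hγpos : 0 < γ := by
    refine lt_of_le_of_ne hγ.1 fun h0 => ?_
    subst h0
    have := inner_gradient_nonneg (d := d) (hdiff x hx) hlt fun u hu hu1 => by
      simpa using hmin u ⟨hu.le, hu1.le⟩
    rw [inner_neg_left] at hdesc
    linarith
  have hx' := hseg γ hγ
  have hfwd : 0 ≤ ⟪gradient f (x + γ • d), d⟫_ℝ := by
    refine inner_gradient_nonneg (hdiff _ hx') (sub_pos.2 hlt) fun u hu hu1 => ?_
    rw [add_assoc, ← add_smul]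
    exact hmin _ ⟨by linarith, by linarith⟩
  -- The curvature bound is applied backwards, from the new point along `v - s`, where the slope
  -- along `d` is nonnegative. Added to the forward bound it yields `g ≤ γ * C`.
  have h2 := hC.2 _ hx' v hv s hs γ ⟨hγ.1, by linarith⟩
  rw [← neg_sub s v, ← hd, smul_neg, add_neg_cancel_right, inner_neg_right] at h2
  have h3 := hbound γ ⟨hγ.1, by linarith⟩
  set g := ⟪-gradient f x, d⟫_ℝ
  have h4 : g ≤ γ * C := by
    have : γ * g ≤ γ * (γ * C) := by nlinarith
    exact le_of_mul_le_mul_left this hγpos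
  have hCpos : 0 < C := by
    refine lt_of_le_of_ne hC.1 fun h0 => ?_
    rw [← h0] at h4
    linarith
  have h5 : g / C ≤ γ := by rwa [div_le_iff₀ hCpos]
  have h6 : 0 ≤ g / C := by positivity
  -- So the minimizer `g / C` of the parabola is an admissible step-size. At any other `η` the
  -- parabola is larger by `C * (q - η) ^ 2 / 2`, with `q = g / C`.
  have h7 := (hmin (g / C) ⟨h6, h5.trans hlt.le⟩).trans (hbound (g / C) ⟨h6, by linarith⟩)
  have e1 : g = g / C * C := by field_simp
  set q := g / C
  rw [e1] at h7 ⊢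
  nlinarith [mul_nonneg hC.1 (sq_nonneg (q - η))]

/-! ### Weights of the line-search variants -/

namespace LineSearchTrace

variable {τ : LineSearchTrace E} {t : ℕ} {ε : ℝ}

/-- The weights of the atoms represent the iterate as a convex combination. -/
def WeightsValid (τ : LineSearchTrace E) (A : Finset E) (t : ℕ) : Prop :=
  (∀ a ∈ A, 0 ≤ τ.weight t a) ∧ ∑ a ∈ A, τ.weight t a = 1 ∧ ∑ a ∈ A, τ.weight t a • a = τ.x t

/-- The weights are updated along a direction `δ` that represents the search direction, and
stay nonnegative up to the maximal step-size. -/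
def FeasibleUpdate (τ : LineSearchTrace E) (A : Finset E) (t : ℕ) : Prop :=
  ∃ δ : E → ℝ, ∑ a ∈ A, δ a = 0 ∧ ∑ a ∈ A, δ a • a = τ.d t ∧
    (∀ η ∈ Icc 0 (τ.γmax t), ∀ a ∈ A, 0 ≤ τ.weight t a + η * δ a) ∧
    ∀ a, τ.weight (t + 1) a = τ.weight t a + τ.γ t * δ a

lemma mem_active {a : E} : a ∈ τ.active A t ↔ a ∈ A ∧ 0 < τ.weight t a := by
  classical
  unfold active
  exact Finset.mem_filter

lemma active_subset : τ.active A t ⊆ A := fun _ h => (mem_active.1 h).1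

lemma WeightsValid.active_mem (h : τ.WeightsValid A t) :
    τ.active A t ∈ activeSets A (τ.x t) := by
  have hz : ∀ a ∈ A, a ∉ τ.active A t → τ.weight t a = 0 := fun a ha hna =>
    le_antisymm (not_lt.1 fun h' => hna (mem_active.2 ⟨ha, h'⟩)) (h.1 a ha)
  refine ⟨active_subset, τ.weight t, fun v hv => (mem_active.1 hv).2, ?_, ?_⟩
  · rw [Finset.sum_subset active_subset hz, h.2.1]
  · rw [Finset.sum_subset active_subset fun a ha hna => by rw [hz a ha hna, zero_smul], h.2.2]

lemma WeightsValid.mem_domain (h : τ.WeightsValid A t) : τ.x t ∈ domain A :=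
  mem_domain_of_activeSets' h.active_mem

lemma WeightsValid.weight_le_one (h : τ.WeightsValid A t) {a : E} (ha : a ∈ A) :
    τ.weight t a ≤ 1 := h.2.1 ▸ Finset.single_le_sum h.1 ha

lemma Starts.weightsValid (h : τ.Starts A) : τ.WeightsValid A 0 := by
  classical
  obtain ⟨h1, h2⟩ := h
  refine ⟨fun a _ => ?_, ?_, ?_⟩
  · rw [h2]
    split_ifs <;> norm_num
  · simp only [h2]
    simp [h1]
  · simp only [h2]
    simp [h1]

lemma Starts.active_card (h : τ.Starts A) : (τ.active A 0).card = 1 := by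
  classical
  rw [Finset.card_eq_one]
  refine ⟨τ.x 0, ?_⟩
  ext a
  rw [mem_active, h.2, Finset.mem_singleton]
  constructor
  · rintro ⟨-, h3⟩
    by_contra hne
    simp [hne] at h3
  · rintro rfl
    exact ⟨h.1, by simp⟩

lemma FeasibleUpdate.mem_domain (h : τ.FeasibleUpdate A t) (hw : τ.WeightsValid A t) :
    ∀ η ∈ Icc 0 (τ.γmax t), τ.x t + η • τ.d t ∈ domain A := by
  intro η hη
  obtain ⟨δ, h0, hd, hnn, -⟩ := h
  have e : τ.x t + η • τ.d t = ∑ a ∈ A, (τ.weight t a + η * δ a) • a := by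
    simp only [add_smul, mul_smul, Finset.sum_add_distrib, ← Finset.smul_sum, hd, hw.2.2]
  rw [e]
  refine sum_smul_mem_domain (hnn η hη) ?_
  rw [Finset.sum_add_distrib, ← Finset.mul_sum, h0, hw.2.1]
  ring

lemma FeasibleUpdate.weightsValid_succ (h : τ.FeasibleUpdate A t) (hw : τ.WeightsValid A t)
    (hs : τ.CommonStep A f ε t) : τ.WeightsValid A (t + 1) := by
  obtain ⟨δ, h0, hd, hnn, hup⟩ := h
  refine ⟨fun a ha => ?_, ?_, ?_⟩
  · rw [hup]
    exact hnn _ hs.stepSize_mem a ha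
  · simp only [hup, Finset.sum_add_distrib, ← Finset.mul_sum, h0, hw.2.1]
    ring
  · simp only [hup, add_smul, mul_smul, Finset.sum_add_distrib, ← Finset.smul_sum, hd, hw.2.2,
      hs.update]

lemma FWBranch.feasibleUpdate (h : τ.FWBranch f t) (hw : τ.WeightsValid A t)
    (hs : τ.CommonStep A f ε t) : τ.FeasibleUpdate A t := by
  classical
  obtain ⟨-, hd, hmax, hup⟩ := h
  have hsA := hs.fwAtom.1
  refine ⟨fun a => (if a = τ.s t then 1 else 0) - τ.weight t a, ?_, ?_, ?_, ?_⟩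
  · rw [Finset.sum_sub_distrib, hw.2.1]
    simp [hsA]
  · simp only [sub_smul, Finset.sum_sub_distrib, hw.2.2, hd]
    simp [hsA]
  · intro η hη a ha
    rw [hmax] at hη
    have := hw.1 a ha
    have h1 := mul_nonneg (sub_nonneg.2 hη.2) this
    dsimp only
    split_ifs <;> linarith [hη.1]
  · intro a
    rw [hup]
    dsimp only
    split_ifs <;> ring

lemma AwayBranch.feasibleUpdate (h : τ.AwayBranch f t) (hw : τ.WeightsValid A t)
    (hs : τ.CommonStep A f ε t) : τ.FeasibleUpdate A t := by
  classical
  obtain ⟨-, hd, hmax, hup⟩ := h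
  have hvA := (mem_active.1 hs.awayAtom.1).1
  refine ⟨fun a => τ.weight t a - (if a = τ.v t then 1 else 0), ?_, ?_, ?_, ?_⟩
  · rw [Finset.sum_sub_distrib, hw.2.1]
    simp [hvA]
  · simp only [sub_smul, Finset.sum_sub_distrib, hw.2.2, hd]
    simp [hvA]
  · intro η hη a ha
    rw [hmax] at hη
    have h1 := hw.1 a ha
    have h2 := mul_nonneg hη.1 h1
    dsimp only
    split_ifs with hav
    · subst hav
      -- If the away atom has all the weight, `γmax` is a division by zero; its weight then changes
      -- by `η * (1 - 1)`, whatever `η` is.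
      rcases (hw.weight_le_one ha).eq_or_lt with h3 | h3
      · rw [h3] at hη ⊢
        linarith
      · have := hη.2
        rw [le_div_iff₀ (sub_pos.2 h3)] at this
        linarith
    · linarith
  · intro a
    rw [hup]
    dsimp only
    split_ifs <;> ring

lemma PairwiseBranch.feasibleUpdate (h : τ.PairwiseBranch t) (hw : τ.WeightsValid A t)
    (hs : τ.CommonStep A f ε t) : τ.FeasibleUpdate A t := by
  classical
  obtain ⟨hd, hmax, hup⟩ := h
  have hsA := hs.fwAtom.1
  have hvA := (mem_active.1 hs.awayAtom.1).1
  refine ⟨fun a => (if a = τ.s t then 1 else 0) - (if a = τ.v t then 1 else 0), ?_, ?_, ?_, ?_⟩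
  · simp [hsA, hvA]
  · simp only [sub_smul, Finset.sum_sub_distrib, hd]
    simp [hsA, hvA]
  · intro η hη a ha
    rw [hmax] at hη
    have h1 := hw.1 a ha
    dsimp only
    split_ifs with h2 h3 h3
    · linarith
    · linarith [hη.1]
    · subst h3
      linarith [hη.2]
    · linarith
  · intro a
    rw [hup]
    dsimp only
    split_ifs <;> ring

lemma CommonStep.le (hs : τ.CommonStep A f ε t) : f (τ.x (t + 1)) ≤ f (τ.x t) := by
  have := hs.lineSearch 0 ⟨le_rfl, hs.stepSize_mem.1.trans hs.stepSize_mem.2⟩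
  rw [hs.update]
  simpa using this

lemma CommonStep.γ_eq (hs : τ.CommonStep A f ε t) (h : ¬ τ.γ t < τ.γmax t) :
    τ.γ t = τ.γmax t := le_antisymm hs.stepSize_mem.2 (not_lt.1 h)

lemma CommonStep.weight_v_pos (hs : τ.CommonStep A f ε t) : 0 < τ.weight t (τ.v t) :=
  (mem_active.1 hs.awayAtom.1).2

lemma CommonStep.inner_pos (hs : τ.CommonStep A f ε t) (hε : 0 ≤ ε) :
    0 < ⟪-gradient f (τ.x t), τ.s t - τ.x t⟫_ℝ := hε.trans_lt hs.not_stopped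

end LineSearchTrace

end FrankWolfe

/-! ### Away-steps and pairwise variants. -/

namespace FrankWolfe

open Set

variable {E : Type*} [NormedAddCommGroup E] [InnerProductSpace ℝ E] [CompleteSpace E]
  {A : Finset E} {f : E → ℝ} {ε : ℝ} {T : ℕ} {τ : LineSearchTrace E} {xstar : E} {C m : ℝ}

namespace LineSearchTrace

/-! ### Away-steps Frank-Wolfe -/

lemma active_succ_subset_insert_of_weight_le [DecidableEq E] {t : ℕ} {s : E}
    (h : ∀ a ∈ A, a ≠ s → 0 < τ.weight (t + 1) a → 0 < τ.weight t a) :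
    τ.active A (t + 1) ⊆ insert s (τ.active A t) := by
  intro a ha
  rw [mem_active] at ha
  by_cases has : a = s
  · exact Finset.mem_insert.2 (Or.inl has)
  · exact Finset.mem_insert_of_mem (mem_active.2 ⟨ha.1, h a ha.1 has ha.2⟩)

lemma FWBranch.card_active_succ_le {t : ℕ} (h : τ.FWBranch f t) (hs : τ.CommonStep A f ε t) :
    (τ.active A (t + 1)).card ≤ (τ.active A t).card + 1 := by
  classical
  refine (Finset.card_le_card (active_succ_subset_insert_of_weight_le (s := τ.s t) ?_)).trans
    (Finset.card_insert_le _ _)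
  intro a _ has hpos
  rw [h.2.2.2, if_neg has, add_zero] at hpos
  have := hs.stepSize_mem.2
  rw [h.2.2.1] at this
  exact pos_of_mul_pos_right hpos (sub_nonneg.2 this)

lemma AwayBranch.active_succ_subset {t : ℕ} (h : τ.AwayBranch f t) (hs : τ.CommonStep A f ε t) :
    τ.active A (t + 1) ⊆ τ.active A t := by
  intro a ha
  rw [mem_active] at ha ⊢
  refine ⟨ha.1, ?_⟩
  have hpos := ha.2
  rw [h.2.2.2] at hpos
  have h0 := hs.stepSize_mem.1
  have : 0 < (1 + τ.γ t) * τ.weight t a := by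
    split_ifs at hpos <;> linarith
  exact pos_of_mul_pos_right this (by linarith)

/-- A maximal away step empties the away atom, and no atom enters. Full weight on that atom is
excluded: its away gap would be zero, not above the positive Frank-Wolfe gap. -/
lemma AwayBranch.drop {t : ℕ} (h : τ.AwayBranch f t) (hs : τ.CommonStep A f ε t)
    (hw : τ.WeightsValid A t) (hε : 0 ≤ ε) (hγ : τ.γ t = τ.γmax t) : τ.Drop A t := by
  refine Finset.card_lt_card ((Finset.ssubset_iff_of_subset (h.active_succ_subset hs)).2
    ⟨τ.v t, hs.awayAtom.1, fun hv => ?_⟩)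
  have h1 := (mem_active.1 hv).2
  have h2 := hw.weight_le_one (mem_active.1 hv).1
  rw [h.2.2.2, if_pos rfl, hγ, h.2.2.1] at h1
  rcases h2.eq_or_lt with h3 | h3
  · have hsingle : ∀ a ∈ A, a ≠ τ.v t → τ.weight t a = 0 := by
      intro a ha hav
      classical
      have hvA := (mem_active.1 hv).1
      have := hw.2.1
      rw [← Finset.add_sum_erase A _ hvA, h3, add_eq_left,
        Finset.sum_eq_zero_iff_of_nonneg fun b hb => hw.1 b (Finset.mem_of_mem_erase hb)] at this
      exact this a (Finset.mem_erase.2 ⟨hav, ha⟩)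
    have hx : τ.x t = τ.v t := by
      rw [← hw.2.2, Finset.sum_eq_single (τ.v t) (fun a ha hav => by
        rw [hsingle a ha hav, zero_smul]) fun hna => absurd (mem_active.1 hv).1 hna, h3, one_smul]
    have h4 := h.1
    rw [hx, sub_self, inner_zero_right, ← hx] at h4
    linarith [hs.inner_pos hε]
  · have : (1 - τ.weight t (τ.v t)) ≠ 0 := by linarith
    field_simp at h1
    simp at h1

end LineSearchTrace

open LineSearchTrace

lemma IsAFW.weightsValid (h : IsAFW A f ε T τ) {t : ℕ} (ht : t ≤ T) : τ.WeightsValid A t := by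
  induction t with
  | zero => exact h.1.weightsValid
  | succ t ih =>
    have hw := ih (by omega)
    obtain ⟨hs, hb⟩ := h.2 t (by omega)
    rcases hb with hb | hb
    · exact (hb.feasibleUpdate hw hs).weightsValid_succ hw hs
    · exact (hb.feasibleUpdate hw hs).weightsValid_succ hw hs

lemma IsAFW.good_of_not_drop (h : IsAFW A f ε T τ) (hε : 0 ≤ ε) {t : ℕ} (ht : t < T)
    (hd : ¬ τ.Drop A t) : τ.Good t := by
  obtain ⟨hs, hb⟩ := h.2 t ht
  rcases hb with hb | hb
  · exact Or.inr hb.2.2.1.ge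
  · by_contra hg
    exact hd (hb.drop hs (h.weightsValid ht.le) hε (hs.γ_eq fun hlt => hg (Or.inl hlt)))

lemma IsAFW.countSteps_drop_le (h : IsAFW A f ε T τ) {t : ℕ} (ht : t ≤ T) :
    (countSteps (τ.Drop A) 0 t : ℝ) ≤ t / 2 := by
  refine countSteps_decrease_le (c := fun t => (τ.active A t).card) h.1.active_card
    (fun t ht => (activeSets_nonempty (h.weightsValid ht).active_mem).card_pos) ?_ ht
  intro t ht
  obtain ⟨hs, hb⟩ := h.2 t ht
  rcases hb with hb | hb
  · exact hb.card_active_succ_le hs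
  · exact (Finset.card_le_card (hb.active_succ_subset hs)).trans (Nat.le_succ _)

lemma IsAFW.half_le_countSteps_good (h : IsAFW A f ε T τ) (hε : 0 ≤ ε) {t : ℕ} (ht : t ≤ T) :
    (t : ℝ) / 2 ≤ countSteps τ.Good 0 t := by
  refine (half_le_countSteps_not (h.countSteps_drop_le ht)).trans ?_
  exact_mod_cast countSteps_le_of_imp ht fun i hi hd => h.good_of_not_drop hε hi hd

lemma IsAFW.sufficientDecrease (h : IsAFW A f ε T τ) (hε : 0 ≤ ε)
    (hdiff : ∀ x ∈ domain A, DifferentiableAt ℝ f x) (hC : AwayCurvatureBound A f C) {t : ℕ}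
    (ht : t < T) (hg : τ.Good t) : SufficientDecrease A f C 2 (τ.x t) (τ.x (t + 1)) := by
  have hw := h.weightsValid ht.le
  obtain ⟨hs, hb⟩ := h.2 t ht
  have hpos := hs.inner_pos hε
  have hsplit : ⟪-gradient f (τ.x t), τ.s t - τ.v t⟫_ℝ
      = ⟪-gradient f (τ.x t), τ.s t - τ.x t⟫_ℝ + ⟪-gradient f (τ.x t), τ.x t - τ.v t⟫_ℝ := by
    rw [← inner_add_right, sub_add_sub_cancel]
  have hsD := mem_domain_of_mem hs.fwAtom.1
  have hvD := mem_domain_of_mem (active_subset hs.awayAtom.1)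
  rcases hb with hb | hb
  -- Both directions are differences of points of the domain, as the away curvature requires: `s -
  -- x` here, `x - v` below. The larger of the two gaps is at least half of their sum, the pairwise
  -- gap.
  · have hle := lineSearch_le hdiff hC hw.mem_domain hsD hw.mem_domain hb.2.1
      ((hb.feasibleUpdate hw hs).mem_domain hw) (by rw [hb.2.1]; exact hpos) hs.stepSize_mem
      hs.lineSearch hg
    rw [← hs.update, hb.2.1] at hle
    exact ⟨_, τ.s t, τ.v t, _, hw.active_mem, hs.fwAtom, hs.awayAtom, hpos, le_rfl,
      by linarith [hb.1], hle⟩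
  · have hle := lineSearch_le hdiff hC hw.mem_domain hw.mem_domain hvD hb.2.1
      ((hb.feasibleUpdate hw hs).mem_domain hw) (by rw [hb.2.1]; exact hpos.trans hb.1)
      hs.stepSize_mem hs.lineSearch hg
    rw [← hs.update, hb.2.1] at hle
    exact ⟨_, τ.s t, τ.v t, _, hw.active_mem, hs.fwAtom, hs.awayAtom, hpos, hb.1.le,
      by linarith [hb.1], hle⟩

theorem IsAFW.rates (h : IsAFW A f ε T τ) (hε : 0 ≤ ε) (hconv : ConvexOn ℝ (domain A) f)
    (hdiff : ∀ x ∈ domain A, DifferentiableAt ℝ f x) (hmem : xstar ∈ domain A)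
    (hmin : IsMinOn f (domain A) xstar) (hC : AwayCurvatureBound A f C)
    (hm : m ∈ lowerBounds (strongConvexitySet A f)) :
    LinearRate (subopt f xstar τ.x) τ.Good T (m / (4 * C)) ∧
    SublinearRate4 (subopt f xstar τ.x) τ.Good T (2 * C + subopt f xstar τ.x 0) :=
  have hx : ∀ t ≤ T, τ.x t ∈ domain A := fun _ ht => (h.weightsValid ht).mem_domain
  have hmono : ∀ t < T, f (τ.x (t + 1)) ≤ f (τ.x t) := fun t ht => (h.2 t ht).1.le
  have hgood := fun t ht hg => h.sufficientDecrease hε hdiff hC (t := t) ht hg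
  ⟨linearRate_quarter hconv hdiff hmem hmin hC.curvatureBound hm hx hmono hgood,
    sublinearRate4 hconv hdiff hmem hmin hC.1 hx hmono hgood⟩

/-! ### Pairwise Frank-Wolfe -/

namespace LineSearchTrace

variable {t : ℕ}

lemma CommonStep.s_ne_v (hs : τ.CommonStep A f ε t) (hw : τ.WeightsValid A t) (hε : 0 ≤ ε) :
    τ.s t ≠ τ.v t := by
  intro h
  have h1 := inner_sub_le_of_isAwayAtom hw.active_mem (τ.s t) hs.awayAtom
  rw [h, sub_self, inner_zero_right, ← h] at h1
  linarith [hs.inner_pos hε]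

lemma CommonStep.inner_d_pos (hs : τ.CommonStep A f ε t) (hw : τ.WeightsValid A t) (hε : 0 ≤ ε)
    (hb : τ.PairwiseBranch t) : 0 < ⟪-gradient f (τ.x t), τ.d t⟫_ℝ := by
  rw [hb.1]
  exact (hs.inner_pos hε).trans_le (inner_sub_le_of_isAwayAtom hw.active_mem _ hs.awayAtom)

lemma PairwiseBranch.active_succ_subset [DecidableEq E] (hb : τ.PairwiseBranch t)
    (hs : τ.CommonStep A f ε t) : τ.active A (t + 1) ⊆ insert (τ.s t) (τ.active A t) := by
  refine active_succ_subset_insert_of_weight_le ?_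
  intro a _ has hpos
  rw [hb.2.2, if_neg has, add_zero] at hpos
  have h0 := hs.stepSize_mem.1
  split_ifs at hpos <;> linarith

lemma PairwiseBranch.weight_v_succ (hb : τ.PairwiseBranch t) (hs : τ.CommonStep A f ε t)
    (hw : τ.WeightsValid A t) (hε : 0 ≤ ε) (hγ : ¬ τ.γ t < τ.γmax t) :
    τ.weight (t + 1) (τ.v t) = 0 := by
  rw [hb.2.2, if_pos rfl, if_neg (hs.s_ne_v hw hε).symm, hs.γ_eq hγ, hb.2.1]
  ring

/-- The away atom leaves, and at most the Frank-Wolfe atom enters. -/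
lemma PairwiseBranch.card_active_succ_le (hb : τ.PairwiseBranch t) (hs : τ.CommonStep A f ε t)
    (hw : τ.WeightsValid A t) (hε : 0 ≤ ε) (hγ : ¬ τ.γ t < τ.γmax t) :
    (τ.active A (t + 1)).card ≤ (τ.active A t).card := by
  classical
  have hsub : τ.active A (t + 1) ⊆ insert (τ.s t) ((τ.active A t).erase (τ.v t)) := by
    intro a ha
    have hav : a ≠ τ.v t := by
      rintro rfl
      exact (mem_active.1 ha).2.ne' (hb.weight_v_succ hs hw hε hγ)
    rcases Finset.mem_insert.1 (hb.active_succ_subset hs ha) with h | h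
    · exact Finset.mem_insert.2 (Or.inl h)
    · exact Finset.mem_insert_of_mem (Finset.mem_erase.2 ⟨hav, h⟩)
  refine (Finset.card_le_card hsub).trans ((Finset.card_insert_le _ _).trans ?_)
  rw [Finset.card_erase_add_one hs.awayAtom.1]

/-- Strictness excludes repeated iterates, on which the bound for swap steps depends. -/
lemma PairwiseBranch.lt (hb : τ.PairwiseBranch t) (hs : τ.CommonStep A f ε t)
    (hw : τ.WeightsValid A t) (hε : 0 ≤ ε)
    (hdiff : ∀ x ∈ domain A, DifferentiableAt ℝ f x) : f (τ.x (t + 1)) < f (τ.x t) := by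
  by_contra! hle
  have hpos := hs.inner_d_pos hw hε hb
  have hmax : 0 < τ.γmax t := hb.2.1 ▸ hs.weight_v_pos
  have := inner_gradient_nonneg (d := τ.d t) (hdiff _ hw.mem_domain) hmax fun u hu hu1 => by
    rw [hs.update] at hle
    exact hle.trans (hs.lineSearch u ⟨hu.le, hu1.le⟩)
  rw [inner_neg_left] at hpos
  linarith

/-- A truncated pairwise step that keeps the size of the active set swaps two weights. -/
lemma PairwiseBranch.weight_swap [DecidableEq E] (hb : τ.PairwiseBranch t)
    (hs : τ.CommonStep A f ε t)
    (hw : τ.WeightsValid A t) (hε : 0 ≤ ε) (hγ : ¬ τ.γ t < τ.γmax t)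
    (hcard : (τ.active A (t + 1)).card = (τ.active A t).card) (a : E) :
    τ.weight (t + 1) (Equiv.swap (τ.s t) (τ.v t) a) = τ.weight t a := by
  have hne := hs.s_ne_v hw hε
  -- The Frank-Wolfe atom must be new; otherwise the active set would lose `v` and gain nothing.
  have hsnot : τ.s t ∉ τ.active A t := by
    intro hmem
    refine hcard.not_lt (Finset.card_lt_card ((Finset.ssubset_iff_of_subset ?_).2
      ⟨τ.v t, hs.awayAtom.1, fun h =>
        (mem_active.1 h).2.ne' (hb.weight_v_succ hs hw hε hγ)⟩))
    have := hb.active_succ_subset hs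
    rwa [Finset.insert_eq_of_mem hmem] at this
  have hs0 : τ.weight t (τ.s t) = 0 :=
    le_antisymm (not_lt.1 fun h => hsnot (mem_active.2 ⟨hs.fwAtom.1, h⟩)) (hw.1 _ hs.fwAtom.1)
  by_cases h1 : a = τ.s t
  · rw [h1, Equiv.swap_apply_left, hb.weight_v_succ hs hw hε hγ, hs0]
  by_cases h2 : a = τ.v t
  · rw [h2, Equiv.swap_apply_right, hb.2.2, if_neg hne, if_pos rfl, hs0, hs.γ_eq hγ, hb.2.1]
    ring
  · rw [Equiv.swap_apply_of_ne_of_ne h1 h2, hb.2.2, if_neg h1, if_neg h2]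
    ring

end LineSearchTrace

lemma IsPFW.weightsValid (h : IsPFW A f ε T τ) {t : ℕ} (ht : t ≤ T) : τ.WeightsValid A t := by
  induction t with
  | zero => exact h.1.weightsValid
  | succ t ih =>
    have hw := ih (by omega)
    obtain ⟨hs, hb⟩ := h.2 t (by omega)
    exact (hb.feasibleUpdate hw hs).weightsValid_succ hw hs

lemma IsPFW.one_le_card (h : IsPFW A f ε T τ) {t : ℕ} (ht : t ≤ T) :
    1 ≤ (τ.active A t).card :=
  (activeSets_nonempty (h.weightsValid ht).active_mem).card_pos

lemma IsPFW.card_succ_le (h : IsPFW A f ε T τ) (hε : 0 ≤ ε) {t : ℕ} (ht : t < T)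
    (hγ : ¬ τ.γ t < τ.γmax t) : (τ.active A (t + 1)).card ≤ (τ.active A t).card :=
  (h.2 t ht).2.card_active_succ_le (h.2 t ht).1 (h.weightsValid ht.le) hε hγ

lemma IsPFW.good_of_not_drop_of_not_swap (h : IsPFW A f ε T τ) (hε : 0 ≤ ε) {t : ℕ} (ht : t < T)
    (hd : ¬ τ.Drop A t) (hsw : ¬ τ.Swap A t) : τ.Good t := by
  by_contra hg
  have hγ : ¬ τ.γ t < τ.γmax t := fun hlt => hg (Or.inl hlt)
  exact hsw ⟨(h.2 t ht).1.γ_eq hγ, (h.card_succ_le hε ht hγ).antisymm (not_lt.1 hd)⟩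

lemma IsPFW.countSteps_drop_le (h : IsPFW A f ε T τ) {t : ℕ} (ht : t ≤ T) :
    (countSteps (τ.Drop A) 0 t : ℝ) ≤ t / 2 := by
  classical
  refine countSteps_decrease_le (c := fun t => (τ.active A t).card) h.1.active_card
    (fun t ht => h.one_le_card ht) ?_ ht
  intro t ht
  obtain ⟨hs, hb⟩ := h.2 t ht
  exact (Finset.card_le_card (hb.active_succ_subset hs)).trans (Finset.card_insert_le _ _)

lemma IsPFW.f_lt (h : IsPFW A f ε T τ) (hε : 0 ≤ ε)
    (hdiff : ∀ x ∈ domain A, DifferentiableAt ℝ f x) {i j : ℕ} (hij : i < j) (hj : j ≤ T) :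
    f (τ.x j) < f (τ.x i) := by
  induction j, hij using Nat.le_induction with
  | base => exact (h.2 i (by omega)).2.lt (h.2 i (by omega)).1 (h.weightsValid (by omega)) hε hdiff
  | succ j _ ih =>
    exact ((h.2 j (by omega)).2.lt (h.2 j (by omega)).1 (h.weightsValid (by omega)) hε hdiff).trans
      (ih (by omega))

lemma IsPFW.card_antitone (h : IsPFW A f ε T τ) (hε : 0 ≤ ε) {i j : ℕ} (hij : i ≤ j) (hj : j ≤ T)
    (hγ : ∀ t, i ≤ t → t < j → ¬ τ.γ t < τ.γmax t) :
    (τ.active A j).card ≤ (τ.active A i).card := by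
  induction j, hij using Nat.le_induction with
  | base => exact le_rfl
  | succ j hij ih =>
    exact (h.card_succ_le hε (by omega) (hγ j hij (by omega))).trans
      (ih (by omega) fun t h1 h2 => hγ t h1 (by omega))

/-- In a run of truncated steps that keep the size of the active set, the weights are permuted. -/
lemma IsPFW.exists_perm (h : IsPFW A f ε T τ) (hε : 0 ≤ ε) {i j : ℕ} (hij : i ≤ j) (hj : j ≤ T)
    (hγ : ∀ t, i ≤ t → t < j → ¬ τ.γ t < τ.γmax t)
    (hcard : (τ.active A j).card = (τ.active A i).card) :
    ∃ σ : Equiv.Perm E, (∀ a, σ a ∈ A ↔ a ∈ A) ∧ ∀ a, τ.weight j (σ a) = τ.weight i a := by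
  classical
  induction j, hij using Nat.le_induction with
  | base => exact ⟨1, by simp, by simp⟩
  | succ j hij ih =>
    -- Sizes never increase in such a run, so equal sizes at its ends force equal sizes throughout.
    have h1 := h.card_succ_le hε (by omega) (hγ j hij (by omega))
    have h2 := h.card_antitone hε hij (by omega) fun t h1 h2 => hγ t h1 (by omega)
    obtain ⟨σ, hσA, hσ⟩ := ih (by omega) (fun t h1 h2 => hγ t h1 (by omega)) (by omega)
    obtain ⟨hs, hb⟩ := h.2 j (by omega)
    have hvA := active_subset hs.awayAtom.1
    have hsA := hs.fwAtom.1
    refine ⟨Equiv.swap (τ.s j) (τ.v j) * σ, fun a => ?_, fun a => ?_⟩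
    · rw [Equiv.Perm.mul_apply, ← hσA a]
      generalize σ a = b
      rcases eq_or_ne b (τ.s j) with rfl | h1
      · simp [hvA, hsA]
      rcases eq_or_ne b (τ.v j) with rfl | h2
      · simp [hvA, hsA]
      · rw [Equiv.swap_apply_of_ne_of_ne h1 h2]
    · rw [Equiv.Perm.mul_apply, hb.weight_swap hs (h.weightsValid (by omega)) hε
        (hγ j hij (by omega)) (by omega), hσ]

/-- A run of truncated steps visits each size `r` of the active set at most
`|A| (|A| - 1) ⋯ (|A| - r + 1)` times. -/
lemma IsPFW.card_filter_le (h : IsPFW A f ε T τ) (hε : 0 ≤ ε)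
    (hdiff : ∀ x ∈ domain A, DifferentiableAt ℝ f x) {a b : ℕ} (hb : b ≤ T)
    (hγ : ∀ t, a ≤ t → t < b → ¬ τ.γ t < τ.γmax t) (r : ℕ) :
    ((Finset.Ico a b).filter fun t => (τ.active A t).card = r).card ≤ A.card.descFactorial r := by
  classical
  set J := (Finset.Ico a b).filter fun t => (τ.active A t).card = r with hJ
  rcases J.eq_empty_or_nonempty with h0 | hne
  · simp [h0]
  have hJmem : ∀ t ∈ J, a ≤ t ∧ t < b ∧ (τ.active A t).card = r := fun t ht => by
    simpa [hJ, and_assoc] using ht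
  set t₀ := J.min' hne
  have ht₀ := hJmem t₀ (J.min'_mem hne)
  have hperm : ∀ t ∈ J, ∃ σ : Equiv.Perm E, (∀ a, σ a ∈ A ↔ a ∈ A) ∧
      ∀ a, τ.weight t (σ a) = τ.weight t₀ a := by
    intro t ht
    have h1 := hJmem t ht
    exact h.exists_perm hε (J.min'_le t ht) (by omega)
      (fun u hu hu' => hγ u (by omega) (by omega)) (by rw [h1.2.2, ht₀.2.2])
  choose! σ hσA hσ using hperm
  have hw₀ := h.weightsValid (show t₀ ≤ T by omega)
  -- A visit to size `r` is encoded by the injection that carries the active atoms of the first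
  -- visit to the current ones.
  let e : J → (τ.active A t₀ ↪ A) := fun t =>
    ⟨fun i => ⟨σ t i, (hσA t t.2 i).2 (active_subset i.2)⟩, fun i j hij => by
      have : σ t i = σ t j := congrArg Subtype.val hij
      exact Subtype.ext ((σ t).injective this)⟩
  -- Equal codes give equal weights and hence equal iterates, which strict decrease forbids at
  -- distinct times.
  have he : Function.Injective e := by
    intro t t' htt'
    have heq : ∀ i ∈ τ.active A t₀, σ t i = σ t' i := fun i hi =>
      congrArg Subtype.val (DFunLike.congr_fun htt' ⟨i, hi⟩)
    have key : ∀ t t' : J, (∀ i ∈ τ.active A t₀, σ t i = σ t' i) → ∀ c ∈ A,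
        0 < τ.weight t c → τ.weight t' c = τ.weight t c := by
      intro t t' heq c hc hpos
      obtain ⟨i, rfl⟩ := (σ t).surjective c
      rw [hσ t t.2] at hpos
      have hi : i ∈ τ.active A t₀ := mem_active.2 ⟨(hσA t t.2 i).1 hc, hpos⟩
      rw [hσ t t.2, heq i hi, hσ t' t'.2]
    have h1 := hJmem t t.2
    have h2 := hJmem t' t'.2
    have hwt := h.weightsValid (show (t : ℕ) ≤ T by omega)
    have hwt' := h.weightsValid (show (t' : ℕ) ≤ T by omega)
    have hweq : ∀ c ∈ A, τ.weight t c = τ.weight t' c := by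
      intro c hc
      rcases (hwt.1 c hc).eq_or_lt with h3 | h3
      · rcases (hwt'.1 c hc).eq_or_lt with h4 | h4
        · rw [← h3, ← h4]
        · exact key t' t (fun i hi => (heq i hi).symm) c hc h4
      · exact (key t t' heq c hc h3).symm
    have hx : τ.x t = τ.x t' := by
      rw [← hwt.2.2, ← hwt'.2.2]
      exact Finset.sum_congr rfl fun c hc => by rw [hweq c hc]
    rcases lt_trichotomy (t : ℕ) t' with h3 | h3 | h3
    · have := h.f_lt hε hdiff h3 (by omega)
      rw [hx] at this
      exact absurd this (lt_irrefl _)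
    · exact Subtype.ext h3
    · have := h.f_lt hε hdiff h3 (by omega)
      rw [hx] at this
      exact absurd this (lt_irrefl _)
  have := Fintype.card_le_of_injective e he
  rwa [Fintype.card_embedding_eq, Fintype.card_coe, Fintype.card_coe, Fintype.card_coe,
    ht₀.2.2] at this

/-- The sum for `N + 1` is `N + 1` times the sum for `N`, plus one. Strictness leaves the slack that
absorbs the added one. -/
lemma sum_descFactorial_lt (n : ℕ) :
    ∑ r ∈ Finset.range (n + 2), (n + 1).descFactorial r < 3 * (n + 1).factorial := by
  induction n with
  | zero => simp [Finset.sum_range_succ]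
  | succ n ih =>
    rw [Finset.sum_range_succ']
    simp only [Nat.succ_descFactorial_succ (n + 1), ← Finset.mul_sum, Nat.descFactorial_zero]
    rw [Nat.factorial_succ (n + 1)]
    nlinarith

lemma sum_descFactorial_le (n : ℕ) :
    ∑ r ∈ Finset.range (n + 1), n.descFactorial r ≤ 3 * n.factorial := by
  cases n with
  | zero => simp
  | succ n => exact (sum_descFactorial_lt n).le

/-- The length of a run of truncated steps. -/
lemma IsPFW.run_length_le (h : IsPFW A f ε T τ) (hε : 0 ≤ ε)
    (hdiff : ∀ x ∈ domain A, DifferentiableAt ℝ f x) {a b : ℕ} (hb : b ≤ T)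
    (hγ : ∀ t, a ≤ t → t < b → ¬ τ.γ t < τ.γmax t) : b - a ≤ 3 * A.card.factorial := by
  classical
  rw [← Nat.card_Ico, Finset.card_eq_sum_card_fiberwise (f := fun t => (τ.active A t).card)
    (t := Finset.range (A.card + 1)) fun t _ => by
      simpa [Nat.lt_succ_iff] using Finset.card_le_card active_subset]
  exact (Finset.sum_le_sum fun r _ => h.card_filter_le hε hdiff hb hγ r).trans
    (sum_descFactorial_le _)

lemma countSteps_le_sub (P : ℕ → Prop) (a b : ℕ) : countSteps P a b ≤ b - a := by
  classical
  exact (Finset.card_filter_le _ _).trans (Nat.card_Ico a b).le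

/-- Before the first step-size that is not truncated, all the weight is on one atom. -/
lemma IsPFW.good_of_no_untruncated (h : IsPFW A f ε T τ) (hε : 0 ≤ ε) {t : ℕ} (ht : t < T)
    (hγ : ∀ i < t, ¬ τ.γ i < τ.γmax i) : τ.Good t := by
  have hw := h.weightsValid ht.le
  obtain ⟨hs, hb⟩ := h.2 t ht
  have hcard : (τ.active A t).card ≤ 1 := by
    rw [← h.1.active_card]
    exact h.card_antitone hε (Nat.zero_le t) ht.le fun i _ hi => hγ i hi
  have hactive : τ.active A t = {τ.v t} :=
    Finset.eq_singleton_iff_unique_mem.2 ⟨hs.awayAtom.1, fun a ha =>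
      Finset.card_le_one.1 hcard a ha _ hs.awayAtom.1⟩
  right
  rw [hb.2.1, ← hw.2.1, ← Finset.sum_subset (active_subset (τ := τ) (t := t)), hactive,
    Finset.sum_singleton]
  exact fun a ha hna => le_antisymm (not_lt.1 fun hp => hna (mem_active.2 ⟨ha, hp⟩)) (hw.1 a ha)

/-- Time is cut at the last untruncated step `p`, which is good: at most `3 * A.card.factorial`
steps follow it, and induction covers the first `p`. If there is none, the active set remains a
single atom and every step is good. -/
lemma IsPFW.le_mul_countSteps_good (h : IsPFW A f ε T τ) (hε : 0 ≤ ε)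
    (hdiff : ∀ x ∈ domain A, DifferentiableAt ℝ f x) {t : ℕ} (ht : t ≤ T) :
    t ≤ (3 * A.card.factorial + 1) * countSteps τ.Good 0 t := by
  classical
  induction t using Nat.strong_induction_on with
  | _ t ih =>
  rcases ((Finset.range t).filter fun i => τ.γ i < τ.γmax i).eq_empty_or_nonempty with h0 | hne
  · have hno : ∀ i < t, ¬ τ.γ i < τ.γmax i := by
      simpa [Finset.filter_eq_empty_iff] using h0
    have : countSteps (fun _ => True) 0 t ≤ countSteps τ.Good 0 t := by
      refine countSteps_le_of_imp le_rfl fun i hi _ => ?_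
      exact h.good_of_no_untruncated hε (by omega) fun j hj => hno j (by omega)
    rw [countSteps_true] at this
    nlinarith
  · set P := (Finset.range t).filter fun i => τ.γ i < τ.γmax i with hP
    set p := P.max' hne
    have hp : p < t ∧ τ.γ p < τ.γmax p := by
      have := Finset.mem_filter.1 (P.max'_mem hne)
      exact ⟨Finset.mem_range.1 this.1, this.2⟩
    have hrun := h.run_length_le hε hdiff (a := p + 1) ht fun i hi hit hlt => by
      have := P.le_max' i (by simp [hP, hit, hlt])
      omega
    have h1 := ih p hp.1 (by omega)
    have h2 := countSteps_mono (P := τ.Good) (a := 0) (show p + 1 ≤ t by omega)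
    rw [countSteps_succ_of_pos (Nat.zero_le p) (Or.inl hp.2)] at h2
    have h3 := Nat.mul_le_mul_left (3 * A.card.factorial + 1) h2
    rw [mul_add, mul_one] at h3
    omega

lemma IsPFW.div_le_countSteps_good (h : IsPFW A f ε T τ) (hε : 0 ≤ ε)
    (hdiff : ∀ x ∈ domain A, DifferentiableAt ℝ f x) {t : ℕ} (ht : t ≤ T) :
    (t : ℝ) / (3 * A.card.factorial + 1) ≤ countSteps τ.Good 0 t := by
  rw [div_le_iff₀ (by positivity), mul_comm]
  exact_mod_cast h.le_mul_countSteps_good hε hdiff ht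

lemma IsPFW.sufficientDecrease (h : IsPFW A f ε T τ) (hε : 0 ≤ ε)
    (hdiff : ∀ x ∈ domain A, DifferentiableAt ℝ f x) (hC : AwayCurvatureBound A f C) {t : ℕ}
    (ht : t < T) (hg : τ.Good t) : SufficientDecrease A f C 1 (τ.x t) (τ.x (t + 1)) := by
  have hw := h.weightsValid ht.le
  obtain ⟨hs, hb⟩ := h.2 t ht
  have hle := lineSearch_le hdiff hC hw.mem_domain (mem_domain_of_mem hs.fwAtom.1)
    (mem_domain_of_mem (active_subset hs.awayAtom.1)) hb.1
    ((hb.feasibleUpdate hw hs).mem_domain hw) (hs.inner_d_pos hw hε hb) hs.stepSize_mem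
    hs.lineSearch hg
  rw [← hs.update, hb.1] at hle
  exact ⟨_, τ.s t, τ.v t, _, hw.active_mem, hs.fwAtom, hs.awayAtom, hs.inner_pos hε,
    inner_sub_le_of_isAwayAtom hw.active_mem _ hs.awayAtom, (one_mul _).ge, hle⟩

theorem IsPFW.rates (h : IsPFW A f ε T τ) (hε : 0 ≤ ε) (hconv : ConvexOn ℝ (domain A) f)
    (hdiff : ∀ x ∈ domain A, DifferentiableAt ℝ f x) (hmem : xstar ∈ domain A)
    (hmin : IsMinOn f (domain A) xstar) (hC : AwayCurvatureBound A f C)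
    (hm : m ∈ lowerBounds (strongConvexitySet A f)) :
    LinearRate (subopt f xstar τ.x) τ.Good T (min (1 / 2) (m / C)) ∧
    LinearRate (subopt f xstar τ.x) τ.Good T (m / (4 * C)) ∧
    SublinearRate2 (subopt f xstar τ.x) τ.Good T C :=
  have hx : ∀ t ≤ T, τ.x t ∈ domain A := fun _ ht => (h.weightsValid ht).mem_domain
  have hmono : ∀ t < T, f (τ.x (t + 1)) ≤ f (τ.x t) := fun t ht => (h.2 t ht).1.le
  have hgood := fun t ht hg => h.sufficientDecrease hε hdiff hC (t := t) ht hg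
  ⟨linearRate_min hconv hdiff hmem hmin hm hx hmono hgood,
    linearRate_quarter hconv hdiff hmem hmin hC.curvatureBound hm hx hmono
      (fun t ht hg => (hgood t ht hg).two),
    sublinearRate2 hconv hdiff hmem hC.1 hx hmono hgood⟩

end FrankWolfe

/-! ### Fully-corrective variants; affine hulls and relative interiors. -/

namespace FrankWolfe

open Set

variable {E : Type*} [NormedAddCommGroup E] [InnerProductSpace ℝ E] [CompleteSpace E]
  {A : Finset E} {f : E → ℝ} {ε : ℝ} {T : ℕ} {τ : CorrectiveTrace E} {xstar : E} {C m : ℝ}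

/-! ### Fully-corrective Frank-Wolfe -/

/-- The pairwise gap is the Frank-Wolfe gap plus the away gap. Approximate correction keeps the
latter below the former (`κ = 2`); exact correction and min-norm-point make it nonpositive (`κ =
1`). -/
lemma SufficientDecrease.of_corrective {κ : ℝ} (hC : CurvatureBound A f C) {x x' s : E}
    {S : Finset E} (hS : S ∈ activeSets A x) (hs : IsFWAtom A f x s)
    (hpos : 0 < ⟪-gradient f x, s - x⟫_ℝ)
    (haway : ∀ v ∈ S, ⟪-gradient f x, x - v⟫_ℝ ≤ (κ - 1) * ⟪-gradient f x, s - x⟫_ℝ)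
    (hx' : ∀ η ∈ Icc (0 : ℝ) 1, f x' ≤ f (x + η • (s - x))) :
    SufficientDecrease A f C κ x x' := by
  obtain ⟨v, hv⟩ := exists_isAwayAtom (activeSets_nonempty hS) f x
  refine ⟨S, s, v, _, hS, hs, hv, hpos, le_rfl, ?_, fun η hη => ?_⟩
  · rw [← sub_add_sub_cancel s x v, inner_add_right]
    linarith [haway v hv.1]
  · have := hC.2 x (mem_domain_of_activeSets' hS) s (mem_domain_of_mem hs.1) η hη
    rw [inner_neg_left]
    linarith [hx' η hη]

lemma IsFCFW.valid (h : IsFCFW A f ε T τ) {t : ℕ} (ht : t ≤ T) : τ.Valid A t := by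
  cases t with
  | zero => exact h.1
  | succ t => exact (h.2.2 t ht).2.1

lemma IsFCFW.awayGapLE (h : IsFCFW A f ε T τ) {t : ℕ} (ht : t ≤ T) : τ.AwayGapLE f ε t := by
  cases t with
  | zero => exact h.2.1
  | succ t => exact (h.2.2 t ht).2.2.2

lemma IsFCFW.sufficientDecrease (h : IsFCFW A f ε T τ) (hε : 0 ≤ ε) (hC : CurvatureBound A f C)
    {t : ℕ} (ht : t < T) : SufficientDecrease A f C 2 (τ.x t) (τ.x (t + 1)) := by
  obtain ⟨hc, -, hle, -⟩ := h.2.2 t ht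
  refine .of_corrective hC (h.valid ht.le).1 hc.1 (hε.trans_lt hc.2) (fun v hv => ?_) hle
  linarith [h.awayGapLE ht.le v hv, hc.2]

theorem IsFCFW.rates (h : IsFCFW A f ε T τ) (hε : 0 ≤ ε) (hconv : ConvexOn ℝ (domain A) f)
    (hdiff : ∀ x ∈ domain A, DifferentiableAt ℝ f x) (hmem : xstar ∈ domain A)
    (hmin : IsMinOn f (domain A) xstar) (hC : CurvatureBound A f C)
    (hm : m ∈ lowerBounds (strongConvexitySet A f)) :
    LinearRate (subopt f xstar τ.x) (fun _ => True) T (m / (4 * C)) ∧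
    SublinearRate4 (subopt f xstar τ.x) (fun _ => True) T (2 * C + subopt f xstar τ.x 0) :=
  have hx : ∀ t ≤ T, τ.x t ∈ domain A := fun _ ht => mem_domain_of_activeSets' (h.valid ht).1
  have hmono : ∀ t < T, f (τ.x (t + 1)) ≤ f (τ.x t) := fun t ht => by
    simpa using (h.2.2 t ht).2.2.1 0 (by simp)
  have hgood := fun t ht (_ : True) => h.sufficientDecrease hε hC (t := t) ht
  ⟨linearRate_quarter hconv hdiff hmem hmin hC hm hx hmono hgood,
    sublinearRate4 hconv hdiff hmem hmin hC.1 hx hmono hgood⟩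

lemma IsFCFWExact.valid (h : IsFCFWExact A f ε T τ) {t : ℕ} (ht : t ≤ T) : τ.Valid A t := by
  cases t with
  | zero => exact h.1
  | succ t => exact (h.2.2 t ht).2.1

/-- By first-order optimality the negative gradient is maximal at the iterate over the corrected
hull, hence it is constant on the active atoms. -/
lemma IsFCFWExact.awayGapLE (h : IsFCFWExact A f ε T τ)
    (hdiff : ∀ x ∈ domain A, DifferentiableAt ℝ f x) {t : ℕ} (ht : t ≤ T) :
    τ.AwayGapLE f 0 t := by
  classical
  cases t with
  | zero => exact h.2.1
  | succ t =>
    obtain ⟨hc, hval, hsub, hmin⟩ := h.2.2 t ht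
    have hS : τ.S (t + 1) ∈ activeSets (insert (τ.s t) (τ.V t)) (τ.x (t + 1)) :=
      ⟨hsub, hval.1.2⟩
    have hx := mem_domain_of_activeSets' hS
    have hle : ∀ z ∈ domain (insert (τ.s t) (τ.V t)),
        ⟪-gradient f (τ.x (t + 1)), z⟫_ℝ ≤ ⟪-gradient f (τ.x (t + 1)), τ.x (t + 1)⟫_ℝ := by
      intro z hz
      have := inner_gradient_nonneg (d := z - τ.x (t + 1))
        (hdiff _ (mem_domain_of_activeSets' hval.1)) one_pos fun u hu hu1 =>
          hmin ((convex_domain _).add_smul_sub_mem hx hz ⟨hu.le, hu1.le⟩)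
      rw [inner_sub_right] at this
      rw [inner_neg_left, inner_neg_left]
      linarith
    intro v hv
    rw [inner_sub_right, mem_of_inner_eq_of_activeSets hS hle v hv, sub_self]

lemma IsFCFWExact.le (h : IsFCFWExact A f ε T τ) {t : ℕ} (ht : t < T) :
    ∀ η ∈ Icc (0 : ℝ) 1, f (τ.x (t + 1)) ≤ f (τ.x t + η • (τ.s t - τ.x t)) := by
  classical
  intro η hη
  obtain ⟨-, -, -, hmin⟩ := h.2.2 t ht
  have hval := h.valid ht.le
  refine hmin ((convex_domain _).add_smul_sub_mem ?_ (mem_domain_of_mem (by simp)) hη)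
  exact domain_mono (hval.2.1.trans (Finset.subset_insert _ _)) (mem_domain_of_activeSets hval.1)

theorem IsFCFWExact.rate (h : IsFCFWExact A f ε T τ) (hε : 0 ≤ ε)
    (hconv : ConvexOn ℝ (domain A) f)
    (hdiff : ∀ x ∈ domain A, DifferentiableAt ℝ f x) (hmem : xstar ∈ domain A)
    (hmin : IsMinOn f (domain A) xstar) (hC : CurvatureBound A f C)
    (hm : m ∈ lowerBounds (strongConvexitySet A f)) :
    LinearRate (subopt f xstar τ.x) (fun _ => True) T (min (1 / 2) (m / C)) := by
  refine linearRate_min hconv hdiff hmem hmin hm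
    (fun _ ht => mem_domain_of_activeSets' (h.valid ht).1)
    (fun t ht => by simpa using h.le ht 0 (by simp)) fun t ht _ => ?_
  obtain ⟨hc, -⟩ := h.2.2 t ht
  refine .of_corrective hC (h.valid ht.le).1 hc.1 (hε.trans_lt hc.2) (fun v hv => ?_) (h.le ht)
  simpa using h.awayGapLE hdiff ht.le v hv

/-! ### Affine spans and relative interiors of finite sets -/

lemma mem_affineSpan_finset {S : Finset E} {z : E} :
    z ∈ affineSpan ℝ (S : Set E) ↔ ∃ b : E → ℝ, ∑ v ∈ S, b v = 1 ∧ ∑ v ∈ S, b v • v = z := by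
  classical
  constructor
  · intro hz
    let Q : AffineSubspace ℝ E :=
      { carrier := {z | ∃ b : E → ℝ, ∑ v ∈ S, b v = 1 ∧ ∑ v ∈ S, b v • v = z}
        smul_vsub_vadd_mem' := by
          rintro c _ _ _ ⟨b₁, h₁, rfl⟩ ⟨b₂, h₂, rfl⟩ ⟨b₃, h₃, rfl⟩
          refine ⟨fun v => c * (b₁ v - b₂ v) + b₃ v, ?_, ?_⟩
          · rw [Finset.sum_add_distrib, ← Finset.mul_sum, Finset.sum_sub_distrib, h₁, h₂, h₃]
            ring
          · simp only [add_smul, mul_smul, sub_smul, Finset.sum_add_distrib, ← Finset.smul_sum,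
              Finset.sum_sub_distrib, vsub_eq_sub, vadd_eq_add] }
    have hle : affineSpan ℝ (S : Set E) ≤ Q := affineSpan_le.2 fun v hv =>
      ⟨fun u => if u = v then 1 else 0, by simp [Finset.mem_coe.1 hv],
        by simp [Finset.mem_coe.1 hv]⟩
    exact hle hz
  · rintro ⟨b, h1, rfl⟩
    have hne : S.Nonempty := by
      rw [Finset.nonempty_iff_ne_empty]
      rintro rfl
      simp at h1
    obtain ⟨p, hp⟩ := hne
    have hp' : p ∈ affineSpan ℝ (S : Set E) := subset_affineSpan ℝ _ hp
    have e : ∑ v ∈ S, b v • v = (∑ v ∈ S, b v • (v - p)) +ᵥ p := by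
      simp only [smul_sub, Finset.sum_sub_distrib, ← Finset.sum_smul, h1, one_smul, vadd_eq_add,
        sub_add_cancel]
    rw [e]
    refine AffineSubspace.vadd_mem_of_mem_direction (Submodule.sum_mem _ fun v hv => ?_) hp'
    exact Submodule.smul_mem _ _ (AffineSubspace.vsub_mem_direction (subset_affineSpan ℝ _ hv) hp')

lemma domain_subset_affineSpan (S : Finset E) : domain S ⊆ affineSpan ℝ (S : Set E) :=
  convexHull_subset_affineSpan _

lemma add_smul_sub_mem_affineSpan {S : Set E} {x y : E} (hx : x ∈ affineSpan ℝ S)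
    (hy : y ∈ affineSpan ℝ S) (η : ℝ) : x + η • (y - x) ∈ affineSpan ℝ S := by
  have := AffineMap.lineMap_mem η hx hy
  rwa [AffineMap.lineMap_apply, vsub_eq_sub, vadd_eq_add, add_comm] at this

/-- From a convex combination one can move towards a point of the affine span whose coefficients
are nonnegative on the atoms of weight zero. -/
lemma exists_pos_add_smul_mem_domain {S : Finset E} {w b : E → ℝ} {x y : E}
    (hw : ∀ v ∈ S, 0 ≤ w v) (hw1 : ∑ v ∈ S, w v = 1) (hx : ∑ v ∈ S, w v • v = x)
    (hb1 : ∑ v ∈ S, b v = 1) (hy : ∑ v ∈ S, b v • v = y) (h : ∀ v ∈ S, 0 < w v ∨ 0 ≤ b v) :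
    ∃ η ∈ Ioo (0 : ℝ) 1, x + η • (y - x) ∈ domain S := by
  have hev : ∀ᶠ η in nhdsWithin (0 : ℝ) (Ioi 0), ∀ v ∈ S, 0 ≤ (1 - η) * w v + η * b v := by
    rw [Filter.eventually_all_finset]
    intro v hv
    rcases h v hv with h | h
    · have hc : Continuous fun η : ℝ => (1 - η) * w v + η * b v := by fun_prop
      have := (hc.tendsto 0).eventually (lt_mem_nhds (a := 0) (by simpa using h))
      exact (this.filter_mono nhdsWithin_le_nhds).mono fun η hη => hη.le
    · filter_upwards [Ioo_mem_nhdsGT one_pos] with η hη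
      have h1 := mul_nonneg (sub_nonneg.2 hη.2.le) (hw v hv)
      have h2 := mul_nonneg hη.1.le h
      linarith
  obtain ⟨η, hη, hη'⟩ := (hev.and (Ioo_mem_nhdsGT one_pos)).exists
  refine ⟨η, hη', ?_⟩
  have e : x + η • (y - x) = ∑ v ∈ S, ((1 - η) * w v + η * b v) • v := by
    simp only [add_smul, mul_smul, Finset.sum_add_distrib, ← Finset.smul_sum, hx, hy]
    module
  rw [e]
  refine sum_smul_mem_domain hη ?_
  rw [Finset.sum_add_distrib, ← Finset.mul_sum, ← Finset.mul_sum, hw1, hb1]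
  ring

lemma exists_pos_add_smul_mem_domain_of_activeSets {S : Finset E} {x y : E}
    (hS : S ∈ activeSets S x) (hy : y ∈ affineSpan ℝ (S : Set E)) :
    ∃ η ∈ Ioo (0 : ℝ) 1, x + η • (y - x) ∈ domain S := by
  obtain ⟨-, w, hw, hw1, hx⟩ := hS
  obtain ⟨b, hb1, hb⟩ := mem_affineSpan_finset.1 hy
  exact exists_pos_add_smul_mem_domain (fun v hv => (hw v hv).le) hw1 hx hb1 hb
    fun v hv => Or.inl (hw v hv)

lemma mem_intrinsicInterior_iff_exists_ball {s : Set E} {y : E} :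
    y ∈ intrinsicInterior ℝ s ↔
      y ∈ affineSpan ℝ s ∧ ∃ r > 0, ∀ z ∈ affineSpan ℝ s, dist z y < r → z ∈ s := by
  rw [mem_intrinsicInterior]
  constructor
  · rintro ⟨y, hy, rfl⟩
    obtain ⟨r, hr, hball⟩ := Metric.mem_nhds_iff.1 (mem_interior_iff_mem_nhds.1 hy)
    exact ⟨y.2, r, hr, fun z hz hzy => hball (a := ⟨z, hz⟩) hzy⟩
  · rintro ⟨hy, r, hr, h⟩
    refine ⟨⟨y, hy⟩, mem_interior_iff_mem_nhds.2 (Metric.mem_nhds_iff.2 ⟨r, hr, ?_⟩), rfl⟩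
    intro z hz
    exact h z z.2 hz

/-- A small move from `y` away from the barycenter of `S` stays in the hull, and `y` is a mean of
the point reached and the barycenter, which gives every atom positive weight. -/
lemma activeSets_of_mem_intrinsicInterior {S : Finset E} {y : E}
    (hy : y ∈ intrinsicInterior ℝ (domain S)) : S ∈ activeSets S y := by
  obtain ⟨hya, r, hr, hball⟩ := mem_intrinsicInterior_iff_exists_ball.1 hy
  have hyD := intrinsicInterior_subset hy
  have hne : S.Nonempty := nonempty_of_mem_domain hyD
  have hcard : (0 : ℝ) < S.card := by exact_mod_cast hne.card_pos
  have hsum : ∑ v ∈ S, (1 / S.card : ℝ) = 1 := by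
    rw [Finset.sum_const, nsmul_eq_mul, mul_one_div_cancel hcard.ne']
  set c := ∑ v ∈ S, (1 / S.card : ℝ) • v with hc
  have hcD : c ∈ domain S := sum_smul_mem_domain (fun _ _ => by positivity) hsum
  obtain ⟨η, hη, hdist⟩ : ∃ η > (0 : ℝ), dist (y + (-η) • (c - y)) y < r := by
    refine ⟨r / (2 * (‖c - y‖ + 1)), by positivity, ?_⟩
    rw [dist_eq_norm, add_sub_cancel_left, norm_smul, norm_neg, Real.norm_of_nonneg (by positivity),
      div_mul_eq_mul_div, div_lt_iff₀ (by positivity)]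
    nlinarith [norm_nonneg (c - y)]
  have hq := hball _ (add_smul_sub_mem_affineSpan hya (subset_affineSpan ℝ _ hcD) (-η)) hdist
  obtain ⟨w, hw, hw1, hwq⟩ := Finset.mem_convexHull'.1 hq
  refine ⟨subset_rfl, fun v => (1 + η)⁻¹ * (w v + η * (1 / S.card)), fun v hv => ?_, ?_, ?_⟩
  · have := hw v hv
    positivity
  · rw [← Finset.mul_sum, Finset.sum_add_distrib, hw1, ← Finset.mul_sum, hsum, mul_one,
      inv_mul_cancel₀ (by positivity)]
  · simp only [mul_smul, add_smul, ← Finset.smul_sum, Finset.sum_add_distrib, hwq]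
    rw [← hc, show y + -η • (c - y) + η • c = (1 + η) • y by module, smul_smul,
      inv_mul_cancel₀ (by positivity), one_smul]

/-- Positive weights allow the segment from a relatively interior point `c` to be prolonged beyond
`y` to some `q` in the hull. The contraction centred at `q` that takes `c` to `y` takes a relative
ball around `c` to one around `y`. -/
lemma mem_intrinsicInterior_of_activeSets [FiniteDimensional ℝ E] {S : Finset E} {y : E}
    (hS : S ∈ activeSets S y) : y ∈ intrinsicInterior ℝ (domain S) := by
  have hyD := mem_domain_of_activeSets hS
  obtain ⟨c, hc⟩ := Set.Nonempty.intrinsicInterior (convex_domain S) ⟨y, hyD⟩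
  obtain ⟨hca, r, hr, hball⟩ := mem_intrinsicInterior_iff_exists_ball.1 hc
  have hya : y ∈ affineSpan ℝ (domain S) := subset_affineSpan ℝ _ hyD
  have hspan : affineSpan ℝ (domain S) = affineSpan ℝ (S : Set E) := affineSpan_convexHull _
  obtain ⟨η, hη, hq⟩ := exists_pos_add_smul_mem_domain_of_activeSets hS (y := y + (-1 : ℝ) • (c - y))
    (hspan ▸ add_smul_sub_mem_affineSpan hya hca _)
  rw [mem_intrinsicInterior_iff_exists_ball]
  set q := y + η • (y + (-1 : ℝ) • (c - y) - y) with hqdef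
  have hη0 := hη.1
  refine ⟨hya, η / (1 + η) * r, by positivity, fun z hz hzy => ?_⟩
  have hc' : c + ((1 + η) / η) • (z - y) ∈ domain S := by
    refine hball _ ?_ ?_
    · have := AffineSubspace.vadd_mem_of_mem_direction (Submodule.smul_mem _ ((1 + η) / η)
        (AffineSubspace.vsub_mem_direction hz hya)) hca
      rwa [vadd_eq_add, add_comm] at this
    · rw [dist_eq_norm, add_sub_cancel_left, norm_smul, Real.norm_of_nonneg (by positivity),
        ← dist_eq_norm]
      calc (1 + η) / η * dist z y < (1 + η) / η * (η / (1 + η) * r) := by gcongr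
        _ = r := by field_simp
  have := convex_domain S hq hc' (a := 1 / (1 + η)) (b := η / (1 + η)) (by positivity)
    (by positivity) (by field_simp)
  convert this using 1
  rw [hqdef]
  match_scalars <;> field_simp <;> ring

/-- A point outside an affine span is separated from it by a linear functional. -/
lemma exists_inner_eq_of_notMem_affineSpan {S : Finset E} (hS : S.Nonempty) {u : E}
    (hu : u ∉ affineSpan ℝ (S : Set E)) :
    ∃ (c : E) (k : ℝ), (∀ z ∈ affineSpan ℝ (S : Set E), ⟪c, z⟫_ℝ = k) ∧ k < ⟪c, u⟫_ℝ := by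
  obtain ⟨p, hp⟩ := hS
  have hp' : p ∈ affineSpan ℝ (S : Set E) := subset_affineSpan ℝ _ hp
  set V := (affineSpan ℝ (S : Set E)).direction with hV
  have : FiniteDimensional ℝ V := by
    rw [hV, direction_affineSpan]
    exact finiteDimensional_vectorSpan_of_finite ℝ S.finite_toSet
  set c := (u - p) - V.starProjection (u - p) with hc
  have hcV : ∀ z ∈ V, ⟪c, z⟫_ℝ = 0 := fun z hz => V.starProjection_inner_eq_zero (u - p) z hz
  refine ⟨c, ⟪c, p⟫_ℝ, fun z hz => ?_, ?_⟩
  · have := hcV (z - p) (AffineSubspace.vsub_mem_direction hz hp')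
    rw [inner_sub_right] at this
    linarith
  · have hc0 : c ≠ 0 := by
      intro h0
      rw [hc, sub_eq_zero] at h0
      have : u - p ∈ V := h0 ▸ V.starProjection_apply_mem (u - p)
      exact hu (by simpa using AffineSubspace.vadd_mem_of_mem_direction this hp')
    have h1 : ⟪c, u - p⟫_ℝ = ⟪c, c⟫_ℝ := by
      have h2 := hcV _ (V.starProjection_apply_mem (u - p))
      have e : u - p = c + V.starProjection (u - p) := by rw [hc, sub_add_cancel]
      nth_rewrite 1 [e]
      rw [inner_add_right, h2, add_zero]
    have h2 : 0 < ⟪c, c⟫_ℝ := real_inner_self_pos.2 hc0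
    rw [inner_sub_right] at h1
    linarith

end FrankWolfe

/-! ### The min-norm-point algorithm. -/

namespace FrankWolfe

open Set

variable {E : Type*} [NormedAddCommGroup E] [InnerProductSpace ℝ E] [CompleteSpace E]
  {A : Finset E} {f : E → ℝ} {ε : ℝ} {T : ℕ} {τ : CorrectiveTrace E} {xstar : E} {C m : ℝ}

/-! ### The min-norm-point algorithm -/

lemma add_smul_sub_le_of_convexOn {s : Set E} (hf : ConvexOn ℝ s f) {x y : E} (hx : x ∈ s)
    (hy : y ∈ s) (hle : f y ≤ f x) {θ : ℝ} (hθ : θ ∈ Icc (0 : ℝ) 1) :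
    f (x + θ • (y - x)) ≤ f x := by
  have := hf.2 hx hy (sub_nonneg.2 hθ.2) hθ.1 (sub_add_cancel 1 θ)
  rw [show (1 - θ) • x + θ • y = x + θ • (y - x) by module, smul_eq_mul, smul_eq_mul] at this
  nlinarith [mul_le_mul_of_nonneg_left hle hθ.1]

lemma IsAffineMinimizer.le {S : Finset E} {y z : E} (h : IsAffineMinimizer f S y)
    (hz : z ∈ affineSpan ℝ (S : Set E)) : f y ≤ f z := h.2 hz

lemma IsAffineMinimizer.inner_eq_zero {S : Finset E} {x z : E} (h : IsAffineMinimizer f S x)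
    (hd : DifferentiableAt ℝ f x) (hz : z ∈ affineSpan ℝ (S : Set E)) :
    ⟪gradient f x, z - x⟫_ℝ = 0 := by
  have h1 := inner_gradient_nonneg (d := z - x) hd one_pos fun u _ _ =>
    h.le (add_smul_sub_mem_affineSpan h.1 hz u)
  have h2 := inner_gradient_nonneg (d := -(z - x)) hd one_pos fun u _ _ => by
    have := h.le (add_smul_sub_mem_affineSpan h.1 hz (-u))
    rwa [neg_smul, ← smul_neg] at this
  rw [inner_neg_right] at h2
  linarith

/-- What the correction loop guarantees about the point that it returns. -/
lemma MNPCorrection.spec (hconv : ConvexOn ℝ (affineSpan ℝ (A : Set E) : Set E) f) {z y : E}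
    {S W : Finset E} (h : MNPCorrection f z S y W) (hSA : S ⊆ A) (hz : z ∈ domain S) :
    W ⊆ S ∧ IsAffineMinimizer f W y ∧ W ∈ activeSets W y ∧ f y ≤ f z := by
  induction h with
  | finish z S y hy hin =>
    exact ⟨subset_rfl, hy, activeSets_of_mem_intrinsicInterior hin,
      hy.le (domain_subset_affineSpan S hz)⟩
  | minor z S y θ S' y' W hy hout hθ hS' next ih =>
    obtain ⟨h1, h2, h3, h4⟩ := ih (hS'.1.trans hSA) (mem_domain_of_activeSets hS')
    refine ⟨h1.trans hS'.1, h2, h3, h4.trans ?_⟩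
    have hspan : affineSpan ℝ (S : Set E) ≤ affineSpan ℝ (A : Set E) :=
      affineSpan_mono ℝ (Finset.coe_subset.2 hSA)
    have hz' := domain_subset_affineSpan S hz
    -- The affine minimizer may lie outside the domain, so convexity on the affine hull is needed.
    exact add_smul_sub_le_of_convexOn hconv (hspan hz') (hspan hy.1) (hy.le hz') hθ.1.1

/-- A minor cycle removes an atom. -/
lemma card_lt_card_of_minor [FiniteDimensional ℝ E] {S S' : Finset E} {z y : E} {θ : ℝ}
    (hy : y ∈ affineSpan ℝ (S : Set E))
    (hout : y ∉ intrinsicInterior ℝ (convexHull ℝ (S : Set E)))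
    (hθ : IsGreatest {η : ℝ | η ∈ Icc (0 : ℝ) 1 ∧
      z + η • (y - z) ∈ convexHull ℝ (S : Set E)} θ)
    (hS' : S' ∈ activeSets S (z + θ • (y - z))) : S'.card < S.card := by
  refine Finset.card_lt_card (hS'.1.ssubset_of_ne ?_)
  -- If all atoms stayed active, the new point would be relatively interior. Either it is `y`,
  -- against `hout`, or one could move further, against the maximality of `θ`.
  rintro rfl
  rcases hθ.1.1.2.eq_or_lt with h1 | h1
  · rw [h1, one_smul, add_sub_cancel] at hS'
    exact hout (mem_intrinsicInterior_of_activeSets hS')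
  · obtain ⟨η, hη, hmem⟩ := exists_pos_add_smul_mem_domain_of_activeSets hS' hy
    have e : z + θ • (y - z) + η • (y - (z + θ • (y - z)))
        = z + (θ + η * (1 - θ)) • (y - z) := by module
    rw [e] at hmem
    have hpos := mul_pos hη.1 (sub_pos.2 h1)
    have := hθ.2 ⟨⟨by linarith [hθ.1.1.1], by nlinarith [hη.2]⟩, hmem⟩
    linarith

/-- The first minor cycle moves by a positive amount. -/
lemma pos_of_minor [DecidableEq E] (hconv : ConvexOn ℝ (affineSpan ℝ (A : Set E) : Set E) f)
    {S : Finset E} {s x y : E} {θ : ℝ} (hA : insert s S ⊆ A) (hS : S ∈ activeSets S x)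
    (hx : IsAffineMinimizer f S x) (hd : DifferentiableAt ℝ f x)
    (hs : ⟪gradient f x, s - x⟫_ℝ < 0) (hsS : s ∉ S) (hy : IsAffineMinimizer f (insert s S) y)
    (hθ : IsGreatest {η : ℝ | η ∈ Icc (0 : ℝ) 1 ∧
      x + η • (y - x) ∈ convexHull ℝ ((insert s S : Finset E) : Set E)} θ) : 0 < θ := by
  have hspan : affineSpan ℝ ((insert s S : Finset E) : Set E) ≤ affineSpan ℝ (A : Set E) :=
    affineSpan_mono ℝ (Finset.coe_subset.2 hA)
  have hx0 : x ∈ affineSpan ℝ ((insert s S : Finset E) : Set E) :=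
    affineSpan_mono ℝ (Finset.coe_subset.2 (Finset.subset_insert s S)) hx.1
  obtain ⟨b, hb1, hb⟩ := mem_affineSpan_finset.1 hy.1
  -- The slope at `x` vanishes along the affine hull of `S`, so the slope towards `y` is `b s` times
  -- the negative slope towards `s`; by convexity it is nonpositive.
  have hbs : 0 ≤ b s := by
    have h1 : ⟪gradient f x, y - x⟫_ℝ ≤ 0 :=
      (inner_gradient_le hconv (hspan hx0) (hspan hy.1) hd).trans (sub_nonpos.2 (hy.le hx0))
    have h2 : y - x = ∑ v ∈ insert s S, b v • (v - x) := by
      simp only [smul_sub, Finset.sum_sub_distrib, ← Finset.sum_smul, hb1, hb, one_smul]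
    rw [h2, Finset.sum_insert hsS, inner_add_right, inner_sum, Finset.sum_eq_zero, add_zero,
      inner_smul_right] at h1
    · by_contra! hneg
      linarith [mul_pos_of_neg_of_neg hneg hs]
    · intro v hv
      rw [inner_smul_right, hx.inner_eq_zero hd (subset_affineSpan ℝ _ hv), mul_zero]
  obtain ⟨-, w, hw, hw1, hwx⟩ := hS
  have hne : ∀ v ∈ S, v ≠ s := fun v hv h => hsS (h ▸ hv)
  obtain ⟨η, hη, hmem⟩ := exists_pos_add_smul_mem_domain (S := insert s S)
    (w := fun v => if v = s then 0 else w v) (b := b) (x := x) (y := y)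
    (fun v hv => by
      split_ifs with h
      · exact le_rfl
      · exact (hw v ((Finset.mem_insert.1 hv).resolve_left h)).le)
    (by
      rw [Finset.sum_insert hsS, if_pos rfl, zero_add, ← hw1]
      exact Finset.sum_congr rfl fun v hv => if_neg (hne v hv))
    (by
      rw [Finset.sum_insert hsS, if_pos rfl, zero_smul, zero_add, ← hwx]
      exact Finset.sum_congr rfl fun v hv => by rw [if_neg (hne v hv)])
    hb1 hb
    (fun v hv => by
      rcases Finset.mem_insert.1 hv with rfl | hv
      · exact Or.inr hbs
      · exact Or.inl (by rw [if_neg (hne v hv)]; exact hw v hv))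
  exact hη.1.trans_le (hθ.2 ⟨⟨hη.1.le, hη.2.le⟩, hmem⟩)

/-- Minimizing over the affine hull of `S` after a single minor cycle, which removed the atom `u`,
is at least as good as any point of the convex hull of `insert u S`. -/
lemma le_of_single_minor [DecidableEq E] {S : Finset E} {u x y y' p : E} {θ : ℝ}
    (hconv : ConvexOn ℝ (affineSpan ℝ ((insert u S : Finset E) : Set E) : Set E) f)
    (hx : x ∈ domain (insert u S)) (hy : IsAffineMinimizer f (insert u S) y)
    (hθ0 : 0 < θ) (hθ1 : θ ≤ 1) (hz : x + θ • (y - x) ∈ domain S)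
    (hy' : IsAffineMinimizer f S y') (hp : p ∈ domain (insert u S)) : f y' ≤ f p := by
  by_cases hu : u ∈ affineSpan ℝ (S : Set E)
  · refine hy'.le (?_ : p ∈ affineSpan ℝ (S : Set E))
    have hle : affineSpan ℝ ((insert u S : Finset E) : Set E) ≤ affineSpan ℝ (S : Set E) := by
      refine affineSpan_le.2 fun v hv => ?_
      rcases Finset.mem_insert.1 (Finset.mem_coe.1 hv) with rfl | hv
      · exact hu
      · exact subset_affineSpan ℝ _ hv
    exact hle (domain_subset_affineSpan _ hp)
  have huS : u ∉ S := fun h => hu (subset_affineSpan ℝ _ h)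
  -- At level `k` the functional `c` separates the hull of `insert u S` from `y`, because the
  -- segment from `x` towards `y` meets the hull of `S` at `θ > 0`. Hence the segment from `p` to
  -- `y` crosses level `k`, at a point where `f` is at most `f p`.
  obtain ⟨c, k, hck, hcu⟩ := exists_inner_eq_of_notMem_affineSpan (nonempty_of_mem_domain hz) hu
  have hge : ∀ z ∈ domain (insert u S), k ≤ ⟪c, z⟫_ℝ := by
    refine fun z hz => le_inner_of_mem_domain (fun a ha => ?_) hz
    rcases Finset.mem_insert.1 ha with rfl | ha
    · exact hcu.le
    · exact (hck a (subset_affineSpan ℝ _ ha)).ge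
  have hyk : ⟪c, y⟫_ℝ ≤ k := by
    have h1 := hck _ (domain_subset_affineSpan S hz)
    have h2 := hge x hx
    rw [inner_add_right, inner_smul_right, inner_sub_right] at h1
    by_contra! hgt
    nlinarith [mul_pos hθ0 (sub_pos.2 hgt), mul_nonneg (sub_nonneg.2 hθ1) (sub_nonneg.2 h2)]
  have hpk := hge p hp
  have hp' := domain_subset_affineSpan _ hp
  obtain ⟨l, hl, hlk⟩ : ∃ l ∈ Icc (0 : ℝ) 1, ⟪c, p + l • (y - p)⟫_ℝ = k := by
    rcases hpk.eq_or_lt with h | h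
    · exact ⟨0, by simp, by simp [h]⟩
    · have hden : 0 < ⟪c, p⟫_ℝ - ⟪c, y⟫_ℝ := by linarith
      refine ⟨(⟪c, p⟫_ℝ - k) / (⟪c, p⟫_ℝ - ⟪c, y⟫_ℝ),
        ⟨div_nonneg (by linarith) hden.le, (div_le_one hden).2 (by linarith)⟩, ?_⟩
      rw [inner_add_right, inner_smul_right, inner_sub_right, ← neg_sub ⟪c, p⟫_ℝ, mul_neg,
        div_mul_cancel₀ _ hden.ne']
      ring
  have hq := add_smul_sub_mem_affineSpan hp' hy.1 l
  have hqS : p + l • (y - p) ∈ affineSpan ℝ (S : Set E) := by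
    obtain ⟨b, hb1, hb⟩ := mem_affineSpan_finset.1 hq
    -- On level `k` the atom `u`, the only one above it, has coefficient zero, so the crossing point
    -- lies in the affine hull of `S`.
    have hbu : b u = 0 := by
      rw [← hb, inner_sum, Finset.sum_insert huS] at hlk
      have h1 : ∑ v ∈ S, ⟪c, b v • v⟫_ℝ = (∑ v ∈ S, b v) * k := by
        rw [Finset.sum_mul]
        exact Finset.sum_congr rfl fun v hv => by
          rw [inner_smul_right, hck v (subset_affineSpan ℝ _ hv)]
      rw [Finset.sum_insert huS] at hb1
      rw [h1, inner_smul_right, show ∑ v ∈ S, b v = 1 - b u by linarith] at hlk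
      have h2 : b u * (⟪c, u⟫_ℝ - k) = 0 := by linarith
      exact (mul_eq_zero.1 h2).resolve_right (by linarith)
    rw [Finset.sum_insert huS, hbu, zero_add] at hb1
    rw [Finset.sum_insert huS, hbu, zero_smul, zero_add] at hb
    exact mem_affineSpan_finset.2 ⟨b, hb1, hb⟩
  exact (hy'.le hqS).trans (add_smul_sub_le_of_convexOn hconv hp' hy.1 (hy.le hp') hl)

/-- A correction that does not shrink the active set reaches a point that is at least as good as
any point of the convex hull of the active atoms and the new atom. -/
theorem MNPCorrection.le_of_card_le [FiniteDimensional ℝ E] [DecidableEq E]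
    (hconv : ConvexOn ℝ (affineSpan ℝ (A : Set E) : Set E) f) {S W : Finset E} {s x x' : E}
    (h : MNPCorrection f x (insert s S) x' W) (hA : insert s S ⊆ A) (hS : S ∈ activeSets S x)
    (hx : IsAffineMinimizer f S x) (hd : DifferentiableAt ℝ f x)
    (hs : ⟪gradient f x, s - x⟫_ℝ < 0) (hcard : S.card ≤ W.card) {p : E}
    (hp : p ∈ domain (insert s S)) : f x' ≤ f p := by
  have hsS : s ∉ S := fun hmem => by
    rw [hx.inner_eq_zero hd (subset_affineSpan ℝ _ hmem)] at hs
    exact lt_irrefl _ hs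
  have hxD : x ∈ domain (insert s S) :=
    domain_mono (Finset.subset_insert s S) (mem_domain_of_activeSets hS)
  generalize hS₀ : insert s S = S₀ at h
  cases h with
  | finish _ _ _ hy hin =>
    subst hS₀
    exact hy.le (domain_subset_affineSpan _ hp)
  | minor _ _ y θ S₁ _ _ hy hout hθ hS₁ next =>
    subst hS₀
    -- The loop starts with `S.card + 1` atoms and each minor cycle removes at least one. As `S.card
    -- ≤ W.card`, there is at most one cycle, and it removes exactly one atom.
    have hlt := card_lt_card_of_minor hy.1 hout hθ hS₁
    rw [Finset.card_insert_of_notMem hsS] at hlt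
    have hθ0 := pos_of_minor hconv hA hS hx hd hs hsS hy hθ
    have hz₁ := mem_domain_of_activeSets hS₁
    have hA₁ := hS₁.1.trans hA
    generalize hz : x + θ • (y - x) = z at next
    rw [hz] at hz₁
    cases next with
    | finish _ _ _ hy' hin =>
      obtain ⟨u, hu, hins⟩ : ∃ u, u ∉ W ∧ insert u W = insert s S := by
        rw [← Finset.covBy_iff_exists_insert, Finset.covBy_iff_card_sdiff_eq_one]
        refine ⟨hS₁.1, ?_⟩
        rw [Finset.card_sdiff_of_subset hS₁.1, Finset.card_insert_of_notMem hsS]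
        omega
      rw [← hins] at hy hp hxD
      have hle : affineSpan ℝ ((insert u W : Finset E) : Set E) ≤ affineSpan ℝ (A : Set E) :=
        affineSpan_mono ℝ (Finset.coe_subset.2 (hins ▸ hA))
      exact le_of_single_minor (hconv.subset hle (AffineSubspace.convex _)) hxD hy hθ0 hθ.1.1.2
        (hz ▸ hz₁) hy' hp
    | minor _ _ y₂ θ₂ S₂ _ _ hy₂ hout₂ hθ₂ hS₂ next₂ =>
      have hlt₂ := card_lt_card_of_minor hy₂.1 hout₂ hθ₂ hS₂
      have := Finset.card_le_card
        (next₂.spec hconv (hS₂.1.trans hA₁) (mem_domain_of_activeSets hS₂)).1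
      omega

/-- Affine minimality of the iterate makes its away gap zero and forces the next Frank-Wolfe atom to
be new. -/
lemma IsMNP.invariant (h : IsMNP A f ε T τ)
    (hconv : ConvexOn ℝ (affineSpan ℝ (A : Set E) : Set E) f) {t : ℕ} (ht : t ≤ T) :
    τ.S t ⊆ A ∧ τ.S t ∈ activeSets (τ.S t) (τ.x t) ∧ IsAffineMinimizer f (τ.S t) (τ.x t) := by
  classical
  induction t with
  | zero =>
    rw [h.2.1]
    refine ⟨by simpa using h.1, singleton_mem_activeSets (by simp), ?_, fun z hz => ?_⟩
    · exact subset_affineSpan ℝ _ (by simp)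
    · rw [Finset.coe_singleton, SetLike.mem_coe, AffineSubspace.mem_affineSpan_singleton] at hz
      exact (congrArg f hz).ge
  | succ t ih =>
    obtain ⟨hSA, hS, hx⟩ := ih (by omega)
    obtain ⟨hc, hcorr⟩ := h.2.2.2 t ht
    rw [h.2.2.1, h.2.2.1] at hcorr
    have hA : insert (τ.s t) (τ.S t) ⊆ A := Finset.insert_subset hc.1.1 hSA
    obtain ⟨h1, h2, h3, -⟩ := hcorr.spec hconv hA
      (domain_mono (Finset.subset_insert _ _) (mem_domain_of_activeSets hS))
    exact ⟨h1.trans hA, h3, h2⟩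

lemma IsMNP.activeSets (h : IsMNP A f ε T τ)
    (hconv : ConvexOn ℝ (affineSpan ℝ (A : Set E) : Set E) f) {t : ℕ} (ht : t ≤ T) :
    τ.S t ∈ activeSets A (τ.x t) :=
  ⟨(h.invariant hconv ht).1, (h.invariant hconv ht).2.1.2⟩

lemma IsMNP.correction [DecidableEq E] (h : IsMNP A f ε T τ) {t : ℕ} (ht : t < T) :
    MNPCorrection f (τ.x t) (insert (τ.s t) (τ.S t)) (τ.x (t + 1)) (τ.S (t + 1)) := by
  have := (h.2.2.2 t ht).2
  rw [h.2.2.1, h.2.2.1] at this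
  convert this

lemma IsMNP.step (h : IsMNP A f ε T τ)
    (hconv : ConvexOn ℝ (affineSpan ℝ (A : Set E) : Set E) f) {t : ℕ} (ht : t < T) :
    f (τ.x (t + 1)) ≤ f (τ.x t) ∧ (τ.S (t + 1)).card ≤ (τ.S t).card + 1 := by
  classical
  obtain ⟨hSA, hS, hx⟩ := h.invariant hconv ht.le
  have hA : insert (τ.s t) (τ.S t) ⊆ A := Finset.insert_subset (h.2.2.2 t ht).1.1.1 hSA
  obtain ⟨h1, -, -, h4⟩ := (h.correction ht).spec hconv hA
    (domain_mono (Finset.subset_insert _ _) (mem_domain_of_activeSets hS))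
  exact ⟨h4, (Finset.card_le_card h1).trans (Finset.card_insert_le _ _)⟩

lemma IsMNP.countSteps_drop_le (h : IsMNP A f ε T τ)
    (hconv : ConvexOn ℝ (affineSpan ℝ (A : Set E) : Set E) f) {t : ℕ} (ht : t ≤ T) :
    (countSteps τ.Drop 0 t : ℝ) ≤ t / 2 :=
  countSteps_decrease_le (c := fun t => (τ.S t).card) (by simp [h.2.1])
    (fun _ ht => (activeSets_nonempty (h.activeSets hconv ht)).card_pos)
    (fun _ ht => (h.step hconv ht).2) ht

lemma IsMNP.sufficientDecrease [FiniteDimensional ℝ E] (h : IsMNP A f ε T τ) (hε : 0 ≤ ε)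
    (hconv : ConvexOn ℝ (affineSpan ℝ (A : Set E) : Set E) f)
    (hdiff : ∀ x ∈ domain A, DifferentiableAt ℝ f x) (hC : CurvatureBound A f C) {t : ℕ}
    (ht : t < T) (hd : ¬ τ.Drop t) : SufficientDecrease A f C 1 (τ.x t) (τ.x (t + 1)) := by
  classical
  obtain ⟨hSA, hS, hx⟩ := h.invariant hconv ht.le
  have hSA' := h.activeSets hconv ht.le
  have hc := (h.2.2.2 t ht).1
  have hdx := hdiff _ (mem_domain_of_activeSets' hSA')
  have hpos := hε.trans_lt hc.2
  refine .of_corrective hC hSA' hc.1 hpos (fun v hv => ?_) fun η hη => ?_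
  · have := hx.inner_eq_zero hdx (subset_affineSpan ℝ _ hv)
    rw [← neg_sub, inner_neg_right, inner_neg_left, this]
    simp
  · rw [inner_neg_left] at hpos
    refine (h.correction ht).le_of_card_le hconv (Finset.insert_subset hc.1.1 hSA) hS hx hdx
      (by linarith) (not_lt.1 hd) ((convex_domain _).add_smul_sub_mem ?_ ?_ hη)
    · exact domain_mono (Finset.subset_insert _ _) (mem_domain_of_activeSets hS)
    · exact mem_domain_of_mem (Finset.mem_insert_self _ _)

theorem IsMNP.rates [FiniteDimensional ℝ E] (h : IsMNP A f ε T τ) (hε : 0 ≤ ε)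
    (haff : ConvexOn ℝ (affineSpan ℝ (A : Set E) : Set E) f)
    (hconv : ConvexOn ℝ (domain A) f)
    (hdiff : ∀ x ∈ domain A, DifferentiableAt ℝ f x) (hmem : xstar ∈ domain A)
    (hmin : IsMinOn f (domain A) xstar) (hC : CurvatureBound A f C)
    (hm : m ∈ lowerBounds (strongConvexitySet A f)) :
    LinearRate (subopt f xstar τ.x) (fun i => ¬ τ.Drop i) T (min (1 / 2) (m / C)) ∧
    LinearRate (subopt f xstar τ.x) (fun i => ¬ τ.Drop i) T (m / (4 * C)) ∧
    SublinearRate2 (subopt f xstar τ.x) (fun i => ¬ τ.Drop i) T C :=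
  have hx : ∀ t ≤ T, τ.x t ∈ domain A := fun _ ht =>
    mem_domain_of_activeSets' (h.activeSets haff ht)
  have hmono : ∀ t < T, f (τ.x (t + 1)) ≤ f (τ.x t) := fun _ ht => (h.step haff ht).1
  have hgood := fun t ht hg => h.sufficientDecrease hε haff hdiff hC (t := t) ht hg
  ⟨linearRate_min hconv hdiff hmem hmin hm hx hmono hgood,
    linearRate_quarter hconv hdiff hmem hmin hC hm hx hmono fun t ht hg => (hgood t ht hg).two,
    sublinearRate2 hconv hdiff hmem hC.1 hx hmono hgood⟩

/-- Exhibits the Euclidean rate as `m / (4 * C)` with `m = μ * pyramidalWidth A ^ 2` and `C = L *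
Metric.diam (domain A) ^ 2`; zero denominators follow the same convention on both sides. -/
lemma euclideanRate_eq (A : Finset E) (L μ : ℝ) :
    euclideanRate A L μ
      = μ * pyramidalWidth A ^ 2 / (4 * (L * Metric.diam (domain A) ^ 2)) := by
  unfold euclideanRate
  rw [div_pow, div_mul_div_comm, mul_assoc]

end FrankWolfe


/-! ### Assembly of the rates. -/

open FrankWolfe in
theorem theorem1 (n : ℕ) (A : Finset (EuclideanSpace ℝ (Fin n)))
    (f : EuclideanSpace ℝ (Fin n) → ℝ)
    (hconv : ConvexOn ℝ (domain A) f)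
    (hdiff : ∀ x ∈ domain A, DifferentiableAt ℝ f x)
    (xstar : EuclideanSpace ℝ (Fin n)) (hmem : xstar ∈ domain A)
    (hmin : IsMinOn f (domain A) xstar)
    (ε : ℝ) (hε : 0 ≤ ε) (T : ℕ) :
    -- away-steps Frank-Wolfe
    (∀ τ : LineSearchTrace (EuclideanSpace ℝ (Fin n)), IsAFW A f ε T τ →
      (∀ t < T, ¬ τ.Drop A t → τ.Good t) ∧
      (∀ t ≤ T, (countSteps (τ.Drop A) 0 t : ℝ) ≤ t / 2) ∧
      (∀ t ≤ T, (t : ℝ) / 2 ≤ countSteps τ.Good 0 t) ∧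
      (BddAbove (awayCurvatureSet A f) →
        LinearRate (subopt f xstar τ.x) τ.Good T
          (geometricStrongConvexity A f / (4 * awayCurvature A f)) ∧
        (∀ t ≤ T, subopt f xstar τ.x t ≤ subopt f xstar τ.x 0 * Real.exp
          (-(1 / 2) * (geometricStrongConvexity A f / (4 * awayCurvature A f)) * t)) ∧
        SublinearRate4 (subopt f xstar τ.x) τ.Good T
          (2 * awayCurvature A f + subopt f xstar τ.x 0)) ∧
      (∀ (L : NNReal) (μ : ℝ), 0 ≤ μ → StrongConvexOn (domain A) μ f →
        (∀ x ∈ awayDomain A, DifferentiableAt ℝ f x) →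
        LipschitzOnWith L (gradient f) (awayDomain A) →
        LinearRate (subopt f xstar τ.x) τ.Good T (euclideanRate A L μ) ∧
        SublinearRate4 (subopt f xstar τ.x) τ.Good T
          (2 * (L * Metric.diam (domain A) ^ 2) + subopt f xstar τ.x 0))) ∧
    -- pairwise Frank-Wolfe
    (∀ τ : LineSearchTrace (EuclideanSpace ℝ (Fin n)), IsPFW A f ε T τ →
      (∀ t < T, ¬ τ.Drop A t → ¬ τ.Swap A t → τ.Good t) ∧
      (∀ t ≤ T, (countSteps (τ.Drop A) 0 t : ℝ) ≤ t / 2) ∧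
      (∀ a b : ℕ, a ≤ b → b ≤ T → (∀ t, a ≤ t → t < b → ¬ τ.γ t < τ.γmax t) →
        countSteps (τ.Swap A) a b ≤ 3 * A.card.factorial) ∧
      (∀ t ≤ T, (t : ℝ) / (3 * A.card.factorial + 1) ≤ countSteps τ.Good 0 t) ∧
      (BddAbove (awayCurvatureSet A f) →
        LinearRate (subopt f xstar τ.x) τ.Good T
          (min (1 / 2) (geometricStrongConvexity A f / awayCurvature A f)) ∧
        SublinearRate2 (subopt f xstar τ.x) τ.Good T (awayCurvature A f)) ∧
      (∀ (L : NNReal) (μ : ℝ), 0 ≤ μ → StrongConvexOn (domain A) μ f →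
        (∀ x ∈ awayDomain A, DifferentiableAt ℝ f x) →
        LipschitzOnWith L (gradient f) (awayDomain A) →
        LinearRate (subopt f xstar τ.x) τ.Good T (euclideanRate A L μ) ∧
        SublinearRate2 (subopt f xstar τ.x) τ.Good T
          (L * Metric.diam (domain A) ^ 2))) ∧
    -- fully-corrective Frank-Wolfe with approximate correction: every step is good
    (∀ τ : CorrectiveTrace (EuclideanSpace ℝ (Fin n)), IsFCFW A f ε T τ →
      (∀ t ≤ T, countSteps (fun _ => True) 0 t = t) ∧
      (BddAbove (curvatureSet A f) →
        LinearRate (subopt f xstar τ.x) (fun _ => True) T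
          (geometricStrongConvexity A f / (4 * curvature A f)) ∧
        SublinearRate4 (subopt f xstar τ.x) (fun _ => True) T
          (2 * curvature A f + subopt f xstar τ.x 0)) ∧
      (∀ (L : NNReal) (μ : ℝ), 0 ≤ μ → StrongConvexOn (domain A) μ f →
        LipschitzOnWith L (gradient f) (domain A) →
        LinearRate (subopt f xstar τ.x) (fun _ => True) T (euclideanRate A L μ) ∧
        SublinearRate4 (subopt f xstar τ.x) (fun _ => True) T
          (2 * (L * Metric.diam (domain A) ^ 2) + subopt f xstar τ.x 0))) ∧
    -- fully-corrective Frank-Wolfe with exact correction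
    (∀ τ : CorrectiveTrace (EuclideanSpace ℝ (Fin n)), IsFCFWExact A f ε T τ →
      BddAbove (curvatureSet A f) →
        LinearRate (subopt f xstar τ.x) (fun _ => True) T
          (min (1 / 2) (geometricStrongConvexity A f / curvature A f))) ∧
    -- min-norm-point algorithm, where f is convex over the affine hull of the atoms
    (ConvexOn ℝ (affineSpan ℝ (A : Set (EuclideanSpace ℝ (Fin n))) : Set _) f →
      ∀ τ : CorrectiveTrace (EuclideanSpace ℝ (Fin n)), IsMNP A f ε T τ →
      (∀ t ≤ T, (countSteps τ.Drop 0 t : ℝ) ≤ t / 2) ∧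
      (∀ t ≤ T, (t : ℝ) / 2 ≤ countSteps (fun i => ¬ τ.Drop i) 0 t) ∧
      (BddAbove (curvatureSet A f) →
        LinearRate (subopt f xstar τ.x) (fun i => ¬ τ.Drop i) T
          (min (1 / 2) (geometricStrongConvexity A f / curvature A f)) ∧
        (∀ t ≤ T, subopt f xstar τ.x t ≤ subopt f xstar τ.x 0 * Real.exp
          (-(1 / 2) * min (1 / 2) (geometricStrongConvexity A f / curvature A f) * t)) ∧
        SublinearRate2 (subopt f xstar τ.x) (fun i => ¬ τ.Drop i) T (curvature A f)) ∧
      (∀ (L : NNReal) (μ : ℝ), 0 ≤ μ → StrongConvexOn (domain A) μ f →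
        LipschitzOnWith L (gradient f) (domain A) →
        LinearRate (subopt f xstar τ.x) (fun i => ¬ τ.Drop i) T (euclideanRate A L μ) ∧
        SublinearRate2 (subopt f xstar τ.x) (fun i => ¬ τ.Drop i) T
          (L * Metric.diam (domain A) ^ 2))) := by
  have hA := nonempty_of_mem_domain hmem
  have hμA := geometricStrongConvexity_mem_lowerBounds hconv hdiff
  have hμA0 := geometricStrongConvexity_nonneg hconv hdiff
  refine ⟨fun τ h => ?_, fun τ h => ?_, fun τ h => ?_, fun τ h hb => ?_, fun haff τ h => ?_⟩
  · have hx0 := (h.weightsValid (Nat.zero_le T)).mem_domain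
    refine ⟨fun t ht => h.good_of_not_drop hε ht, fun t ht => h.countSteps_drop_le ht,
      fun t ht => h.half_le_countSteps_good hε ht, fun hb => ?_, fun L μ hμ hsc hd hL => ?_⟩
    · have hC := awayCurvatureBound_of_bddAbove hA hb
      obtain ⟨h1, h2⟩ := h.rates hε hconv hdiff hmem hmin hC hμA
      refine ⟨h1, fun t ht => h1.le_exp_half (subopt_nonneg hmin hx0) ?_ ht
        (h.half_le_countSteps_good hε ht), h2⟩
      have := hC.1
      positivity
    · rw [euclideanRate_eq]
      exact h.rates hε hconv hdiff hmem hmin (awayCurvatureBound_of_lipschitz hd hL)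
        (mul_pyramidalWidth_sq_mem_lowerBounds hdiff hμ hsc)
  · refine ⟨fun t ht => h.good_of_not_drop_of_not_swap hε ht, fun t ht => h.countSteps_drop_le ht,
      fun a b _ hbT hγ => (countSteps_le_sub _ a b).trans (h.run_length_le hε hdiff hbT hγ),
      fun t ht => h.div_le_countSteps_good hε hdiff ht, fun hb => ?_,
      fun L μ hμ hsc hd hL => ?_⟩
    · obtain ⟨h1, -, h2⟩ := h.rates hε hconv hdiff hmem hmin
        (awayCurvatureBound_of_bddAbove hA hb) hμA
      exact ⟨h1, h2⟩
    · rw [euclideanRate_eq]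
      exact (h.rates hε hconv hdiff hmem hmin (awayCurvatureBound_of_lipschitz hd hL)
        (mul_pyramidalWidth_sq_mem_lowerBounds hdiff hμ hsc)).2
  · refine ⟨fun t _ => countSteps_true t, fun hb => ?_, fun L μ hμ hsc hL => ?_⟩
    · exact h.rates hε hconv hdiff hmem hmin (curvatureBound_of_bddAbove hA hb) hμA
    · rw [euclideanRate_eq]
      exact h.rates hε hconv hdiff hmem hmin (curvatureBound_of_lipschitz hdiff hL)
        (mul_pyramidalWidth_sq_mem_lowerBounds hdiff hμ hsc)
  · exact h.rate hε hconv hdiff hmem hmin (curvatureBound_of_bddAbove hA hb) hμA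
  · have hx0 := mem_domain_of_activeSets' (h.activeSets haff (Nat.zero_le T))
    have hhalf : ∀ t ≤ T, (t : ℝ) / 2 ≤ countSteps (fun i => ¬ τ.Drop i) 0 t :=
      fun t ht => half_le_countSteps_not (h.countSteps_drop_le haff ht)
    refine ⟨fun t ht => h.countSteps_drop_le haff ht, hhalf, fun hb => ?_,
      fun L μ hμ hsc hL => ?_⟩
    · have hC := curvatureBound_of_bddAbove hA hb
      obtain ⟨h1, -, h2⟩ := h.rates hε haff hconv hdiff hmem hmin hC hμA
      exact ⟨h1, fun t ht => h1.le_exp_half (subopt_nonneg hmin hx0)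
        (le_min (by norm_num) (div_nonneg hμA0 hC.1)) ht (hhalf t ht), h2⟩
    · rw [euclideanRate_eq]
      exact (h.rates hε haff hconv hdiff hmem hmin (curvatureBound_of_lipschitz hdiff hL)
        (mul_pyramidalWidth_sq_mem_lowerBounds hdiff hμ hsc)).2
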